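/- Let $\Sigma$ be a smooth two-dimensional manifold and $(M,\mathcal P)$ a smooth $n$-dimensional Poisson manifold (both Hausdorff, second countable, without boundary). Let $C^\sigma$ ($\sigma=1,\dots,m$) be smooth Casimir functions on $M$ and $\varepsilon_\sigma$ smooth 2-forms on $\Sigma$. The fields of the almost topological Poisson Sigma Model are a map $X:\Sigma\to M$ and a 1-form $A$ on $\Sigma$ with values in $X^*T^*M$; a solution is a smooth pair $(X,A)$ which in all local coordinates satisfies $$\mathrm dX^i+\mathcal P^{ij}(X)A_j=0,\qquad \mathrm dA_i+\tfrac12\,\partial_i\mathcal P^{kl}(X)\,A_k\wedge A_l+\sum_\sigma \partial_iC^{\sigma}(X)\,\varepsilon_\sigma=0 .$$ Gauge equivalence is the equivalence relation on solutions generated by integrating (along smooth one-parameter families of solutions) the infinitesimal symmetries $\delta X^i=\epsilon_j\mathcal P^{ji}(X)$, $\delta A_i=\mathrm d\epsilon_i+\partial_i\mathcal P^{kl}(X)A_k\epsilon_l$ with smooth parameters $\epsilon_t\in\Gamma(X_t^*T^*M)$. Let $L$ be a symplectic leaf of $\mathcal P$ of codimension $k$ which is regular and embedded, i.e. $\dim\ker\mathcal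 P=k$ along $L$ and near each of its points $L$ is the common zero set of $k$ independent Casimir functions, and which has trivial holonomy, i.e. continuing the germ of such a system of local Casimir functions along any loop in $L$ gives back the same germ. Let $U$ be an open neighbourhood of $L$ with a compatible presymplectic form $\widetilde\Omega$: a closed 2-form on $U$ which restricts on the tangent spaces of the symplectic leaves to the leaf symplectic form, with the convention $\mathcal P^{\alpha\beta}\widetilde\Omega_{\beta\gamma}=\delta^\alpha_\gamma$ along the leaves. Let $X:\Sigma\to M$ be a smooth map with $X(\Sigma)\subset L$. Then there are an open neighbourhood $W\subset U$ of $L$ and Casimir functions $C^1,\dots,C^k$ on $W$, with differentials linearly independent along $L$, such that $L=(C^1,\dots,C^k)^{-1}(0)$. Moreover, for every choice of such functions $C^I$ on an open neighbourhood of $L$: (1) There are unique constants $C^\sigma{}_{,I}$ with $\mathrm dC^\sigma=\sum_I C^\sigma{}_{,I}\,\mathrm dC^I$ along $L$. Put $\varepsilon_I:=\sum_\sigma C^\sigma{}_{,I}\,\varepsilon_\sigma$. Suppose in addition that $\varepsilon_I=\mathrm dp_I$ with smooth 1-forms $p_I$ on $\Sigma$, $I=1,\dots,k$. Then: (2) For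 a 1-form $A$ on $\Sigma$ with values in $X^*T^*M$, the pair $(X,A)$ is a solution if and only if $$A_i=-X^*(\partial_i\lrcorner\widetilde\Omega)+\sum_I\alpha_I\,X^*(\partial_iC^I)$$ with smooth 1-forms $\alpha_I$ on $\Sigma$ such that every $\alpha_I+p_I$ is closed; the $\alpha_I$ are then unique. (3) For fixed $\widetilde\Omega$ and $C^I$, changing the $\alpha_I$ of a solution by exact 1-forms on $\Sigma$ is a gauge transformation. (4) For the fixed map $X$, the assignment $A\mapsto([\alpha_I+p_I])_{I=1,\dots,k}$ induces a bijection from the set of gauge equivalence classes of solutions $A$ onto $H^1(\Sigma)^k$, where $H^1(\Sigma)$ is the first de Rham cohomology over $\mathbb R$. -/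

import Mathlib

open scoped Manifold ContDiff Topology

noncomputable section

namespace PSM

/-! ### Components in charts

A smooth `d`-manifold is modelled on `EuclideanSpace ℝ (Fin d)`; charts range over the whole
smooth maximal atlas. Tensors are described by their components in charts. -/

section Charts

variable (d : ℕ) (N : Type*) [TopologicalSpace N] [ChartedSpace (EuclideanSpace ℝ (Fin d)) N]

/-- The smooth charts (coordinate systems) of `N`. -/
def charts : Set (OpenPartialHomeomorph N (EuclideanSpace ℝ (Fin d))) :=
  IsManifold.maximalAtlas (𝓡 d) ∞ N

end Charts

section Forms

variable {d : ℕ} {N : Type*} [TopologicalSpace N] [ChartedSpace (EuclideanSpace ℝ (Fin d)) N]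

/-- `coordVec φ x v = v^i ∂_i` at the point `x`, where `∂_i` are the coordinate vector fields of
the chart `φ` (meaningful for `x` in the domain of `φ`). -/
def coordVec (φ : OpenPartialHomeomorph N (EuclideanSpace ℝ (Fin d))) (x : N) :
    EuclideanSpace ℝ (Fin d) →L[ℝ] TangentSpace (𝓡 d) x :=
  mfderiv (𝓡 d) (𝓡 d) φ.symm (φ x)

/-- `coordCovec φ x a = a_i dx^i` at the point `x`, where `x^i` are the coordinate functions of
the chart `φ`. -/
def coordCovec (φ : OpenPartialHomeomorph N (EuclideanSpace ℝ (Fin d)))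
    (a : EuclideanSpace ℝ (Fin d) →L[ℝ] ℝ) (x : N) : TangentSpace (𝓡 d) x →L[ℝ] ℝ :=
  mvfderiv (𝓡 d) (fun y => a (φ y)) x

/-- A (not necessarily smooth) field of covectors. -/
abbrev CovectorField (d : ℕ) (N : Type*) [TopologicalSpace N]
    [ChartedSpace (EuclideanSpace ℝ (Fin d)) N] : Type _ :=
  ∀ x : N, TangentSpace (𝓡 d) x →L[ℝ] ℝ

/-- A (not necessarily smooth or alternating) field of bilinear forms. -/
abbrev BilinField (d : ℕ) (N : Type*) [TopologicalSpace N]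
    [ChartedSpace (EuclideanSpace ℝ (Fin d)) N] : Type _ :=
  ∀ x : N, TangentSpace (𝓡 d) x →L[ℝ] (TangentSpace (𝓡 d) x →L[ℝ] ℝ)

/-- Component `u ↦ α_i(u) v^i` of a covector field in the chart `φ`. -/
def comp₁ (α : CovectorField d N) (φ : OpenPartialHomeomorph N (EuclideanSpace ℝ (Fin d)))
    (v u : EuclideanSpace ℝ (Fin d)) : ℝ :=
  α (φ.symm u) (coordVec φ (φ.symm u) v)

/-- Component `u ↦ τ_ij(u) v^i w^j` of a field of bilinear forms in the chart `φ`. -/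
def comp₂ (τ : BilinField d N) (φ : OpenPartialHomeomorph N (EuclideanSpace ℝ (Fin d)))
    (v w u : EuclideanSpace ℝ (Fin d)) : ℝ :=
  τ (φ.symm u) (coordVec φ (φ.symm u) v) (coordVec φ (φ.symm u) w)

/-- Smooth 1-forms. -/
def IsSmooth₁ (α : CovectorField d N) : Prop :=
  ∀ φ ∈ charts d N, ∀ v, ContDiffOn ℝ ∞ (comp₁ α φ v) φ.target

/-- Smooth 2-forms on an open set `U`. -/
def IsTwoFormOn (U : Set N) (τ : BilinField d N) : Prop :=
  (∀ x ∈ U, ∀ v, τ x v v = 0) ∧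
  ∀ φ ∈ charts d N, ∀ v w, ContDiffOn ℝ ∞ (comp₂ τ φ v w) (φ.target ∩ φ.symm ⁻¹' U)

/-- `dα = τ` for a 1-form `α`: in every chart, `∂_v α(w) - ∂_w α(v) = τ(v, w)`. -/
def HasExtDeriv₁ (α : CovectorField d N) (τ : BilinField d N) : Prop :=
  ∀ φ ∈ charts d N, ∀ u ∈ φ.target, ∀ v w,
    fderiv ℝ (comp₁ α φ w) u v - fderiv ℝ (comp₁ α φ v) u w = comp₂ τ φ v w u

theorem comp₁_differentiableAt {α : CovectorField d N} (hα : IsSmooth₁ α)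
    {φ : OpenPartialHomeomorph N (EuclideanSpace ℝ (Fin d))} (hφ : φ ∈ charts d N)
    {u : EuclideanSpace ℝ (Fin d)} (hu : u ∈ φ.target) (v : EuclideanSpace ℝ (Fin d)) :
    DifferentiableAt ℝ (comp₁ α φ v) u :=
  ((hα φ hφ v).contDiffAt (φ.open_target.mem_nhds hu)).differentiableAt (by simp)

/-- `dτ = 0` on the open set `U`, for a 2-form `τ`. -/
def IsClosedTwoFormOn (U : Set N) (τ : BilinField d N) : Prop :=
  ∀ φ ∈ charts d N, ∀ u ∈ φ.target, φ.symm u ∈ U → ∀ v w z,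
    fderiv ℝ (comp₂ τ φ w z) u v + fderiv ℝ (comp₂ τ φ z v) u w
      + fderiv ℝ (comp₂ τ φ v w) u z = 0

end Forms

/-! ### First de Rham cohomology -/

section Subquotient

variable {V : Type*} [AddCommGroup V] [Module ℝ V] (Z B : Submodule ℝ V)

/-- The vector space `Z / (Z ∩ B)`. -/
abbrev Subquotient : Type _ := Z ⧸ B.submoduleOf Z

/-- The projection `Z → Z / (Z ∩ B)`. -/
def Subquotient.mk : Z →ₗ[ℝ] Subquotient Z B := (B.submoduleOf Z).mkQ

end Subquotient

section DeRham

variable (d : ℕ) (N : Type*) [TopologicalSpace N] [ChartedSpace (EuclideanSpace ℝ (Fin d)) N]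

/-- The space of closed smooth 1-forms. -/
def closedForms : Submodule ℝ (CovectorField d N) where
  carrier := {α | IsSmooth₁ α ∧ HasExtDeriv₁ α 0}
  zero_mem' := by
    have h0 : ∀ (φ : OpenPartialHomeomorph N (EuclideanSpace ℝ (Fin d))) v,
        comp₁ (0 : CovectorField d N) φ v = fun _ => 0 := fun φ v => rfl
    refine ⟨fun φ _ v => ?_, fun φ _ u _ v w => ?_⟩
    · rw [h0]; exact contDiffOn_const
    · simp [h0, comp₂]
  add_mem' := by
    rintro α β ⟨hα, hα'⟩ ⟨hβ, hβ'⟩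
    have hadd : ∀ (φ : OpenPartialHomeomorph N (EuclideanSpace ℝ (Fin d))) v,
        comp₁ (α + β) φ v = comp₁ α φ v + comp₁ β φ v := fun φ v => rfl
    refine ⟨fun φ hφ v => ?_, fun φ hφ u hu v w => ?_⟩
    · rw [hadd]; exact (hα φ hφ v).add (hβ φ hφ v)
    · have dα := fun v => comp₁_differentiableAt hα hφ hu v
      have dβ := fun v => comp₁_differentiableAt hβ hφ hu v
      have h1 := hα' φ hφ u hu v w
      have h2 := hβ' φ hφ u hu v w
      rw [hadd, hadd, fderiv_add (dα w) (dβ w), fderiv_add (dα v) (dβ v)]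
      simp only [comp₂, Pi.zero_apply, _root_.zero_apply,
        _root_.add_apply] at h1 h2 ⊢
      linarith
  smul_mem' := by
    rintro r α ⟨hα, hα'⟩
    have hsm : ∀ (φ : OpenPartialHomeomorph N (EuclideanSpace ℝ (Fin d))) v,
        comp₁ (r • α) φ v = r • comp₁ α φ v := fun φ v => rfl
    refine ⟨fun φ hφ v => ?_, fun φ hφ u hu v w => ?_⟩
    · rw [hsm]; exact (hα φ hφ v).const_smul r
    · have dα := fun v => comp₁_differentiableAt hα hφ hu v
      have h1 := hα' φ hφ u hu v w
      rw [hsm, hsm, fderiv_const_smul (dα w), fderiv_const_smul (dα v)]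
      simp only [comp₂, Pi.zero_apply, _root_.zero_apply,
        _root_.smul_apply, smul_eq_mul] at h1 ⊢
      rw [← mul_sub, h1, mul_zero]

/-- The space of exact 1-forms `df`, `f` a smooth function. -/
def exactForms : Submodule ℝ (CovectorField d N) where
  carrier := {α | ∃ f : N → ℝ, ContMDiff (𝓡 d) 𝓘(ℝ, ℝ) ∞ f ∧ α = fun x => mvfderiv (𝓡 d) f x}
  zero_mem' := ⟨fun _ => 0, contMDiff_const, by funext x; exact (mvfderiv_const (0 : ℝ)).symm⟩
  add_mem' := by
    rintro _ _ ⟨f, hf, rfl⟩ ⟨g, hg, rfl⟩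
    refine ⟨f + g, hf.add hg, ?_⟩
    funext x
    exact (mvfderiv_add (hf.mdifferentiableAt (by simp)) (hg.mdifferentiableAt (by simp))).symm
  smul_mem' := by
    rintro r _ ⟨f, hf, rfl⟩
    refine ⟨fun x => r * f x, contMDiff_const.mul hf, ?_⟩
    funext x
    have h := mvfderiv_mul (I := 𝓡 d) (x := x) (f := fun _ : N => r) (g := f)
      mdifferentiableAt_const (hf.mdifferentiableAt (by simp))
    rw [mvfderiv_const, smul_zero, add_zero] at h
    exact h.symm

/-- First de Rham cohomology: closed 1-forms modulo exact 1-forms. -/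
abbrev H1 : Type _ := Subquotient (closedForms d N) (exactForms d N)

variable {d N} in
/-- The cohomology class `[α]` of a closed 1-form. -/
def H1.mk (α : CovectorField d N) (hα : α ∈ closedForms d N) : H1 d N :=
  Subquotient.mk (closedForms d N) (exactForms d N) ⟨α, hα⟩

end DeRham

/-! ### Poisson manifolds -/

section Poisson

variable (n : ℕ) (M : Type*) [TopologicalSpace M] [ChartedSpace (EuclideanSpace ℝ (Fin n)) M]

/-- A Poisson tensor `𝒫`, given by the bundle map `T^*M → TM`, `a ↦ 𝒫^{ij} a_j ∂_i`.
Thus `𝒫(a, b) = 𝒫^{ij} a_i b_j = a (sharp b)`. -/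
structure PoissonTensor where
  /-- `(sharp a)^i = 𝒫^{ij} a_j` -/
  sharp : ∀ x : M, (TangentSpace (𝓡 n) x →L[ℝ] ℝ) →L[ℝ] TangentSpace (𝓡 n) x
  skew : ∀ (x : M) (a b : TangentSpace (𝓡 n) x →L[ℝ] ℝ), a (sharp x b) = - b (sharp x a)
  smooth : ∀ ψ ∈ charts n M, ∀ a b, ContDiffOn ℝ ∞
    (fun y => coordCovec ψ a (ψ.symm y) (sharp (ψ.symm y) (coordCovec ψ b (ψ.symm y)))) ψ.target
  /-- the Jacobi identity `𝒫^{il} 𝒫^{jk}_{,l} + cycl(ijk) = 0` in every chart -/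
  jacobi : ∀ ψ ∈ charts n M, ∀ x ∈ ψ.source, ∀ a b c,
    let D := fun a b c : EuclideanSpace ℝ (Fin n) →L[ℝ] ℝ =>
      fderiv ℝ (fun y =>
        coordCovec ψ b (ψ.symm y) (sharp (ψ.symm y) (coordCovec ψ c (ψ.symm y)))) (ψ x)
        (mfderiv (𝓡 n) (𝓡 n) ψ x (sharp x (coordCovec ψ a x)))
    D a b c + D b c a + D c a b = 0

variable {n M}
variable (P : PoissonTensor n M)

/-- Component `y ↦ 𝒫^{ij}(y) a_i b_j` of the Poisson tensor in the chart `ψ`. -/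
def PoissonTensor.comp (ψ : OpenPartialHomeomorph M (EuclideanSpace ℝ (Fin n)))
    (a b : EuclideanSpace ℝ (Fin n) →L[ℝ] ℝ) (y : EuclideanSpace ℝ (Fin n)) : ℝ :=
  coordCovec ψ a (ψ.symm y) (P.sharp (ψ.symm y) (coordCovec ψ b (ψ.symm y)))

/-- The number `𝒫^{kl}_{,i}(x) e^i a_k b_l` computed in the chart `ψ`, for covectors
`a`, `b` at `x`. -/
def PoissonTensor.dComp (ψ : OpenPartialHomeomorph M (EuclideanSpace ℝ (Fin n))) (x : M)
    (e : EuclideanSpace ℝ (Fin n)) (a b : TangentSpace (𝓡 n) x →L[ℝ] ℝ) : ℝ :=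
  fderiv ℝ (P.comp ψ (a.comp (coordVec ψ x)) (b.comp (coordVec ψ x))) (ψ x) e

/-- `f` is a (smooth) Casimir function on the open set `W`. -/
def IsCasimirOn (W : Set M) (f : M → ℝ) : Prop :=
  ContMDiffOn (𝓡 n) 𝓘(ℝ, ℝ) ∞ f W ∧ ∀ x ∈ W, P.sharp x (mvfderiv (𝓡 n) f x) = 0

/-- `y` is reached from `x` along a smooth curve `γ` whose velocity is `𝒫^{ij} η_j` for a smooth
covector field `η` along `γ`. -/
def CotangentStep (x y : M) : Prop :=
  ∃ (γ : ℝ → M) (η : ∀ t, TangentSpace (𝓡 n) (γ t) →L[ℝ] ℝ),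
    ContMDiff 𝓘(ℝ, ℝ) (𝓡 n) ∞ γ ∧
    (∀ ψ ∈ charts n M, ∀ e,
      ContDiffOn ℝ ∞ (fun t => η t (coordVec ψ (γ t) e)) (γ ⁻¹' ψ.source)) ∧
    (∀ t, mfderiv 𝓘(ℝ, ℝ) (𝓡 n) γ t (1 : ℝ) = P.sharp (γ t) (η t)) ∧
    γ 0 = x ∧ γ 1 = y

/-- Symplectic leaves: the classes of points that can be joined by finitely many
cotangent curves. -/
def IsSymplecticLeaf (L : Set M) : Prop :=
  ∃ x₀, L = {y | Relation.EqvGen (CotangentStep P) x₀ y}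

/-- `C^1, …, C^k` are Casimir functions on the open set `W`, independent along `L`, and
`L ∩ W = (C^I)⁻¹(0)`. -/
structure IsDefining {k : ℕ} (L W : Set M) (C : Fin k → M → ℝ) : Prop where
  isOpen : IsOpen W
  casimir : ∀ I, IsCasimirOn P W (C I)
  indep : ∀ x ∈ L ∩ W, LinearIndependent ℝ (fun I => mvfderiv (𝓡 n) (C I) x)
  zeroSet : L ∩ W = {x ∈ W | ∀ I, C I x = 0}

/-- `L` is a regular (embedded) symplectic leaf of codimension `k`: the kernel of `𝒫` has
dimension `k` along `L`, and near each of its points `L` is the zero set of `k` independent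
Casimir functions (the transversal coordinates of a foliated chart). -/
structure IsRegularLeaf (k : ℕ) (L : Set M) : Prop where
  leaf : IsSymplecticLeaf P L
  corank : ∀ x ∈ L, Module.finrank ℝ (LinearMap.ker (P.sharp x).toLinearMap) = k
  foliated : ∀ x ∈ L, ∃ (V : Set M) (D : Fin k → M → ℝ), x ∈ V ∧ IsDefining P L V D

/-- `c` assigns to each `t ∈ [0,1]` (the germ at `γ t` of) transversal coordinates, continued
along `γ`: near each parameter value all these germs come from one defining system. -/
def IsContinuation (k : ℕ) (L : Set M) (γ : C(unitInterval, M))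
    (c : unitInterval → Fin k → M → ℝ) : Prop :=
  ∀ t₀, ∃ (V : Set M) (D : Fin k → M → ℝ), γ t₀ ∈ V ∧ IsDefining P L V D ∧
    ∀ᶠ t in 𝓝 t₀, ∀ I, c t I =ᶠ[𝓝 (γ t)] D I

/-- Trivial holonomy of a regular leaf: continuing a germ of transversal coordinates along any
loop in the leaf leads back to the same germ (i.e. every loop has trivial holonomy germ). -/
def HasTrivialHolonomy (k : ℕ) (L : Set M) : Prop :=
  ∀ (γ : C(unitInterval, M)) (c : unitInterval → Fin k → M → ℝ),
    (∀ t, γ t ∈ L) → γ 0 = γ 1 → IsContinuation P k L γ c →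
    ∀ I, c 0 I =ᶠ[𝓝 (γ 0)] c 1 I

/-- `Ω` is a presymplectic form on the open set `U` compatible with `𝒫`: a closed 2-form which on
vectors tangent to the leaves, i.e. in the image of `𝒫`, is the symplectic form of the leaf. The
leaf form is the inverse matrix of `𝒫`, `𝒫^{αβ} Ω_{βγ} = δ^α_γ`, that is
`Ω(𝒫a, 𝒫b) = 𝒫(b, a)`. -/
structure IsCompatiblePresymplectic (U : Set M) (Ω : BilinField n M) : Prop where
  twoForm : IsTwoFormOn U Ω
  closed : IsClosedTwoFormOn U Ω
  compatible : ∀ x ∈ U, ∀ a b : TangentSpace (𝓡 n) x →L[ℝ] ℝ, Ω x (P.sharp x a) (P.sharp x b) = b (P.sharp x a)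

end Poisson

/-! ### The almost topological Poisson Sigma Model -/

section Model

variable {n : ℕ} {M : Type*} [TopologicalSpace M] [ChartedSpace (EuclideanSpace ℝ (Fin n)) M]
  {S : Type*} [TopologicalSpace S] [ChartedSpace (EuclideanSpace ℝ (Fin 2)) S]

/-- 1-forms on the worldsheet `S` with values in `X^* T^*M`. -/
abbrev PullbackForm (X : S → M) : Type _ :=
  ∀ x : S, TangentSpace (𝓡 2) x →L[ℝ] (TangentSpace (𝓡 n) (X x) →L[ℝ] ℝ)

/-- The component `u ↦ A_{iμ}(u) e^i v^μ` in the charts `φ` of `S` and `ψ` of `M`. -/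
def compA {X : S → M} (A : PullbackForm (n := n) X)
    (φ : OpenPartialHomeomorph S (EuclideanSpace ℝ (Fin 2)))
    (ψ : OpenPartialHomeomorph M (EuclideanSpace ℝ (Fin n)))
    (e : EuclideanSpace ℝ (Fin n)) (v u : EuclideanSpace ℝ (Fin 2)) : ℝ :=
  A (φ.symm u) (coordVec φ (φ.symm u) v) (coordVec ψ (X (φ.symm u)) e)

variable (n M S) in
/-- The fields of the model: a map `X` and a 1-form `A` with values in `X^* T^*M`. -/
structure Fields where
  /-- the map from the worldsheet to the target -/
  X : S → M
  /-- the 1-forms `A_i` -/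
  A : PullbackForm (n := n) X

variable (P : PoissonTensor n M) {m : ℕ} (Cas : Fin m → M → ℝ) (eps : Fin m → BilinField 2 S)

/-- Smooth solutions of the field equations
`dX^i + 𝒫^{ij} A_j = 0` and `dA_i + ½ 𝒫^{kl}_{,i} A_k A_l + C^σ_{,i} ε_σ = 0`,
the second one in all charts `φ` of `S` and `ψ` of `M`, contracted with a constant vector `e^i`
and evaluated on two vectors `v`, `w`. -/
structure IsSolution (Φ : Fields n M S) : Prop where
  smooth_X : ContMDiff (𝓡 2) (𝓡 n) ∞ Φ.X
  smooth_A : ∀ φ ∈ charts 2 S, ∀ ψ ∈ charts n M, ∀ e v,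
    ContDiffOn ℝ ∞ (compA Φ.A φ ψ e v) {u ∈ φ.target | Φ.X (φ.symm u) ∈ ψ.source}
  eqX : ∀ x v, mfderiv (𝓡 2) (𝓡 n) Φ.X x v + P.sharp (Φ.X x) (Φ.A x v) = 0
  eqA : ∀ φ ∈ charts 2 S, ∀ ψ ∈ charts n M, ∀ x ∈ φ.source, Φ.X x ∈ ψ.source → ∀ e v w,
    (fderiv ℝ (compA Φ.A φ ψ e w) (φ x) v - fderiv ℝ (compA Φ.A φ ψ e v) (φ x) w)
      + P.dComp ψ (Φ.X x) e (Φ.A x (coordVec φ x v)) (Φ.A x (coordVec φ x w))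
      + ∑ s, mvfderiv (𝓡 n) (Cas s) (Φ.X x) (coordVec ψ (Φ.X x) e)
          * eps s x (coordVec φ x v) (coordVec φ x w) = 0

/-- `Φ'` arises from `Φ` by integrating, from time `0` to time `1`, the infinitesimal symmetries
`δX^i = ε_j 𝒫^{ji}`, `δA_i = dε_i + 𝒫^{kl}_{,i} A_k ε_l` on the space of solutions, with a
smooth time-dependent parameter `ε_t ∈ Γ(X_t^* T^*M)`. -/
def GaugeTransform (Φ Φ' : Fields n M S) : Prop :=
  ∃ (F : ℝ → Fields n M S) (ε : ∀ t x, TangentSpace (𝓡 n) ((F t).X x) →L[ℝ] ℝ),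
    (∀ t, IsSolution P Cas eps (F t)) ∧
    ContMDiff (𝓘(ℝ, ℝ).prod (𝓡 2)) (𝓡 n) ∞ (fun q : ℝ × S => (F q.1).X q.2) ∧
    (∀ φ ∈ charts 2 S, ∀ ψ ∈ charts n M, ∀ e v,
      ContDiffOn ℝ ∞ (fun q : ℝ × EuclideanSpace ℝ (Fin 2) => compA (F q.1).A φ ψ e v q.2)
        {q | q.2 ∈ φ.target ∧ (F q.1).X (φ.symm q.2) ∈ ψ.source}) ∧
    (∀ φ ∈ charts 2 S, ∀ ψ ∈ charts n M, ∀ e,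
      ContDiffOn ℝ ∞ (fun q : ℝ × EuclideanSpace ℝ (Fin 2) =>
          ε q.1 (φ.symm q.2) (coordVec ψ ((F q.1).X (φ.symm q.2)) e))
        {q | q.2 ∈ φ.target ∧ (F q.1).X (φ.symm q.2) ∈ ψ.source}) ∧
    (∀ t x, mfderiv 𝓘(ℝ, ℝ) (𝓡 n) (fun s => (F s).X x) t (1 : ℝ)
      = - P.sharp ((F t).X x) (ε t x)) ∧
    (∀ φ ∈ charts 2 S, ∀ ψ ∈ charts n M, ∀ t, ∀ x ∈ φ.source, (F t).X x ∈ ψ.source → ∀ e v,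
      deriv (fun s => compA (F s).A φ ψ e v (φ x)) t
        = fderiv ℝ (fun u => ε t (φ.symm u) (coordVec ψ ((F t).X (φ.symm u)) e)) (φ x) v
          + P.dComp ψ ((F t).X x) e ((F t).A x (coordVec φ x v)) (ε t x)) ∧
    F 0 = Φ ∧ F 1 = Φ'

/-- Gauge equivalence: the equivalence relation generated by gauge transformations. -/
def GaugeEquiv (Φ Φ' : Fields n M S) : Prop :=
  Relation.EqvGen (GaugeTransform P Cas eps) Φ Φ'

/-- The solutions `A` for a fixed map `X`. -/
abbrev SolutionsOver (X : S → M) : Type _ :=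
  {A : PullbackForm (n := n) X // IsSolution P Cas eps ⟨X, A⟩}

/-- Gauge equivalence of solutions for a fixed map `X`. -/
def gaugeSetoid (X : S → M) : Setoid (SolutionsOver P Cas eps X) where
  r A A' := GaugeEquiv P Cas eps ⟨X, A.1⟩ ⟨X, A'.1⟩
  iseqv :=
    ⟨fun _ => Relation.EqvGen.refl _, fun h => h.symm, fun h h' => h.trans _ _ _ h'⟩

/-- `A_i = - X^*(∂_i ⌟ Ω) + α_I X^*(∂_i C^I)`, evaluated on `v ∈ T_x S` and contracted with
`w ∈ T_{X(x)} M`. -/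
def HasForm {k : ℕ} (Ω : BilinField n M) (C : Fin k → M → ℝ) {X : S → M}
    (A : PullbackForm (n := n) X) (α : Fin k → CovectorField 2 S) : Prop :=
  ∀ x v w, A x v w = - Ω (X x) w (mfderiv (𝓡 2) (𝓡 n) X x v)
    + ∑ I, α I x v * mvfderiv (𝓡 n) (C I) (X x) w

end Model

end PSM

end

/-! The first field equation is pointwise an inhomogeneous linear equation for `A`. Along `L` the
kernel of 𝒫 is spanned by the `dC^I` (a dimension count), and compatibility of Ω makes `-Ω(·, dX)` a
particular solution, because `dX` is tangent to the leaf. Hence `A = -Ω(·, dX) + α_I dC^I`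
(`exists_coefficients`, `sharp_eq_neg`).

For such `A` the left side `dA + ½ ∂𝒫 A A` of the second equation equals `dα_I dC^I`
(`curvature_identity`). This follows from `dΩ = 0` after differentiating skewness, compatibility and
the Casimir property in an arbitrary direction of `M`. The source term is `dp_I dC^I`, so
independence of the `dC^I` leaves exactly `d(α_I + p_I) = 0`.

Gauge transformations come from the same identity on `ℝ × Σ`. A family `X_t` is a map from `ℝ × Σ`,
the parameter ε is the time component of `A`, and ε has the form `-Ω(·, ∂_t X) + f_I dC^I`. The
mixed component of the curvature then says that the gauge law for `A` is `∂_t α_I = d f_I`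
(`gauge_defect`). Integrating over `t` changes `α_I` by the exact form `d ∫ f_I dt`; conversely, an
exact change is realised with constant `X` and `ε = f_I dC^I`. The maps `X_t` cannot leave `L`,
since each `t ↦ X_t(x)` is a cotangent curve. Thus the classes `[α_I + p_I]` are complete
invariants, and every tuple of classes occurs.

For the global Casimir functions, germs of local defining systems form a space over `L` in which
paths are continuations. Two systems at a point differ by a local diffeomorphism of `ℝ^k` fixing 0,
so a germ extends along all of `L` inside the domain of any other system. As `L` is connected, one
germ continues to every point; trivial holonomy makes the result unambiguous, and a locally finite
cover glues the germs (`exists_isDefining`). Connectedness also gives the constancy of `C^σ_{,I}`.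
-/

open scoped Manifold ContDiff Topology

namespace PSM

/-! ### The curvature identity in a vector space. -/

section Calculus

variable {E F ι : Type*} [NormedAddCommGroup E] [NormedSpace ℝ E]
  [NormedAddCommGroup F] [NormedSpace ℝ F] [Fintype ι]

/-- The covariant curvature of `A = -Ω(·, dx) + α_I dC^I` is `dα_I dC^I`. -/
theorem curvature_identity
    {p : E → (E →L[ℝ] ℝ) →L[ℝ] E} {p' : E →L[ℝ] (E →L[ℝ] ℝ) →L[ℝ] E}
    {Ω : E → E →L[ℝ] E →L[ℝ] ℝ} {Ω' : E →L[ℝ] E →L[ℝ] E →L[ℝ] ℝ}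
    {dC : ι → E → E →L[ℝ] ℝ} {ddC : ι → E →L[ℝ] E →L[ℝ] ℝ}
    {x : F → E} {dx : F → F →L[ℝ] E} {ddx : F →L[ℝ] F →L[ℝ] E}
    {α : ι → F → F →L[ℝ] ℝ} {α' : ι → F →L[ℝ] F →L[ℝ] ℝ} {u : F}
    (hp : HasFDerivAt p p' (x u)) (hΩ : HasFDerivAt Ω Ω' (x u))
    (hC : ∀ I, HasFDerivAt (dC I) (ddC I) (x u)) (hx : HasFDerivAt x (dx u) u)
    (hdx : HasFDerivAt dx ddx u) (hα : ∀ I, HasFDerivAt (α I) (α' I) u)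
    (skew : ∀ᶠ y in 𝓝 (x u), ∀ a b : E →L[ℝ] ℝ, a (p y b) = - b (p y a))
    (alt : ∀ᶠ y in 𝓝 (x u), ∀ v w, Ω y v w = - Ω y w v)
    (closed : ∀ v w z, Ω' v w z + Ω' w z v + Ω' z v w = 0)
    (compat : ∀ᶠ y in 𝓝 (x u), ∀ a b, Ω y (p y a) (p y b) = b (p y a))
    (cas : ∀ I, ∀ᶠ y in 𝓝 (x u), p y (dC I y) = 0)
    (symC : ∀ I v w, ddC I v w = ddC I w v) (symx : ∀ v w, ddx v w = ddx w v)
    {v w : F} {e : E} {a b : E →L[ℝ] ℝ} {fv fw : F → ℝ}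
    (ha : ∀ z, a z = - Ω (x u) z (dx u v) + ∑ I, α I u v * dC I (x u) z)
    (hb : ∀ z, b z = - Ω (x u) z (dx u w) + ∑ I, α I u w * dC I (x u) z)
    (hfv : ∀ᶠ u in 𝓝 u, fv u = - Ω (x u) e (dx u v) + ∑ I, α I u v * dC I (x u) e)
    (hfw : ∀ᶠ u in 𝓝 u, fw u = - Ω (x u) e (dx u w) + ∑ I, α I u w * dC I (x u) e)
    (hpa : dx u v = - p (x u) a) (hpb : dx u w = - p (x u) b) :
    fderiv ℝ fw u v - fderiv ℝ fv u w + a (p' e b)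
      = ∑ I, (α' I v w - α' I w v) * dC I (x u) e := by
  -- The terms with `ddx` and `ddC` produced here are disposed of by symmetry of second derivatives,
  -- once both orders are subtracted and the differentiated Casimir identity is used.
  have key : ∀ (w v : F), fderiv ℝ (fun u => - Ω (x u) e (dx u w)
      + ∑ I, α I u w * dC I (x u) e) u v
      = -(Ω' (dx u v) e (dx u w) + Ω (x u) e (ddx v w))
        + (∑ I, α' I v w * dC I (x u) e + ∑ I, α I u w * ddC I (dx u v) e) := by
    intro w v
    have h0 : HasFDerivAt (fun u => Ω (x u) e) _ u :=
      (hΩ.comp u hx).clm_apply (hasFDerivAt_const e u)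
    have h1 := (h0.clm_apply (hdx.clm_apply (hasFDerivAt_const w u))).neg
    have h2 := HasFDerivAt.fun_sum (u := Finset.univ) fun I _ =>
      ((hα I).clm_apply (hasFDerivAt_const w u)).mul
        (((hC I).comp u hx).clm_apply (hasFDerivAt_const e u))
    have h3 := (h1.add h2).fderiv
    have h4 := congrArg (fun T => T v) h3
    refine Eq.trans h4 ?_
    simp [Finset.sum_add_distrib, mul_comm]
    ring
  rw [Filter.EventuallyEq.fderiv_eq hfw, Filter.EventuallyEq.fderiv_eq hfv, key, key]
  have hpe : ∀ a, HasFDerivAt (fun y => p y a) (p'.flip a) (x u) := fun a => by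
    simpa using! hp.clm_apply (hasFDerivAt_const a (x u))
  -- Each pointwise identity holds near `x u`, so it may be differentiated. The direction `e` is
  -- arbitrary and may be transversal to the leaf.
  have dskew : ∀ a b : E →L[ℝ] ℝ, a (p' e b) = - b (p' e a) := by
    intro a b
    have h1 := (a.hasFDerivAt.comp (x u) (hpe b)).fderiv
    have h2 := ((b.hasFDerivAt.comp (x u) (hpe a)).neg).fderiv
    have h3 : (fun y => a (p y b)) =ᶠ[𝓝 (x u)] fun y => - b (p y a) :=
      skew.mono fun y hy => hy a b
    have h4 := h1.symm.trans ((Filter.EventuallyEq.fderiv_eq h3).trans h2)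
    simpa using congrArg (fun T => T e) h4
  have dalt : ∀ z v w, Ω' z v w = - Ω' z w v := by
    intro z v w
    have hd : ∀ v w, HasFDerivAt (fun y => Ω y v w) ((Ω'.flip v).flip w) (x u) := fun v w => by
      simpa using! (hΩ.clm_apply (hasFDerivAt_const v (x u))).clm_apply (hasFDerivAt_const w (x u))
    have h3 : (fun y => Ω y v w) =ᶠ[𝓝 (x u)] fun y => - Ω y w v :=
      alt.mono fun y hy => hy v w
    have h4 := (hd v w).fderiv.symm.trans
      ((Filter.EventuallyEq.fderiv_eq h3).trans (hd w v).neg.fderiv)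
    simpa using congrArg (fun T => T z) h4
  have dcompat : Ω' e (p (x u) a) (p (x u) b) + Ω (x u) (p' e a) (p (x u) b)
      + Ω (x u) (p (x u) a) (p' e b) = b (p' e a) := by
    have h1 := ((hΩ.clm_apply (hpe a)).clm_apply (hpe b)).fderiv
    have h2 := (b.hasFDerivAt.comp (x u) (hpe a)).fderiv
    have h3 : (fun y => Ω y (p y a) (p y b)) =ᶠ[𝓝 (x u)] fun y => b (p y a) :=
      compat.mono fun y hy => hy a b
    have h4 := h1.symm.trans ((Filter.EventuallyEq.fderiv_eq h3).trans h2)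
    have h5 := congrArg (fun T => T e) h4
    simp at h5
    linarith
  have dcas : ∀ I a, dC I (x u) (p' e a) = - ddC I (p (x u) a) e := by
    intro I a
    have h1 := (hp.clm_apply (hC I)).fderiv
    have h3 : (fun y => p y (dC I y)) =ᶠ[𝓝 (x u)] fun _ => 0 := cas I
    have h4 := h1.symm.trans ((Filter.EventuallyEq.fderiv_eq h3).trans
      (hasFDerivAt_const (0 : E) (x u)).fderiv)
    have h5 := congrArg (fun T => a (T e)) h4
    simp at h5
    rw [dskew, skew.self_of_nhds] at h5
    rw [symC]
    linarith
  -- Evaluating `a` and `b` on the vectors `p' e b` and `p' e a` turns the two terms of `dcompat`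
  -- with Ω undifferentiated into terms with `p'` and `ddC`; closedness at `(dx v, dx w, e)`
  -- supplies the remaining `Ω'` term.
  have hb' := hb (p' e a)
  have ha' := ha (p' e b)
  simp only [dcas] at ha' hb'
  have h1 := closed (dx u v) (dx u w) e
  have h2 := dalt (dx u v) e (dx u w)
  have h3 := dskew a b
  have h4 := alt.self_of_nhds (p (x u) a) (p' e b)
  rw [symx w v]
  simp only [sub_mul, Finset.sum_sub_distrib]
  simp only [hpa, hpb, map_neg, neg_neg, _root_.neg_apply, mul_neg, Finset.sum_neg_distrib] at *
  linarith

end Calculus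

/-! ### Dual vectors and smooth dependence of coefficients. -/

section LinearAlgebra

variable {E ι : Type*} [NormedAddCommGroup E] [NormedSpace ℝ E] [Fintype ι]

/-- A nonzero functional on `ι → ℝ` vanishing on the range would be a nontrivial linear relation
among the `f I`. -/
theorem surjective_of_linearIndependent {f : ι → E →L[ℝ] ℝ} (hf : LinearIndependent ℝ f) :
    Function.Surjective (fun (v : E) (I : ι) => f I v) := by
  classical
  let T : E →ₗ[ℝ] (ι → ℝ) := LinearMap.pi fun I => (f I).toLinearMap
  have hT : LinearMap.range T = ⊤ := by
    by_contra hne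
    obtain ⟨g, hg, hle⟩ := Submodule.exists_le_ker_of_lt_top _ (lt_top_iff_ne_top.2 hne)
    have hz : ∑ I, g (Pi.single I 1) • f I = 0 := by
      ext v
      have h1 : g (T v) = 0 := hle ⟨v, rfl⟩
      rw [LinearMap.pi_apply_eq_sum_univ g] at h1
      have h2 : ∀ I : ι, (fun j => if I = j then (1 : ℝ) else 0) = Pi.single I 1 := fun I => by
        ext j
        simp [Pi.single_apply, eq_comm]
      simpa [T, h2, mul_comm] using! h1
    have h0 := Fintype.linearIndependent_iff.1 hf _ hz
    apply hg
    ext I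
    simpa using h0 I
  exact fun w => LinearMap.range_eq_top.1 hT w

theorem exists_dual_vectors [DecidableEq ι] {f : ι → E →L[ℝ] ℝ} (hf : LinearIndependent ℝ f) :
    ∃ e : ι → E, ∀ I J, f I (e J) = if I = J then 1 else 0 := by
  choose g hg using surjective_of_linearIndependent hf
  exact ⟨fun J => g fun I => if I = J then 1 else 0, fun I J => congrFun (hg _) I⟩

theorem contDiffAt_det [DecidableEq ι] {G : Type*} [NormedAddCommGroup G] [NormedSpace ℝ G]
    {m : G → Matrix ι ι ℝ} {u : G} {r : WithTop ℕ∞}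
    (hm : ∀ i j, ContDiffAt ℝ r (fun u => m u i j) u) : ContDiffAt ℝ r (fun u => (m u).det) u := by
  simp only [Matrix.det_apply]
  exact ContDiffAt.sum fun s _ => (contDiffAt_prod fun i _ => hm _ _).const_smul _

/-- The coefficients of a smooth combination of a smooth frame are smooth. -/
theorem contDiffAt_coefficient {G V : Type*} [NormedAddCommGroup G] [NormedSpace ℝ G]
    [DecidableEq ι] {B : ι → G → V → ℝ} {g : V → G → ℝ} {α : ι → G → ℝ} {u : G}
    {r : WithTop ℕ∞} {e : ι → V} (he : ∀ I J, B I u (e J) = if I = J then 1 else 0)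
    (hB : ∀ I z, ContDiffAt ℝ r (fun u => B I u z) u) (hg : ∀ z, ContDiffAt ℝ r (g z) u)
    (h : ∀ᶠ u in 𝓝 u, ∀ z, g z u = ∑ I, α I u * B I u z) (I : ι) :
    ContDiffAt ℝ r (α I) u := by
  -- Cramer's rule: this matrix is the identity at the base point, hence invertible nearby, and the
  -- coefficients are quotients of determinants with smooth entries.
  let m : G → Matrix ι ι ℝ := fun u => Matrix.of fun J I => B I u (e J)
  have hm : ContDiffAt ℝ r (fun u => (m u).det) u := contDiffAt_det fun i j => hB _ _
  have h1 : (m u).det = 1 := by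
    have : m u = 1 := by
      ext J I
      simp [m, he, Matrix.one_apply, eq_comm]
    rw [this, Matrix.det_one]
  have hne : ∀ᶠ u in 𝓝 u, (m u).det ≠ 0 :=
    hm.continuousAt.eventually_ne (by rw [h1]; exact one_ne_zero)
  have hc : ContDiffAt ℝ r (fun u => ((m u).updateCol I fun J => g (e J) u).det) u := by
    refine contDiffAt_det fun i j => ?_
    by_cases hj : j = I
    · subst hj
      simpa using hg _
    · simpa [Matrix.updateCol_apply, hj, m] using hB _ _
  refine (ContDiffAt.fun_div hc hm (by rw [h1]; exact one_ne_zero)).congr_of_eventuallyEq ?_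
  filter_upwards [h, hne] with u hu hn
  have hv : (fun J => g (e J) u) = (m u).mulVec fun I => α I u := by
    ext J
    simp [m, Matrix.mulVec, dotProduct, hu, mul_comm]
  rw [hv, ← Matrix.cramer_apply, Matrix.cramer_eq_adjugate_mulVec, Matrix.mulVec_mulVec,
    Matrix.adjugate_mul]
  simp [hn, Matrix.smul_mulVec]

end LinearAlgebra

/-! ### Submersions: adapted coordinates, functions constant on fibres, paths in fibres. -/

section Straightening

variable {E G : Type*} [NormedAddCommGroup E] [NormedSpace ℝ E] [FiniteDimensional ℝ E]
  [NormedAddCommGroup G] [NormedSpace ℝ G] [FiniteDimensional ℝ G]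

/-- Near a point where `D` is a submersion, there are smooth coordinates extending `D`; `σ` is
the inverse coordinate map. -/
theorem exists_adapted_coordinates {D : E → G} {O : Set E} {y : E} (hO : IsOpen O)
    (hy : y ∈ O) (hD : ContDiffOn ℝ ∞ D O) (hs : Function.Surjective (fderiv ℝ D y)) :
    ∃ (σ : G × (fderiv ℝ D y).ker → E) (r : ℝ), 0 < r ∧
      ContDiffOn ℝ ∞ σ (Metric.ball (D y) r ×ˢ Metric.ball 0 r) ∧
      (∀ q ∈ Metric.ball (D y) r ×ˢ Metric.ball 0 r, σ q ∈ O ∧ D (σ q) = q.1) ∧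
      (∀ᶠ x in 𝓝 y, D x ∈ Metric.ball (D y) r ∧ ∃ w ∈ Metric.ball 0 r, σ (D x, w) = x) ∧
      σ (D y, 0) = y := by
  have hDy : ContDiffAt ℝ ∞ D y := hD.contDiffAt (hO.mem_nhds hy)
  have hst : HasStrictFDerivAt D (fderiv ℝ D y) y := hDy.hasStrictFDerivAt (by simp)
  have hr : (fderiv ℝ D y).range = ⊤ := LinearMap.range_eq_top.2 hs
  have hker : (fderiv ℝ D y).ker.ClosedComplemented :=
    Submodule.ClosedComplemented.of_finiteDimensional _
  -- Ψ is `D` together with a projection of `x - y` to the kernel of its differential.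
  let Ψ := hst.implicitToOpenPartialHomeomorphOfComplemented D (fderiv ℝ D y) hr hker
  have hyΨ : y ∈ Ψ.source :=
    hst.mem_implicitToOpenPartialHomeomorphOfComplemented_source hr hker
  have hΨy : Ψ y = (D y, 0) := hst.implicitToOpenPartialHomeomorphOfComplemented_self hr hker
  have hΨ : ∀ x, Ψ x = (D x, Classical.choose hker (x - y)) := fun x => rfl
  have hΨs : ContDiffOn ℝ ∞ Ψ O := by
    have : (Ψ : E → _) = fun x => (D x, Classical.choose hker (x - y)) := funext hΨ
    rw [this]
    exact hD.prodMk ((Classical.choose hker).contDiff.comp (contDiff_id.sub contDiff_const)).contDiffOn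
  obtain ⟨Φ₀, hΦ₀⟩ : ∃ Φ₀ : E ≃L[ℝ] G × (fderiv ℝ D y).ker,
      HasFDerivAt Ψ (Φ₀ : E →L[ℝ] _) y := by
    let φ := hst.implicitFunctionDataOfComplemented D (fderiv ℝ D y) hr hker
    obtain ⟨e, he⟩ := φ.isInvertible_fderiv_prodFun
    refine ⟨e, ?_⟩
    rw [he]
    exact (φ.hasStrictFDerivAt.hasFDerivAt).differentiableAt.hasFDerivAt
  -- Invertibility of the differential is an open condition, so the inverse of Ψ is smooth on a
  -- whole neighbourhood. It is then shrunk to a product of balls, whose slices over a fixed value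
  -- of `D` are convex.
  have hinv : ∀ᶠ x in 𝓝 y, ∃ e : E ≃L[ℝ] G × (fderiv ℝ D y).ker,
      HasFDerivAt Ψ (e : E →L[ℝ] _) x := by
    have hc : ContinuousAt (fderiv ℝ Ψ) y :=
      (hΨs.continuousOn_fderiv_of_isOpen hO (by simp)).continuousAt (hO.mem_nhds hy)
    have hn : Set.range ((↑) : (E ≃L[ℝ] G × (fderiv ℝ D y).ker) → _) ∈ 𝓝 (fderiv ℝ Ψ y) := by
      rw [hΦ₀.fderiv]
      exact Φ₀.nhds
    filter_upwards [hc hn, hO.mem_nhds hy] with x ⟨e, he⟩ hx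
    refine ⟨e, ?_⟩
    rw [he]
    exact ((hΨs.contDiffAt (hO.mem_nhds hx)).differentiableAt (by simp)).hasFDerivAt
  have hT : Ψ.target ∩ {q | Ψ.symm q ∈ O ∧ ∃ e : E ≃L[ℝ] G × (fderiv ℝ D y).ker,
      HasFDerivAt Ψ (e : E →L[ℝ] _) (Ψ.symm q)} ∈ 𝓝 (D y, (0 : (fderiv ℝ D y).ker)) := by
    rw [← hΨy]
    refine Filter.inter_mem (Ψ.open_target.mem_nhds (Ψ.map_source hyΨ)) ?_
    have hc := Ψ.continuousAt_symm (Ψ.map_source hyΨ)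
    rw [ContinuousAt, Ψ.left_inv hyΨ] at hc
    exact hc ((hO.eventually_mem hy).and hinv)
  obtain ⟨r, hr0, hrT⟩ := Metric.mem_nhds_iff.1 hT
  rw [← ball_prod_same] at hrT
  refine ⟨Ψ.symm, r, hr0, ?_, ?_, ?_, ?_⟩
  · intro q hq
    obtain ⟨hq1, hq2, e, he⟩ := hrT hq
    exact (Ψ.contDiffAt_symm hq1 he (hΨs.contDiffAt (hO.mem_nhds hq2))).contDiffWithinAt
  · intro q hq
    obtain ⟨hq1, hq2, -⟩ := hrT hq
    exact ⟨hq2, congrArg Prod.fst (Ψ.right_inv hq1)⟩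
  · have hc : ContinuousAt Ψ y := Ψ.continuousAt hyΨ
    have hb : Metric.ball (D y) r ×ˢ Metric.ball (0 : (fderiv ℝ D y).ker) r ∈ 𝓝 (Ψ y) := by
      rw [hΨy]
      exact prod_mem_nhds (Metric.ball_mem_nhds _ hr0) (Metric.ball_mem_nhds _ hr0)
    filter_upwards [hc hb, Ψ.open_source.mem_nhds hyΨ] with x hx hxs
    exact ⟨hx.1, (Ψ x).2, hx.2, Ψ.left_inv hxs⟩
  · rw [← hΨy, Ψ.left_inv hyΨ]

/-- A function whose differential vanishes on the fibres of a submersion `D` is a smooth function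
of `D`. -/
theorem exists_eq_comp_of_ker_le {G' : Type*} [NormedAddCommGroup G'] [NormedSpace ℝ G']
    {D : E → G} {f : E → G'} {O : Set E} {y : E} (hO : IsOpen O)
    (hy : y ∈ O) (hD : ContDiffOn ℝ ∞ D O) (hs : Function.Surjective (fderiv ℝ D y))
    (hf : ContDiffOn ℝ ∞ f O) (hk : ∀ z ∈ O, ∀ v, fderiv ℝ D z v = 0 → fderiv ℝ f z v = 0) :
    ∃ (B : Set G) (h : G → G'), IsOpen B ∧ D y ∈ B ∧ ContDiffOn ℝ ∞ h B ∧
      ∀ᶠ x in 𝓝 y, f x = h (D x) := by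
  obtain ⟨σ, r, hr, hσ, hσO, hx, hσy⟩ := exists_adapted_coordinates hO hy hD hs
  -- The function of `D` is `f` on the slice `w = 0`. It represents `f` because `f ∘ σ` has zero
  -- derivative in `w` on a ball, so it is constant there.
  refine ⟨Metric.ball (D y) r, fun z => f (σ (z, 0)), Metric.isOpen_ball,
    Metric.mem_ball_self hr, ?_, ?_⟩
  · refine hf.comp (hσ.comp (by fun_prop) fun z hz => ?_) fun z hz => ?_
    · exact ⟨hz, Metric.mem_ball_self hr⟩
    · exact (hσO _ ⟨hz, Metric.mem_ball_self hr⟩).1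
  · filter_upwards [hx] with x ⟨hxb, w, hw, hxw⟩
    have hd : ∀ w ∈ Metric.ball (0 : (fderiv ℝ D y).ker) r,
        HasFDerivAt (fun w => f (σ (D x, w))) (0 : (fderiv ℝ D y).ker →L[ℝ] G') w := by
      intro w hw
      have hmem : (D x, w) ∈ Metric.ball (D y) r ×ˢ Metric.ball (0 : (fderiv ℝ D y).ker) r :=
        ⟨hxb, hw⟩
      have hopen : IsOpen (Metric.ball (D y) r ×ˢ Metric.ball (0 : (fderiv ℝ D y).ker) r) :=
        Metric.isOpen_ball.prod Metric.isOpen_ball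
      have hσd : DifferentiableAt ℝ σ (D x, w) :=
        (hσ.contDiffAt (hopen.mem_nhds hmem)).differentiableAt (by simp)
      have hσO' := (hσO _ hmem).1
      have hDd : DifferentiableAt ℝ D (σ (D x, w)) :=
        (hD.contDiffAt (hO.mem_nhds hσO')).differentiableAt (by simp)
      have hfd : DifferentiableAt ℝ f (σ (D x, w)) :=
        (hf.contDiffAt (hO.mem_nhds hσO')).differentiableAt (by simp)
      have h1 : HasFDerivAt (fun w => σ (D x, w)) _ w :=
        hσd.hasFDerivAt.comp w (hasFDerivAt_prodMk_right (D x) w)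
      have h2 := hDd.hasFDerivAt.comp w h1
      have h3 := hfd.hasFDerivAt.comp w h1
      have h4 : (fun w => D (σ (D x, w))) =ᶠ[𝓝 w] fun _ => D x := by
        filter_upwards [Metric.isOpen_ball.mem_nhds hw] with w' hw'
        exact (hσO (D x, w') ⟨hxb, hw'⟩).2
      have h5 := h2.unique ((hasFDerivAt_const (D x) w).congr_of_eventuallyEq h4)
      convert! h3 using 1
      ext v
      exact (hk _ hσO' _ (by simpa using congrArg (fun T => T v) h5)).symm
    have := Metric.isOpen_ball.is_const_of_fderiv_eq_zero
      (convex_ball (0 : (fderiv ℝ D y).ker) r).isPreconnected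
      (fun w hw => (hd w hw).differentiableAt.differentiableWithinAt)
      (fun w hw => (hd w hw).fderiv) hw (Metric.mem_ball_self hr)
    simp only [hxw] at this
    exact this

/-- The fibres of a submersion are locally path connected. -/
theorem eventually_joinedIn_fiber {D : E → G} {O : Set E} {y : E} (hO : IsOpen O)
    (hy : y ∈ O) (hD : ContDiffOn ℝ ∞ D O) (hs : Function.Surjective (fderiv ℝ D y)) :
    ∀ᶠ x in 𝓝 y, D x = D y → JoinedIn (O ∩ {x | D x = D y}) y x := by
  obtain ⟨σ, r, hr, hσ, hσO, hx, hσy⟩ := exists_adapted_coordinates hO hy hD hs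
  filter_upwards [hx] with x ⟨hxb, w, hw, hxw⟩ hxy
  -- In adapted coordinates the path is the straight segment from `0` to `w` in the fibre.
  have hmem : ∀ t ∈ unitInterval, (D y, t • w) ∈
      Metric.ball (D y) r ×ˢ Metric.ball (0 : (fderiv ℝ D y).ker) r := by
    intro t ht
    refine ⟨Metric.mem_ball_self hr, ?_⟩
    rw [mem_ball_zero_iff, norm_smul, Real.norm_of_nonneg ht.1]
    rw [mem_ball_zero_iff] at hw
    exact (mul_le_of_le_one_left (norm_nonneg _) ht.2).trans_lt hw
  refine JoinedIn.ofLine (f := fun t : ℝ => σ (D y, t • w)) ?_ (by simp [hσy])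
    (by rw [one_smul, ← hxy, hxw]) ?_
  · exact hσ.continuousOn.comp (by fun_prop) hmem
  · rintro _ ⟨t, ht, rfl⟩
    exact hσO _ (hmem t ht)

end Straightening

/-! ### Integration of a gauge parameter over time. -/

section Integral

open MeasureTheory

/-- Differentiation under the integral followed by the fundamental theorem of calculus. With `∂_t a
= d g_t` it exhibits the total change of the 1-form `a` as the differential of `∫ g_t dt`.
Compactness of `[0,1]` times a closed ball provides the dominating constant. -/
theorem hasFDerivAt_integral_of_hasDerivAt {H : Type*} [NormedAddCommGroup H] [NormedSpace ℝ H]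
    [FiniteDimensional ℝ H] {T : Set H} (hT : IsOpen T) {g : ℝ × H → ℝ}
    (hg : ContDiffOn ℝ ∞ g {q | q.2 ∈ T}) {a : ℝ → H →L[ℝ] ℝ} {u : H} (hu : u ∈ T)
    (ha : ∀ t v, HasDerivAt (fun t => a t v) (fderiv ℝ (fun u => g (t, u)) u v) t) :
    HasFDerivAt (fun u => ∫ t in (0 : ℝ)..1, g (t, u)) (a 1 - a 0) u := by
  have hO : IsOpen {q : ℝ × H | q.2 ∈ T} := hT.preimage continuous_snd
  let g' : H → ℝ → H →L[ℝ] ℝ := fun u t => (fderiv ℝ g (t, u)).comp (ContinuousLinearMap.inr ℝ ℝ H)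
  have hg' : ContinuousOn (fun q : ℝ × H => g' q.2 q.1) {q | q.2 ∈ T} :=
    (hg.continuousOn_fderiv_of_isOpen hO (by simp)).clm_comp continuousOn_const
  have hd : ∀ t, ∀ u ∈ T, HasFDerivAt (fun u => g (t, u)) (g' u t) u := fun t u hu =>
    (((hg.contDiffAt (hO.mem_nhds (x := (t, u)) hu)).differentiableAt
      (by simp)).hasFDerivAt).comp u (hasFDerivAt_prodMk_right t u)
  have hcont : ∀ u ∈ T, Continuous fun t => g (t, u) := fun u hu =>
    hg.continuousOn.comp_continuous (by fun_prop) fun t => hu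
  have hcont' : ∀ u ∈ T, Continuous fun t => g' u t := fun u hu =>
    hg'.comp_continuous (f := fun t : ℝ => (t, u)) (by fun_prop) fun t => hu
  obtain ⟨r, hr, hrT⟩ := Metric.nhds_basis_closedBall.mem_iff.1 (hT.mem_nhds hu)
  obtain ⟨c, hc⟩ := (isCompact_Icc (a := (0 : ℝ)) (b := 1)).prod (isCompact_closedBall u r)
    |>.exists_bound_of_continuousOn (hg'.mono fun q hq => hrT hq.2)
  have key := intervalIntegral.hasFDerivAt_integral_of_dominated_of_fderiv_le (μ := volume)
    (𝕜 := ℝ) (a := 0) (b := 1)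
    (F := fun u t => g (t, u)) (F' := g') (x₀ := u) (bound := fun _ => c)
    (Metric.closedBall_mem_nhds u hr)
    (by filter_upwards [hT.mem_nhds hu] with u hu using (hcont u hu).aestronglyMeasurable)
    ((hcont u hu).intervalIntegrable _ _) (hcont' u hu).aestronglyMeasurable
    (Filter.Eventually.of_forall fun t ht x hx => hc (t, x)
      ⟨Set.Ioc_subset_Icc_self (by simpa using ht), hx⟩)
    (intervalIntegrable_const) (Filter.Eventually.of_forall fun t _ x hx => hd t x (hrT hx))
  convert! key using 1
  ext v
  rw [ContinuousLinearMap.intervalIntegral_apply ((hcont' u hu).intervalIntegrable _ _)]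
  refine (intervalIntegral.integral_eq_sub_of_hasDerivAt (f := fun t => a t v)
    (fun t _ => ?_) (((hcont' u hu).clm_apply continuous_const).intervalIntegrable _ _)).symm
  rw [← (hd t u hu).fderiv]
  exact ha t v

end Integral

/-! ### Gluing germs along a closed set. -/

section Gluing

/-- A compatible family of germs along a closed set is induced by a single function. -/
theorem exists_eventuallyEq_of_isClosed {X β : Type*} [TopologicalSpace X] [T2Space X]
    [ParacompactSpace X] {L : Set X} (hL : IsClosed L) (s : X → X → β)
    (hs : ∀ y ∈ L, ∀ᶠ z in 𝓝 y, z ∈ L → s z =ᶠ[𝓝 z] s y) :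
    ∃ f : X → β, ∀ y ∈ L, f =ᶠ[𝓝 y] s y := by
  classical
  by_cases hβ : Nonempty β
  swap
  · have hX : IsEmpty X := ⟨fun x => hβ ⟨s x x⟩⟩
    exact ⟨fun x => hX.elim x, fun y => hX.elim y⟩
  choose u hu using fun y : L => mem_nhds_iff.1 (hs y y.2)
  obtain ⟨v, hvo, hLv, hvf, hvu⟩ := precise_refinement_set hL u (fun y => (hu y).2.1)
    fun y hy => Set.mem_iUnion.2 ⟨⟨y, hy⟩, (hu ⟨y, hy⟩).2.2⟩
  obtain ⟨w, hLw, hwo, hwv⟩ := exists_subset_iUnion_closure_subset hL hvo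
    (fun x _ => hvf.point_finite x) hLv
  have hwf : LocallyFinite fun i => closure (w i) := hvf.subset hwv
  -- Any index whose closed set contains `x` may be used: near a point of `L`, all candidates agree.
  let f : X → β := fun x => if h : ∃ i, x ∈ closure (w i) then s (h.choose) x else hβ.some
  refine ⟨f, fun y hy => ?_⟩
  have hfin := hwf.point_finite y
  have h1 : ∀ᶠ x in 𝓝 y, ∀ i ∈ {i | y ∈ closure (w i)}, s i x = s y x := by
    rw [Filter.eventually_all_finite hfin]
    intro i hi
    have := (hu i).1 (hvu i (hwv i hi)) hy
    exact this.symm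
  -- By local finiteness, closed sets missing `y` also miss a neighbourhood of `y`, so only the
  -- finitely many indices of `h1` compete near `y`.
  have h2 : ∀ᶠ x in 𝓝 y, ∀ i, x ∈ closure (w i) → y ∈ closure (w i) := by
    have := hwf.iInter_compl_mem_nhds (fun i => isClosed_closure) y
    filter_upwards [this] with x hx i hxi
    by_contra hyi
    exact Set.mem_iInter₂.1 hx i hyi hxi
  obtain ⟨i, hi⟩ := Set.mem_iUnion.1 (hLw hy)
  filter_upwards [h1, h2, (hwo i).mem_nhds hi] with x hx1 hx2 hx3
  have hex : ∃ i, x ∈ closure (w i) := ⟨i, subset_closure hx3⟩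
  simp only [f, dif_pos hex]
  exact hx1 _ (hx2 _ hex.choose_spec)

end Gluing

end PSM

noncomputable section

namespace PSM

/-! ### Forms, maps and the Poisson tensor in charts. -/

theorem eventually_chart {N H : Type*} [TopologicalSpace N] [TopologicalSpace H]
    {φ : OpenPartialHomeomorph N H} {x : N} (hx : x ∈ φ.source) {p : N → Prop} (h : ∀ᶠ z in 𝓝 x, p z) :
    ∀ᶠ u in 𝓝 (φ x), u ∈ φ.target ∧ p (φ.symm u) := by
  have hc := φ.continuousAt_symm (φ.map_source hx)
  rw [ContinuousAt, φ.left_inv hx] at hc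
  exact (φ.open_target.eventually_mem (φ.map_source hx)).and (hc.eventually h)

section ChartCalculus

variable {d : ℕ} {N : Type*} [TopologicalSpace N] [ChartedSpace (EuclideanSpace ℝ (Fin d)) N]
  {φ : OpenPartialHomeomorph N (EuclideanSpace ℝ (Fin d))}

theorem chartAt_mem_charts [IsManifold (𝓡 d) ∞ N] (x : N) :
    chartAt (EuclideanSpace ℝ (Fin d)) x ∈ charts d N :=
  IsManifold.chart_mem_maximalAtlas x

theorem mdifferentiable_of_mem_charts (hφ : φ ∈ charts d N) :
    φ.MDifferentiable (𝓡 d) (𝓡 d) :=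
  ⟨(contMDiffOn_of_mem_maximalAtlas hφ).mdifferentiableOn (by simp),
    (contMDiffOn_symm_of_mem_maximalAtlas hφ).mdifferentiableOn (by simp)⟩

theorem coordVec_mfderiv (hφ : φ ∈ charts d N) {x : N} (hx : x ∈ φ.source)
    (ξ : TangentSpace (𝓡 d) x) : coordVec φ x (mfderiv (𝓡 d) (𝓡 d) φ x ξ) = ξ :=
  congrArg (fun T => T ξ) ((mdifferentiable_of_mem_charts hφ).symm_comp_deriv hx)

theorem mfderiv_coordVec_self (hφ : φ ∈ charts d N) {x : N} (hx : x ∈ φ.source)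
    (v : EuclideanSpace ℝ (Fin d)) : mfderiv (𝓡 d) (𝓡 d) φ x (coordVec φ x v) = v :=
  ((mdifferentiable_of_mem_charts hφ).mfderiv hx).right_inv v

theorem coordVec_surjective (hφ : φ ∈ charts d N) {x : N} (hx : x ∈ φ.source) :
    Function.Surjective (coordVec φ x) := fun ξ => ⟨_, coordVec_mfderiv hφ hx ξ⟩

theorem coordVec_injective (hφ : φ ∈ charts d N) {x : N} (hx : x ∈ φ.source) :
    Function.Injective (coordVec φ x) :=
  Function.LeftInverse.injective (mfderiv_coordVec_self hφ hx)

theorem covector_ext (hφ : φ ∈ charts d N) {x : N} (hx : x ∈ φ.source)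
    {a b : TangentSpace (𝓡 d) x →L[ℝ] ℝ} (h : ∀ v, a (coordVec φ x v) = b (coordVec φ x v)) :
    a = b := by
  ext ξ
  obtain ⟨v, rfl⟩ := coordVec_surjective hφ hx ξ
  exact h v

theorem mvfderiv_coordVec (hφ : φ ∈ charts d N) {x : N} (hx : x ∈ φ.source) {f : N → ℝ}
    (hf : MDifferentiableAt (𝓡 d) 𝓘(ℝ, ℝ) f x) (v : EuclideanSpace ℝ (Fin d)) :
    mvfderiv (𝓡 d) f x (coordVec φ x v) = fderiv ℝ (fun u => f (φ.symm u)) (φ x) v := by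
  have hφs := (mdifferentiable_of_mem_charts hφ).mdifferentiableAt_symm (φ.map_source hx)
  have h := mfderiv_comp_apply_of_eq (φ x) hf hφs (φ.left_inv hx) v
  rw [← mfderiv_eq_fderiv]
  exact h.symm

theorem contDiffAt_comp_chart_symm {V : Type*} [NormedAddCommGroup V] [NormedSpace ℝ V]
    (hφ : φ ∈ charts d N) {x : N} (hx : x ∈ φ.source) {f : N → V}
    (hf : ContMDiffAt (𝓡 d) 𝓘(ℝ, V) ∞ f x) :
    ContDiffAt ℝ ∞ (fun u => f (φ.symm u)) (φ x) := by
  rw [← contMDiffAt_iff_contDiffAt]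
  exact hf.comp_of_eq (contMDiffAt_symm_of_mem_maximalAtlas hφ (φ.map_source hx))
    (φ.left_inv hx)

theorem contMDiffAt_of_comp_chart_symm {V : Type*} [NormedAddCommGroup V] [NormedSpace ℝ V]
    (hφ : φ ∈ charts d N) {x : N} (hx : x ∈ φ.source) {f : N → V}
    (hf : ContDiffAt ℝ ∞ (fun u => f (φ.symm u)) (φ x)) :
    ContMDiffAt (𝓡 d) 𝓘(ℝ, V) ∞ f x := by
  have h := hf.contMDiffAt.comp x (contMDiffAt_of_mem_maximalAtlas hφ hx)
  refine h.congr_of_eventuallyEq ?_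
  filter_upwards [φ.open_source.mem_nhds hx] with z hz
  simp [φ.left_inv hz]

theorem coordCovec_apply (hφ : φ ∈ charts d N) {x : N} (hx : x ∈ φ.source)
    (a : EuclideanSpace ℝ (Fin d) →L[ℝ] ℝ) (ξ : TangentSpace (𝓡 d) x) :
    coordCovec φ a x ξ = a (mfderiv (𝓡 d) (𝓡 d) φ x ξ) := by
  have h := mfderiv_comp_apply (I' := 𝓡 d) (I'' := 𝓘(ℝ, ℝ)) x
    (a.differentiableAt.mdifferentiableAt)
    ((mdifferentiable_of_mem_charts hφ).mdifferentiableAt hx) ξ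
  rw [mfderiv_eq_fderiv, a.fderiv] at h
  exact h

theorem coordCovec_coordVec (hφ : φ ∈ charts d N) {x : N} (hx : x ∈ φ.source)
    (a : EuclideanSpace ℝ (Fin d) →L[ℝ] ℝ) (v : EuclideanSpace ℝ (Fin d)) :
    coordCovec φ a x (coordVec φ x v) = a v := by
  rw [coordCovec_apply hφ hx, mfderiv_coordVec_self hφ hx]

theorem coordCovec_comp_coordVec (hφ : φ ∈ charts d N) {x : N} (hx : x ∈ φ.source)
    (a : TangentSpace (𝓡 d) x →L[ℝ] ℝ) : coordCovec φ (a.comp (coordVec φ x)) x = a :=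
  covector_ext hφ hx fun v => coordCovec_coordVec hφ hx _ v

/-- The components of a covector field in a chart. -/
def coord₁ (α : CovectorField d N) (φ : OpenPartialHomeomorph N (EuclideanSpace ℝ (Fin d)))
    (u : EuclideanSpace ℝ (Fin d)) : EuclideanSpace ℝ (Fin d) →L[ℝ] ℝ :=
  (α (φ.symm u)).comp (coordVec φ (φ.symm u))

theorem coord₁_apply (α : CovectorField d N) (u v : EuclideanSpace ℝ (Fin d)) :
    coord₁ α φ u v = comp₁ α φ v u := rfl

theorem contDiffOn_coord₁ {α : CovectorField d N} (hα : IsSmooth₁ α) (hφ : φ ∈ charts d N) :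
    ContDiffOn ℝ ∞ (coord₁ α φ) φ.target :=
  contDiffOn_clm_apply.2 fun v => hα φ hφ v

/-- The components of a bilinear field in a chart. -/
def coord₂ (τ : BilinField d N) (φ : OpenPartialHomeomorph N (EuclideanSpace ℝ (Fin d)))
    (u : EuclideanSpace ℝ (Fin d)) :
    EuclideanSpace ℝ (Fin d) →L[ℝ] EuclideanSpace ℝ (Fin d) →L[ℝ] ℝ :=
  let T : EuclideanSpace ℝ (Fin d) →L[ℝ] EuclideanSpace ℝ (Fin d) := coordVec φ (φ.symm u)
  let t : EuclideanSpace ℝ (Fin d) →L[ℝ] EuclideanSpace ℝ (Fin d) →L[ℝ] ℝ := τ (φ.symm u)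
  t.bilinearComp T T

theorem coord₂_apply (τ : BilinField d N) (u v w : EuclideanSpace ℝ (Fin d)) :
    coord₂ τ φ u v w = comp₂ τ φ v w u := rfl

theorem contDiffOn_coord₂ {τ : BilinField d N} {U : Set N} (hτ : IsTwoFormOn U τ)
    (hφ : φ ∈ charts d N) : ContDiffOn ℝ ∞ (coord₂ τ φ) (φ.target ∩ φ.symm ⁻¹' U) :=
  contDiffOn_clm_apply.2 fun v => contDiffOn_clm_apply.2 fun w => hτ.2 φ hφ v w

theorem contDiffAt_coord₂ {τ : BilinField d N} {U : Set N} (hU : IsOpen U) (hτ : IsTwoFormOn U τ)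
    (hφ : φ ∈ charts d N) {x : N} (hx : x ∈ φ.source) (hxU : x ∈ U) :
    ContDiffAt ℝ ∞ (coord₂ τ φ) (φ x) :=
  (contDiffOn_coord₂ hτ hφ).contDiffAt <| (φ.isOpen_inter_preimage_symm hU).mem_nhds
    ⟨φ.map_source hx, by simpa [φ.left_inv hx] using hxU⟩

end ChartCalculus

section MapCalculus

variable {d n : ℕ} {N M : Type*} [TopologicalSpace N] [ChartedSpace (EuclideanSpace ℝ (Fin d)) N]
  [TopologicalSpace M] [ChartedSpace (EuclideanSpace ℝ (Fin n)) M]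
  {φ : OpenPartialHomeomorph N (EuclideanSpace ℝ (Fin d))}
  {ψ : OpenPartialHomeomorph M (EuclideanSpace ℝ (Fin n))}

theorem contDiffAt_coord_map (hφ : φ ∈ charts d N) (hψ : ψ ∈ charts n M) {X : N → M} {x : N}
    (hx : x ∈ φ.source) (hXx : X x ∈ ψ.source) (hX : ContMDiffAt (𝓡 d) (𝓡 n) ∞ X x) :
    ContDiffAt ℝ ∞ (fun u => ψ (X (φ.symm u))) (φ x) :=
  contDiffAt_comp_chart_symm hφ hx ((contMDiffAt_of_mem_maximalAtlas hψ hXx).comp x hX)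

theorem mfderiv_coordVec (hφ : φ ∈ charts d N) (hψ : ψ ∈ charts n M) {X : N → M} {x : N}
    (hx : x ∈ φ.source) (hXx : X x ∈ ψ.source) (hX : MDifferentiableAt (𝓡 d) (𝓡 n) X x)
    (v : EuclideanSpace ℝ (Fin d)) :
    mfderiv (𝓡 d) (𝓡 n) X x (coordVec φ x v)
      = coordVec ψ (X x) (fderiv ℝ (fun u => ψ (X (φ.symm u))) (φ x) v) := by
  have hφs := (mdifferentiable_of_mem_charts hφ).mdifferentiableAt_symm (φ.map_source hx)
  have h1 : MDifferentiableAt (𝓡 d) (𝓡 n) (fun z => ψ (X z)) x :=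
    ((mdifferentiable_of_mem_charts hψ).mdifferentiableAt hXx).comp x hX
  have h2 := mfderiv_comp_apply_of_eq (φ x) h1 hφs (φ.left_inv hx) v
  have h3 := mfderiv_comp_apply x ((mdifferentiable_of_mem_charts hψ).mdifferentiableAt hXx) hX
    (coordVec φ x v)
  rw [← coordVec_mfderiv hψ hXx (mfderiv (𝓡 d) (𝓡 n) X x (coordVec φ x v))]
  congr 1
  rw [← mfderiv_eq_fderiv]
  exact h3.symm.trans h2.symm

end MapCalculus

section PoissonCoord

variable {n : ℕ} {M : Type*} [TopologicalSpace M] [ChartedSpace (EuclideanSpace ℝ (Fin n)) M]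
  {ψ : OpenPartialHomeomorph M (EuclideanSpace ℝ (Fin n))} (P : PoissonTensor n M)

/-- The Poisson tensor in a chart. -/
def PoissonTensor.coord (ψ : OpenPartialHomeomorph M (EuclideanSpace ℝ (Fin n)))
    (y : EuclideanSpace ℝ (Fin n)) :
    (EuclideanSpace ℝ (Fin n) →L[ℝ] ℝ) →L[ℝ] EuclideanSpace ℝ (Fin n) :=
  let T : EuclideanSpace ℝ (Fin n) →L[ℝ] EuclideanSpace ℝ (Fin n) :=
    mfderiv (𝓡 n) (𝓡 n) ψ (ψ.symm y)
  let p : (EuclideanSpace ℝ (Fin n) →L[ℝ] ℝ) →L[ℝ] EuclideanSpace ℝ (Fin n) := P.sharp (ψ.symm y)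
  T ∘L p ∘L ContinuousLinearMap.precomp ℝ T

theorem PoissonTensor.coord_eq (hψ : ψ ∈ charts n M) {y : EuclideanSpace ℝ (Fin n)}
    (hy : y ∈ ψ.target) (b : EuclideanSpace ℝ (Fin n) →L[ℝ] ℝ) :
    P.coord ψ y b = mfderiv (𝓡 n) (𝓡 n) ψ (ψ.symm y)
      (P.sharp (ψ.symm y) (coordCovec ψ b (ψ.symm y))) := by
  have : coordCovec ψ b (ψ.symm y) = b ∘L (mfderiv (𝓡 n) (𝓡 n) ψ (ψ.symm y)) := by
    ext ξ
    exact coordCovec_apply hψ (ψ.map_target hy) b ξ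
  rw [this]
  rfl

theorem PoissonTensor.apply_coord (hψ : ψ ∈ charts n M) {y : EuclideanSpace ℝ (Fin n)}
    (hy : y ∈ ψ.target) (a b : EuclideanSpace ℝ (Fin n) →L[ℝ] ℝ) :
    a (P.coord ψ y b) = P.comp ψ a b y := by
  rw [P.coord_eq hψ hy, PoissonTensor.comp, coordCovec_apply hψ (ψ.map_target hy) a]

theorem PoissonTensor.sharp_eq_coord (hψ : ψ ∈ charts n M) {x : M} (hx : x ∈ ψ.source)
    (b : TangentSpace (𝓡 n) x →L[ℝ] ℝ) :
    P.sharp x b = coordVec ψ x (P.coord ψ (ψ x) (b.comp (coordVec ψ x))) := by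
  rw [P.coord_eq hψ (ψ.map_source hx)]
  -- The point determines the tangent space in which the terms live, so `ψ.symm (ψ x) = x` is used
  -- by generalising the point and substituting. The same device recurs below.
  have key : ∀ x', x' = x → P.sharp x b = coordVec ψ x (mfderiv (𝓡 n) (𝓡 n) ψ x' (P.sharp x' (coordCovec ψ (b.comp (coordVec ψ x)) x'))) := by
    rintro x' rfl
    rw [coordVec_mfderiv hψ hx, coordCovec_comp_coordVec hψ hx]
  exact key _ (ψ.left_inv hx)

theorem PoissonTensor.contDiffOn_coord (hψ : ψ ∈ charts n M) :
    ContDiffOn ℝ ∞ (P.coord ψ) ψ.target := by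
  refine contDiffOn_clm_apply.2 fun b => contDiffOn_euclidean.2 fun i => ?_
  refine (P.smooth ψ hψ (EuclideanSpace.proj i) b).congr fun y hy => ?_
  exact P.apply_coord hψ hy (EuclideanSpace.proj i) b

theorem PoissonTensor.dComp_eq (hψ : ψ ∈ charts n M) {x : M} (hx : x ∈ ψ.source)
    (e : EuclideanSpace ℝ (Fin n)) (a b : TangentSpace (𝓡 n) x →L[ℝ] ℝ) :
    P.dComp ψ x e a b
      = (a.comp (coordVec ψ x)) (fderiv ℝ (P.coord ψ) (ψ x) e (b.comp (coordVec ψ x))) := by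
  have hd : HasFDerivAt (P.coord ψ) _ (ψ x) := (((P.contDiffOn_coord hψ).contDiffAt
    (ψ.open_target.mem_nhds (ψ.map_source hx))).differentiableAt (by simp)).hasFDerivAt
  have h1 := (a.comp (coordVec ψ x)).hasFDerivAt.comp (ψ x)
    (hd.clm_apply (hasFDerivAt_const (b.comp (coordVec ψ x)) (ψ x)))
  have h2 : P.comp ψ (a.comp (coordVec ψ x)) (b.comp (coordVec ψ x)) =ᶠ[𝓝 (ψ x)]
      fun y => (a.comp (coordVec ψ x)) (P.coord ψ y (b.comp (coordVec ψ x))) := by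
    filter_upwards [ψ.open_target.mem_nhds (ψ.map_source hx)] with y hy
    exact (P.apply_coord hψ hy _ _).symm
  rw [PoissonTensor.dComp, h2.fderiv_eq]
  refine (congrArg (fun T => T e) h1.fderiv).trans ?_
  simp

end PoissonCoord

end PSM

end

noncomputable section

namespace PSM

/-! ### Kernel and range of a skew map. -/

section PoissonLinear

variable {E ι : Type*} [NormedAddCommGroup E] [NormedSpace ℝ E] [FiniteDimensional ℝ E]

/-- For skew `p` the range is the annihilator of the kernel: a functional separating `v` from the
range lies in the kernel by skewness, hence in the span of the `f I`, which all vanish on `v`. -/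
theorem mem_range_of_skew {p : (E →L[ℝ] ℝ) →L[ℝ] E} (skew : ∀ a b : E →L[ℝ] ℝ, a (p b) = - b (p a))
    {f : ι → E →L[ℝ] ℝ} (hker : ∀ a, p a = 0 → a ∈ Submodule.span ℝ (Set.range f)) {v : E}
    (hv : ∀ I, f I v = 0) : ∃ a, p a = v := by
  by_contra hne
  have hnm : v ∉ LinearMap.range p.toLinearMap := fun ⟨a, ha⟩ => hne ⟨a, ha⟩
  obtain ⟨g, hgv, hg⟩ := Submodule.exists_le_ker_of_notMem hnm
  let g' : E →L[ℝ] ℝ := LinearMap.toContinuousLinearMap g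
  have hpg : p g' = 0 := by
    by_contra hpne
    obtain ⟨b, hb⟩ := exists_dual_vector'' ℝ (p g')
    have h1 : b (p g') = - g (p b) := skew b g'
    have h2 : g (p b) = 0 := hg ⟨b, rfl⟩
    rw [hb.2, h2, neg_zero] at h1
    exact hpne (norm_eq_zero.1 (by exact_mod_cast h1))
  have hle : Submodule.span ℝ (Set.range f) ≤
      LinearMap.ker (ContinuousLinearMap.apply ℝ ℝ v).toLinearMap := by
    rw [Submodule.span_le]
    rintro _ ⟨I, rfl⟩
    exact hv I
  exact hgv (hle (hker g' hpg))

/-- A frame of the kernel of `p y₀` that stays in the kernel remains a frame of the kernel. -/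
theorem eventually_ker_eq_span [Fintype ι] {p : E → (E →L[ℝ] ℝ) →L[ℝ] E} {f : ι → E → E →L[ℝ] ℝ} {y : E}
    (hp : ContinuousAt p y) (hf : ∀ I, ContinuousAt (f I) y)
    (hli : LinearIndependent ℝ fun I => f I y) (hpf : ∀ᶠ z in 𝓝 y, ∀ I, p z (f I z) = 0)
    (hrank : Module.finrank ℝ (LinearMap.ker (p y).toLinearMap) = Fintype.card ι) :
    ∀ᶠ z in 𝓝 y, (LinearIndependent ℝ fun I => f I z) ∧
      ∀ a, p z a = 0 → a ∈ Submodule.span ℝ (Set.range fun I => f I z) := by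
  let r := Module.finrank ℝ (LinearMap.range (p y).toLinearMap)
  let b := Module.finBasis ℝ (LinearMap.range (p y).toLinearMap)
  choose a ha using fun i => (b i).2
  have hli' : LinearIndependent ℝ fun i => p y (a i) := by
    have h := b.linearIndependent.map' (LinearMap.range (p y).toLinearMap).subtype
      (Submodule.ker_subtype _)
    have h2 : (fun i => p y (a i)) = (LinearMap.range (p y).toLinearMap).subtype ∘ b := by
      funext i
      exact ha i
    rw [h2]
    exact h
  have h1 : ∀ᶠ z in 𝓝 y, LinearIndependent ℝ fun i => p z (a i) := by
    have hc : ContinuousAt (fun z i => p z (a i)) y :=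
      continuousAt_pi.2 fun i => hp.clm_apply continuousAt_const
    exact hc.eventually (isOpen_setOfPred_linearIndependent.mem_nhds hli')
  have h2 : ∀ᶠ z in 𝓝 y, LinearIndependent ℝ fun I => f I z := by
    have hc : ContinuousAt (fun z I => f I z) y := continuousAt_pi.2 hf
    exact hc.eventually (isOpen_setOfPred_linearIndependent.mem_nhds hli)
  filter_upwards [h1, h2, hpf] with z hz1 hz2 hz3
  refine ⟨hz2, ?_⟩
  have hle : Submodule.span ℝ (Set.range fun I => f I z) ≤ LinearMap.ker (p z).toLinearMap := by
    rw [Submodule.span_le]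
    rintro _ ⟨I, rfl⟩
    exact hz3 I
  -- The rank cannot drop nearby because images of finitely many covectors stay independent. So the
  -- kernel cannot grow, and the independent elements already in it span it.
  have hr : r ≤ Module.finrank ℝ (LinearMap.range (p z).toLinearMap) := by
    have h := finrank_span_eq_card hz1
    rw [Fintype.card_fin] at h
    refine h.symm.le.trans (Submodule.finrank_mono ?_)
    rw [Submodule.span_le]
    rintro _ ⟨i, rfl⟩
    exact ⟨a i, rfl⟩
  have hd1 := LinearMap.finrank_range_add_finrank_ker (p y).toLinearMap
  have hd2 := LinearMap.finrank_range_add_finrank_ker (p z).toLinearMap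
  have hs := finrank_span_eq_card hz2
  have heq := Submodule.eq_of_le_of_finrank_le hle (by omega)
  intro a ha
  rw [heq]
  exact ha

end PoissonLinear

/-! ### Connectedness of symplectic leaves. -/

section Leaf

variable {n : ℕ} {M : Type*} [TopologicalSpace M] [ChartedSpace (EuclideanSpace ℝ (Fin n)) M]
  {P : PoissonTensor n M}

theorem IsSymplecticLeaf.nonempty {L : Set M} (hL : IsSymplecticLeaf P L) : L.Nonempty := by
  obtain ⟨x₀, rfl⟩ := hL
  exact ⟨x₀, Relation.EqvGen.refl _⟩

/-- The reparametrisation `s ↦ t s`, with covectors scaled by `t`, makes every point of a cotangent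
curve an endpoint at time 1. It yields that the whole curve lies in one leaf. -/
theorem CotangentStep.of_curve {γ : ℝ → M} {η : ∀ t, TangentSpace (𝓡 n) (γ t) →L[ℝ] ℝ}
    (hγ : ContMDiff 𝓘(ℝ, ℝ) (𝓡 n) ∞ γ)
    (hη : ∀ ψ ∈ charts n M, ∀ e,
      ContDiffOn ℝ ∞ (fun t => η t (coordVec ψ (γ t) e)) (γ ⁻¹' ψ.source))
    (hv : ∀ t, mfderiv 𝓘(ℝ, ℝ) (𝓡 n) γ t (1 : ℝ) = P.sharp (γ t) (η t)) (t : ℝ) :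
    CotangentStep P (γ 0) (γ t) := by
  have hsm : ContDiff ℝ ∞ fun s : ℝ => t * s := by fun_prop
  refine ⟨fun s => γ (t * s), fun s => t • η (t * s), hγ.comp hsm.contMDiff, ?_, ?_,
    by simp, by simp⟩
  · intro ψ hψ e
    have h : ContDiffOn ℝ ∞ (fun s => t * (fun t => η t (coordVec ψ (γ t) e)) (t * s))
        ((fun s => γ (t * s)) ⁻¹' ψ.source) :=
      contDiffOn_const.mul ((hη ψ hψ e).comp hsm.contDiffOn fun s hs => hs)
    exact h
  · intro s
    have h1 := mfderiv_comp_apply (I := 𝓘(ℝ, ℝ)) (I' := 𝓘(ℝ, ℝ)) s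
      ((hγ.mdifferentiable (by simp)) (t * s))
      ((hsm.differentiable (by simp) s).mdifferentiableAt) (1 : ℝ)
    refine h1.trans ?_
    rw [mfderiv_eq_fderiv]
    have h2 : fderiv ℝ (fun s : ℝ => t * s) s (1 : ℝ) = t • (1 : ℝ) := by
      rw [fderiv_const_mul differentiableAt_id]
      simp
    have h3 : P.sharp (γ (t * s)) (t • η (t * s)) = t • P.sharp (γ (t * s)) (η (t * s)) :=
      map_smul _ _ _
    rw [h3, ← hv]
    exact (congrArg (mfderiv 𝓘(ℝ, ℝ) (𝓡 n) γ (t * s)) h2).trans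
      (map_smul (mfderiv 𝓘(ℝ, ℝ) (𝓡 n) γ (t * s)) t (1 : ℝ))

theorem IsSymplecticLeaf.mem_of_step {L : Set M} (hL : IsSymplecticLeaf P L) {x y : M}
    (h : CotangentStep P x y) : x ∈ L ↔ y ∈ L := by
  obtain ⟨x₀, rfl⟩ := hL
  exact ⟨fun hx => hx.trans _ _ _ (.rel _ _ h), fun hy => hy.trans _ _ _ ((Relation.EqvGen.rel _ _ h).symm)⟩

/-- A chain of cotangent curves is a connected subset of `L` joining its ends. Connectedness in the
topology of `M` is what lets local statements along `L` propagate. -/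
theorem IsSymplecticLeaf.isPreconnected {L : Set M} (hL : IsSymplecticLeaf P L) :
    IsPreconnected L := by
  have key : ∀ x y, Relation.EqvGen (CotangentStep P) x y → x ∈ L →
      ∃ t ⊆ L, x ∈ t ∧ y ∈ t ∧ IsPreconnected t := by
    intro x y h
    have hmem : ∀ x y, Relation.EqvGen (CotangentStep P) x y → x ∈ L → y ∈ L := by
      obtain ⟨x₀, rfl⟩ := hL
      exact fun x y h hx => hx.trans _ _ _ h
    induction h with
    | rel x y h =>
      intro hx
      obtain ⟨γ, η, hγ, hη, hv, rfl, rfl⟩ := h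
      refine ⟨Set.range γ, ?_, ⟨0, rfl⟩, ⟨1, rfl⟩, isPreconnected_range hγ.continuous⟩
      rintro _ ⟨t, rfl⟩
      exact (hL.mem_of_step (CotangentStep.of_curve hγ hη hv t)).1 hx
    | refl x => exact fun hx => ⟨{x}, by simpa using hx, rfl, rfl, isPreconnected_singleton⟩
    | symm x y h ih =>
      intro hy
      obtain ⟨t, h1, h2, h3, h4⟩ := ih (hmem _ _ h.symm hy)
      exact ⟨t, h1, h3, h2, h4⟩
    | trans x y z h h' ih ih' =>
      intro hx
      obtain ⟨t, h1, h2, h3, h4⟩ := ih hx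
      obtain ⟨t', h1', h2', h3', h4'⟩ := ih' (h1 h3)
      exact ⟨t ∪ t', Set.union_subset h1 h1', Or.inl h2, Or.inr h3', h4.union y h3 h2' h4'⟩
  obtain ⟨x₀, rfl⟩ := id hL
  exact isPreconnected_of_forall x₀ fun y hy => key x₀ y hy (Relation.EqvGen.refl _)

/-- Composition with `coordVec` maps one kernel isomorphically onto the other, with inverse
`coordCovec`. -/
theorem PoissonTensor.finrank_ker_coord {ψ : OpenPartialHomeomorph M (EuclideanSpace ℝ (Fin n))}
    (hψ : ψ ∈ charts n M) {x : M} (hx : x ∈ ψ.source) :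
    Module.finrank ℝ (LinearMap.ker (P.coord ψ (ψ x)).toLinearMap)
      = Module.finrank ℝ (LinearMap.ker (P.sharp x).toLinearMap) := by
  refine LinearEquiv.finrank_eq (LinearEquiv.ofBijective
    ((LinearMap.codRestrict (LinearMap.ker (P.coord ψ (ψ x)).toLinearMap)
      ({ toFun := fun a => (a.1.comp (coordVec ψ x) : EuclideanSpace ℝ (Fin n) →L[ℝ] ℝ)
         map_add' := fun a b => rfl
         map_smul' := fun r a => rfl } :
        LinearMap.ker (P.sharp x).toLinearMap →ₗ[ℝ] EuclideanSpace ℝ (Fin n) →L[ℝ] ℝ) ?_))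
        ⟨?_, ?_⟩).symm
  · intro a
    have h : P.sharp x a.1 = 0 := a.2
    rw [P.sharp_eq_coord hψ hx] at h
    exact coordVec_injective hψ hx (h.trans (map_zero _).symm)
  · intro a b h
    refine Subtype.ext (covector_ext hψ hx fun v => ?_)
    exact congrArg (fun T => T.1 v) h
  · intro b
    refine ⟨⟨coordCovec ψ b.1 x, ?_⟩, ?_⟩
    · have hb : (coordCovec ψ b.1 x).comp (coordVec ψ x) = b.1 := by
        ext v
        exact coordCovec_coordVec hψ hx _ v
      change P.sharp x _ = 0
      rw [P.sharp_eq_coord hψ hx, hb]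
      exact (congrArg (coordVec ψ x) b.2).trans (map_zero _)
    · refine Subtype.ext ?_
      ext v
      exact coordCovec_coordVec hψ hx _ v

end Leaf

end PSM

end

noncomputable section

namespace PSM

/-! ### Local geometry of defining Casimir functions. -/

section Defining

variable {n k : ℕ} {M : Type*} [TopologicalSpace M] [ChartedSpace (EuclideanSpace ℝ (Fin n)) M]
  {P : PoissonTensor n M} {L W : Set M} {C : Fin k → M → ℝ}

theorem IsCasimirOn.contMDiffAt {f : M → ℝ} (hf : IsCasimirOn P W f) (hW : IsOpen W) {x : M}
    (hx : x ∈ W) : ContMDiffAt (𝓡 n) 𝓘(ℝ, ℝ) ∞ f x :=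
  hf.1.contMDiffAt (hW.mem_nhds hx)

theorem IsCasimirOn.mdifferentiableAt {f : M → ℝ} (hf : IsCasimirOn P W f) (hW : IsOpen W) {x : M}
    (hx : x ∈ W) : MDifferentiableAt (𝓡 n) 𝓘(ℝ, ℝ) f x :=
  (hf.contMDiffAt hW hx).mdifferentiableAt (by simp)

theorem IsCasimirOn.mvfderiv_sharp {f : M → ℝ} (hf : IsCasimirOn P W f) {x : M}
    (hx : x ∈ W) (a : TangentSpace (𝓡 n) x →L[ℝ] ℝ) : mvfderiv (𝓡 n) f x (P.sharp x a) = 0 := by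
  rw [P.skew, hf.2 x hx, map_zero, neg_zero]

theorem IsDefining.contMDiffAt (hC : IsDefining P L W C) {x : M} (hx : x ∈ W) (I : Fin k) :
    ContMDiffAt (𝓡 n) 𝓘(ℝ, ℝ) ∞ (C I) x :=
  (hC.casimir I).contMDiffAt hC.isOpen hx

theorem IsDefining.mdifferentiableAt (hC : IsDefining P L W C) {x : M} (hx : x ∈ W) (I : Fin k) :
    MDifferentiableAt (𝓡 n) 𝓘(ℝ, ℝ) (C I) x :=
  (hC.casimir I).mdifferentiableAt hC.isOpen hx

theorem IsDefining.eq_zero (hC : IsDefining P L W C) {x : M} (hxL : x ∈ L) (hx : x ∈ W)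
    (I : Fin k) : C I x = 0 := by
  have h : x ∈ L ∩ W := ⟨hxL, hx⟩
  rw [hC.zeroSet] at h
  exact h.2 I

theorem IsDefining.mono (hC : IsDefining P L W C) {V : Set M} (hV : IsOpen V) (hVW : V ⊆ W) :
    IsDefining P L V C where
  isOpen := hV
  casimir I := ⟨(hC.casimir I).1.mono hVW, fun x hx => (hC.casimir I).2 x (hVW hx)⟩
  indep x hx := hC.indep x ⟨hx.1, hVW hx.2⟩
  zeroSet := by
    ext x
    constructor
    · exact fun h => ⟨h.2, hC.eq_zero h.1 (hVW h.2)⟩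
    · intro h
      have h' : x ∈ L ∩ W := by
        rw [hC.zeroSet]
        exact ⟨hVW h.1, h.2⟩
      exact ⟨h'.1, h.1⟩

theorem mvfderiv_congr {f g : M → ℝ} {x : M} (h : f =ᶠ[𝓝 x] g) :
    mvfderiv (𝓡 n) f x = mvfderiv (𝓡 n) g x :=
  h.mfderiv_eq

theorem IsDefining.congr {D : Fin k → M → ℝ} (hC : IsDefining P L W C)
    (h : ∀ x ∈ W, ∀ I, D I =ᶠ[𝓝 x] C I) : IsDefining P L W D where
  isOpen := hC.isOpen
  casimir I := by
    refine ⟨(hC.casimir I).1.congr fun x hx => (h x hx I).eq_of_nhds, fun x hx => ?_⟩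
    rw [mvfderiv_congr (h x hx I)]
    exact (hC.casimir I).2 x hx
  indep x hx := by
    have : (fun I => mvfderiv (𝓡 n) (D I) x) = fun I => mvfderiv (𝓡 n) (C I) x :=
      funext fun I => mvfderiv_congr (h x hx.2 I)
    rw [this]
    exact hC.indep x hx
  zeroSet := by
    rw [hC.zeroSet]
    ext x
    refine and_congr_right fun hx => forall_congr' fun I => ?_
    rw [(h x hx I).eq_of_nhds]

/-- A function that is locally defining is defining. -/
theorem IsDefining.of_local (hW : IsOpen W)
    (h : ∀ x ∈ W, ∃ V, x ∈ V ∧ IsDefining P L V C) : IsDefining P L W C where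
  isOpen := hW
  casimir I := by
    refine ⟨fun x hx => ?_, fun x hx => ?_⟩
    · obtain ⟨V, hxV, hV⟩ := h x hx
      exact (hV.contMDiffAt hxV I).contMDiffWithinAt
    · obtain ⟨V, hxV, hV⟩ := h x hx
      exact (hV.casimir I).2 x hxV
  indep x hx := by
    obtain ⟨V, hxV, hV⟩ := h x hx.2
    exact hV.indep x ⟨hx.1, hxV⟩
  zeroSet := by
    ext x
    constructor
    · intro hx
      obtain ⟨V, hxV, hV⟩ := h x hx.2
      exact ⟨hx.2, hV.eq_zero hx.1 hxV⟩
    · intro hx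
      obtain ⟨V, hxV, hV⟩ := h x hx.1
      have h' : x ∈ L ∩ V := by
        rw [hV.zeroSet]
        exact ⟨hxV, hx.2⟩
      exact ⟨h'.1, hx.1⟩

/-- The `dC^I` are `k` independent elements of a kernel of dimension `k`. -/
theorem ker_sharp_le_span (hL : IsRegularLeaf P k L) (hC : IsDefining P L W C) {x : M}
    (hxL : x ∈ L) (hx : x ∈ W) {a : TangentSpace (𝓡 n) x →L[ℝ] ℝ} (ha : P.sharp x a = 0) :
    a ∈ Submodule.span ℝ (Set.range fun I => mvfderiv (𝓡 n) (C I) x) := by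
  have hfd : FiniteDimensional ℝ (TangentSpace (𝓡 n) x →L[ℝ] ℝ) :=
    inferInstanceAs (FiniteDimensional ℝ (EuclideanSpace ℝ (Fin n) →L[ℝ] ℝ))
  have hle : Submodule.span ℝ (Set.range fun I => mvfderiv (𝓡 n) (C I) x)
      ≤ LinearMap.ker (P.sharp x).toLinearMap := by
    rw [Submodule.span_le]
    rintro _ ⟨I, rfl⟩
    exact (hC.casimir I).2 x hx
  rw [Submodule.eq_of_le_of_finrank_le hle ?_]
  · exact ha
  · rw [hL.corank x hxL, finrank_span_eq_card (hC.indep x ⟨hxL, hx⟩), Fintype.card_fin]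

theorem exists_sharp_eq (hL : IsRegularLeaf P k L) (hC : IsDefining P L W C) {x : M}
    (hxL : x ∈ L) (hx : x ∈ W) {ξ : TangentSpace (𝓡 n) x}
    (hξ : ∀ I, mvfderiv (𝓡 n) (C I) x ξ = 0) : ∃ a, P.sharp x a = ξ :=
  mem_range_of_skew (E := EuclideanSpace ℝ (Fin n)) (p := P.sharp x) (P.skew x)
    (fun _ ha => ker_sharp_le_span hL hC hxL hx ha) hξ

theorem hasFDerivAt_coord (hC : IsDefining P L W C)
    {ψ : OpenPartialHomeomorph M (EuclideanSpace ℝ (Fin n))} (hψ : ψ ∈ charts n M)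
    {u : EuclideanSpace ℝ (Fin n)} (hu : u ∈ ψ.target) (huW : ψ.symm u ∈ W) (I : Fin k) :
    HasFDerivAt (fun u => C I (ψ.symm u)) ((mvfderiv (𝓡 n) (C I) (ψ.symm u)).comp
      (coordVec ψ (ψ.symm u)) : EuclideanSpace ℝ (Fin n) →L[ℝ] ℝ) u := by
  have hs := ψ.map_target hu
  have h := contDiffAt_comp_chart_symm hψ hs (hC.contMDiffAt huW I)
  rw [ψ.right_inv hu] at h
  convert! (h.differentiableAt (by simp)).hasFDerivAt using 1
  ext v
  have h2 := mvfderiv_coordVec hψ hs (hC.mdifferentiableAt huW I) v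
  rw [ψ.right_inv hu] at h2
  exact h2

/-- Near a point of the leaf, defining functions form, in a chart, a submersion whose fibres are
tangent to the image of the Poisson tensor. -/
theorem exists_coord_submersion (hL : IsRegularLeaf P k L) (hC : IsDefining P L W C) {x : M}
    (hxL : x ∈ L) (hx : x ∈ W)
    {ψ : OpenPartialHomeomorph M (EuclideanSpace ℝ (Fin n))} (hψ : ψ ∈ charts n M)
    (hxψ : x ∈ ψ.source) {V : Set M} (hV : V ∈ 𝓝 x) :
    ∃ O, IsOpen O ∧ ψ x ∈ O ∧ O ⊆ ψ.target ∩ ψ.symm ⁻¹' (W ∩ V) ∧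
      ContDiffOn ℝ ∞ (fun u I => C I (ψ.symm u)) O ∧
      Function.Surjective (fderiv ℝ (fun u I => C I (ψ.symm u)) (ψ x)) ∧
      ∀ u ∈ O, ∀ v, fderiv ℝ (fun u I => C I (ψ.symm u)) u v = 0 →
        ∃ a, P.sharp (ψ.symm u) a = coordVec ψ (ψ.symm u) v := by
  have hWo : IsOpen (ψ.target ∩ ψ.symm ⁻¹' W) := ψ.isOpen_inter_preimage_symm hC.isOpen
  have hxs : ψ x ∈ ψ.target ∩ ψ.symm ⁻¹' W :=
    ⟨ψ.map_source hxψ, by simpa [ψ.left_inv hxψ] using hx⟩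
  have hpi : ∀ u ∈ ψ.target ∩ ψ.symm ⁻¹' W, HasFDerivAt (fun u I => C I (ψ.symm u))
      (ContinuousLinearMap.pi fun I => fderiv ℝ (fun u => C I (ψ.symm u)) u) u := fun u hu =>
    hasFDerivAt_pi.2 fun I => (hasFDerivAt_coord hC hψ hu.1 hu.2 I).differentiableAt.hasFDerivAt
  have hD : ∀ I, ContDiffOn ℝ ∞ (fun u => C I (ψ.symm u)) (ψ.target ∩ ψ.symm ⁻¹' W) := by
    intro I u hu
    have h := contDiffAt_comp_chart_symm hψ (ψ.map_target hu.1) (hC.contMDiffAt hu.2 I)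
    rw [ψ.right_inv hu.1] at h
    exact h.contDiffWithinAt
  have hli : LinearIndependent ℝ fun I => fderiv ℝ (fun u => C I (ψ.symm u)) (ψ x) := by
    have h1 := hC.indep x ⟨hxL, hx⟩
    rw [Fintype.linearIndependent_iff] at h1 ⊢
    intro g hg
    refine h1 g (covector_ext hψ hxψ fun v => ?_)
    have h2 := congrArg (fun T => T v) hg
    simp only [← mvfderiv_coordVec hψ hxψ (hC.mdifferentiableAt hx _), _root_.sum_apply,
      _root_.smul_apply, _root_.zero_apply] at h2 ⊢
    exact h2
  have hcas : ∀ᶠ u in 𝓝 (ψ x), ∀ I, P.coord ψ u (fderiv ℝ (fun u => C I (ψ.symm u)) u) = 0 := by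
    filter_upwards [hWo.mem_nhds hxs] with u hu I
    rw [(hasFDerivAt_coord hC hψ hu.1 hu.2 I).fderiv, P.coord_eq hψ hu.1,
      coordCovec_comp_coordVec hψ (ψ.map_target hu.1), (hC.casimir I).2 _ hu.2]
    exact map_zero _
  have hrank : Module.finrank ℝ (LinearMap.ker (P.coord ψ (ψ x)).toLinearMap)
      = Fintype.card (Fin k) := by
    rw [PoissonTensor.finrank_ker_coord hψ hxψ, hL.corank x hxL, Fintype.card_fin]
  -- Independence and corank are given only on `L`; this carries them to nearby points off the leaf,
  -- so that all nearby fibres, not only the zero fibre, are tangent to the range of 𝒫.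
  have hev := eventually_ker_eq_span
    (((P.contDiffOn_coord hψ).continuousOn).continuousAt (ψ.open_target.mem_nhds hxs.1))
    (fun I => ((hD I).continuousOn_fderiv_of_isOpen hWo (by simp)).continuousAt
      (hWo.mem_nhds hxs)) hli hcas hrank
  have hevV := eventually_chart hxψ hV
  obtain ⟨O, hOs, hO, hxO⟩ := mem_nhds_iff.1 (Filter.inter_mem hev
    (Filter.inter_mem (hWo.mem_nhds hxs) hevV))
  refine ⟨O, hO, hxO, fun u hu => ⟨(hOs hu).2.1.1, (hOs hu).2.1.2, (hOs hu).2.2.2⟩,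
    contDiffOn_pi.2 fun I => (hD I).mono fun u hu => (hOs hu).2.1, ?_, ?_⟩
  · rw [(hpi _ hxs).fderiv]
    exact surjective_of_linearIndependent hli
  · intro u hu v hv
    have huW := (hOs hu).2.1
    rw [(hpi u huW).fderiv] at hv
    obtain ⟨a, ha⟩ := mem_range_of_skew (p := P.coord ψ u)
      (fun a b => by
        rw [P.apply_coord hψ huW.1, P.apply_coord hψ huW.1, PoissonTensor.comp,
          PoissonTensor.comp, P.skew])
      (hOs hu).1.2 (v := v) fun I => congrFun hv I
    refine ⟨coordCovec ψ a (ψ.symm u), ?_⟩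
    rw [P.coord_eq hψ huW.1] at ha
    rw [← ha, coordVec_mfderiv hψ (ψ.map_target huW.1)]

variable [IsManifold (𝓡 n) ∞ M]

/-- Near a point of the leaf, Casimir functions are functions of the defining ones. -/
theorem exists_casimir_eq_comp (hL : IsRegularLeaf P k L) (hC : IsDefining P L W C) {x : M}
    (hxL : x ∈ L) (hx : x ∈ W) {m : ℕ} {f : Fin m → M → ℝ} {V : Set M} (hV : IsOpen V)
    (hxV : x ∈ V) (hf : ∀ s, IsCasimirOn P V (f s)) :
    ∃ (B : Set (Fin k → ℝ)) (h : (Fin k → ℝ) → Fin m → ℝ), IsOpen B ∧ 0 ∈ B ∧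
      ContDiffOn ℝ ∞ h B ∧ ∀ᶠ y in 𝓝 x, ∀ s, f s y = h (fun I => C I y) s := by
  have hψ := chartAt_mem_charts (d := n) x
  set ψ := chartAt (EuclideanSpace ℝ (Fin n)) x
  have hxψ : x ∈ ψ.source := mem_chart_source _ x
  obtain ⟨O, hO, hxO, hOW, hD, hs, hk⟩ :=
    exists_coord_submersion hL hC hxL hx hψ hxψ (hV.mem_nhds hxV)
  have hfd : ∀ s, ∀ u ∈ O, ContDiffAt ℝ ∞ (fun u => f s (ψ.symm u)) u := by
    intro s u hu
    have h := contDiffAt_comp_chart_symm hψ (ψ.map_target (hOW hu).1)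
      ((hf s).contMDiffAt hV (hOW hu).2.2)
    rwa [ψ.right_inv (hOW hu).1] at h
  obtain ⟨B, h, hB, hxB, hh, hev⟩ := exists_eq_comp_of_ker_le
    (f := fun u s => f s (ψ.symm u)) hO hxO hD hs
    (contDiffOn_pi.2 fun s u hu => (hfd s u hu).contDiffWithinAt) (by
      intro u hu v hv
      -- A vector tangent to a fibre is in the range of 𝒫, and Casimir differentials annihilate that
      -- range.
      obtain ⟨a, ha⟩ := hk u hu v hv
      have hpi := hasFDerivAt_pi.2 fun s =>
        ((hfd s u hu).differentiableAt (by simp)).hasFDerivAt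
      rw [hpi.fderiv]
      ext s
      have h1 := mvfderiv_coordVec hψ (ψ.map_target (hOW hu).1)
        ((hf s).mdifferentiableAt hV (hOW hu).2.2) v
      rw [ψ.right_inv (hOW hu).1, ← ha, (hf s).mvfderiv_sharp (hOW hu).2.2] at h1
      exact h1.symm)
  have hx0 : (fun I => C I (ψ.symm (ψ x))) = 0 := by
    funext I
    rw [ψ.left_inv hxψ, hC.eq_zero hxL hx]
    rfl
  refine ⟨B, h, hB, hx0 ▸ hxB, hh, ?_⟩
  filter_upwards [(ψ.continuousAt hxψ).eventually hev, ψ.open_source.mem_nhds hxψ] with y hy hyψ s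
  have := congrFun hy s
  simpa only [ψ.left_inv hyψ] using this

/-- Near `x` the leaf is the zero fibre of a submersion, and fibres of submersions are locally path
connected. -/
theorem eventually_joinedIn_leaf (hL : IsRegularLeaf P k L) (hC : IsDefining P L W C) {x : M}
    (hxL : x ∈ L) (hx : x ∈ W) : ∀ᶠ y in 𝓝 x, y ∈ L → JoinedIn (L ∩ W) x y := by
  have hψ := chartAt_mem_charts (d := n) x
  set ψ := chartAt (EuclideanSpace ℝ (Fin n)) x
  have hxψ : x ∈ ψ.source := mem_chart_source _ x
  obtain ⟨O, hO, hxO, hOW, hD, hs, hk⟩ :=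
    exists_coord_submersion hL hC hxL hx hψ hxψ Filter.univ_mem
  have hx0 : (fun I => C I (ψ.symm (ψ x))) = 0 := by
    funext I
    rw [ψ.left_inv hxψ, hC.eq_zero hxL hx]
    rfl
  filter_upwards [(ψ.continuousAt hxψ).eventually (eventually_joinedIn_fiber hO hxO hD hs),
    ψ.open_source.mem_nhds hxψ, hC.isOpen.mem_nhds hx] with y hy hyψ hyW hyL
  have hy0 : (fun I => C I (ψ.symm (ψ y))) = fun I => C I (ψ.symm (ψ x)) := by
    rw [hx0]
    funext I
    rw [ψ.left_inv hyψ, hC.eq_zero hyL hyW]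
    rfl
  rw [hx0] at hy hy0
  have h := (hy hy0).map_continuousOn (f := ψ.symm)
    (ψ.continuousOn_symm.mono fun u hu => (hOW hu.1).1)
  rw [ψ.left_inv hxψ, ψ.left_inv hyψ] at h
  refine h.mono ?_
  rintro _ ⟨u, ⟨hu, hu0⟩, rfl⟩
  rw [hC.zeroSet]
  refine ⟨(hOW hu).2.1, fun I => ?_⟩
  have h0 := congrFun hu0 I
  exact h0

/-- A submersion is open. This transfers identities between germs on `M` at a point of the leaf to
identities between germs on `ℝ^k` at `0`, as needed to see that two transition maps are mutually
inverse. -/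
theorem map_nhds_defining (hL : IsRegularLeaf P k L) (hC : IsDefining P L W C) {x : M}
    (hxL : x ∈ L) (hx : x ∈ W) : Filter.map (fun y I => C I y) (𝓝 x) = 𝓝 0 := by
  have hψ := chartAt_mem_charts (d := n) x
  set ψ := chartAt (EuclideanSpace ℝ (Fin n)) x
  have hxψ : x ∈ ψ.source := mem_chart_source _ x
  obtain ⟨O, hO, hxO, hOW, hD, hs, hk⟩ :=
    exists_coord_submersion hL hC hxL hx hψ hxψ Filter.univ_mem
  have hst := (hD.contDiffAt (hO.mem_nhds hxO)).hasStrictFDerivAt (by simp)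
  have h := hst.map_nhds_eq_of_surj (LinearMap.range_eq_top.2 hs)
  have hx0 : (fun I => C I (ψ.symm (ψ x))) = 0 := by
    funext I
    rw [ψ.left_inv hxψ, hC.eq_zero hxL hx]
    rfl
  rw [hx0, ← ψ.map_nhds_eq hxψ, Filter.map_map] at h
  rw [← h]
  refine Filter.map_congr ?_
  filter_upwards [ψ.open_source.mem_nhds hxψ] with y hy
  simp [ψ.left_inv hy]

theorem mvfderiv_comp_defining (hC : IsDefining P L W C) {x : M} (hx : x ∈ W)
    {g : (Fin k → ℝ) → ℝ} (hg : DifferentiableAt ℝ g fun I => C I x) {f : M → ℝ}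
    (hf : ∀ᶠ y in 𝓝 x, f y = g fun I => C I y) :
    mvfderiv (𝓡 n) f x
      = ∑ I, fderiv ℝ g (fun I => C I x) (Pi.single I 1) • mvfderiv (𝓡 n) (C I) x := by
  have hψ := chartAt_mem_charts (d := n) x
  set ψ := chartAt (EuclideanSpace ℝ (Fin n)) x
  have hxψ : x ∈ ψ.source := mem_chart_source _ x
  have hd : ∀ I, MDifferentiableAt (𝓡 n) 𝓘(ℝ, ℝ) (C I) x := hC.mdifferentiableAt hx
  have hpi : HasFDerivAt (fun u I => C I (ψ.symm u))
      (ContinuousLinearMap.pi fun I => fderiv ℝ (fun u => C I (ψ.symm u)) (ψ x)) (ψ x) :=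
    hasFDerivAt_pi.2 fun I =>
      ((contDiffAt_comp_chart_symm hψ hxψ (hC.contMDiffAt hx I)).differentiableAt
        (by simp)).hasFDerivAt
  have hx' : (fun I => C I (ψ.symm (ψ x))) = fun I => C I x := by
    simp [ψ.left_inv hxψ]
  have hc := (hx' ▸ hg : DifferentiableAt ℝ g fun I => C I (ψ.symm (ψ x))).hasFDerivAt.comp _ hpi
  have hfu : (fun u => f (ψ.symm u)) =ᶠ[𝓝 (ψ x)] fun u => g fun I => C I (ψ.symm u) := by
    filter_upwards [eventually_chart hxψ hf] with u hu using hu.2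
  have hfm : MDifferentiableAt (𝓡 n) 𝓘(ℝ, ℝ) f x := by
    have h1 : MDifferentiableAt (𝓡 n) 𝓘(ℝ, ℝ) (fun y => g fun I => C I y) x :=
      hg.mdifferentiableAt.comp (I' := 𝓘(ℝ, Fin k → ℝ)) x
        ((contMDiffAt_pi_space.2 (hC.contMDiffAt hx)).mdifferentiableAt (by simp))
    exact h1.congr_of_eventuallyEq hf
  refine covector_ext hψ hxψ fun v => ?_
  rw [mvfderiv_coordVec hψ hxψ hfm, hfu.fderiv_eq]
  refine (congrArg (fun T => T v) hc.fderiv).trans ?_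
  simp only [_root_.sum_apply, _root_.smul_apply,
    mvfderiv_coordVec hψ hxψ (hd _), ContinuousLinearMap.comp_apply, hx', smul_eq_mul]
  have := LinearMap.pi_apply_eq_sum_univ (fderiv ℝ g fun I => C I x).toLinearMap
    (fun I => fderiv ℝ (fun u => C I (ψ.symm u)) (ψ x) v)
  refine this.trans (Finset.sum_congr rfl fun I _ => ?_)
  rw [smul_eq_mul, mul_comm]
  have hsi : (fun j => if I = j then (1 : ℝ) else 0) = Pi.single I 1 := by
    ext j
    simp [Pi.single_apply, eq_comm]
  rw [hsi]
  rfl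

end Defining

end PSM

end

noncomputable section

namespace PSM

/-! ### Gluing germs along a locally closed set. -/

section Gluing

/-- A compatible family of germs along a locally closed subset of a metrizable space is induced by
a single function. -/
theorem exists_eventuallyEq_of_isOpen_diff {X β : Type*} [TopologicalSpace X]
    [TopologicalSpace.MetrizableSpace X] [Nonempty β] {L O : Set X} (hO : IsOpen O) (hLO : L ⊆ O)
    (hL : IsOpen (O \ L)) (s : X → X → β)
    (hs : ∀ y ∈ L, ∀ᶠ z in 𝓝 y, z ∈ L → s z =ᶠ[𝓝 z] s y) :
    ∃ f : X → β, ∀ y ∈ L, f =ᶠ[𝓝 y] s y := by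
  classical
  -- The gluing takes place in the open set `O`, where `L` is closed; `O` is paracompact because it
  -- is metrizable.
  let _ := TopologicalSpace.metrizableSpaceMetric O
  have hcl : IsClosed ((↑) ⁻¹' L : Set O) := by
    rw [← isOpen_compl_iff]
    convert! hL.preimage continuous_subtype_val using 1
    ext x
    simp
  obtain ⟨f, hf⟩ := exists_eventuallyEq_of_isClosed hcl (fun y x => s y x) (by
    intro y hy
    filter_upwards [continuous_subtype_val.continuousAt.eventually (hs y hy)] with z hz hzL
    exact continuous_subtype_val.continuousAt.eventually (hz hzL))
  refine ⟨fun x => if h : x ∈ O then f ⟨x, h⟩ else Classical.arbitrary β, fun y hy => ?_⟩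
  have h1 := hf ⟨y, hLO hy⟩ hy
  rw [Filter.EventuallyEq, ← map_nhds_subtype_coe_eq_nhds (hLO hy) (hO.mem_nhds (hLO hy)),
    Filter.eventually_map]
  filter_upwards [h1] with x hx
  simpa using hx

end Gluing

/-! ### Continuation of germs, global defining functions, constant coefficients. -/

section Holonomy

variable {n k : ℕ} {M : Type*} [TopologicalSpace M] [ChartedSpace (EuclideanSpace ℝ (Fin n)) M]
  {P : PoissonTensor n M} {L V V' : Set M} {D E : Fin k → M → ℝ}

/-- The functions `h ∘ D` are defining if `h` has a local inverse. -/
theorem IsDefining.comp (hD : IsDefining P L V D) [IsManifold (𝓡 n) ∞ M]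
    {h h' : (Fin k → ℝ) → Fin k → ℝ} {B : Set (Fin k → ℝ)} (hB : IsOpen B)
    (hh : ContDiffOn ℝ ∞ h B) (hh' : DifferentiableAt ℝ h' 0) (h0 : h 0 = 0) (h0' : h' 0 = 0)
    (hl : ∀ z ∈ B, h' (h z) = z) (hr : ∀ᶠ z in 𝓝 0, h (h' z) = z) :
    IsDefining P L (V ∩ {y | (fun I => D I y) ∈ B}) fun I y => h (fun J => D J y) I := by
  have hVo : IsOpen (V ∩ {y | (fun I => D I y) ∈ B}) := by
    have hc : ContinuousOn (fun y I => D I y) V :=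
      continuousOn_pi.2 fun I => (hD.casimir I).1.continuousOn
    exact hc.isOpen_inter_preimage hD.isOpen hB
  have hcomp : ∀ I, ∀ z ∈ B, ContDiffAt ℝ ∞ (fun z => h z I) z := fun I z hz =>
    contDiffAt_pi.1 (hh.contDiffAt (hB.mem_nhds hz)) I
  have hdF : ∀ I, ∀ y ∈ V ∩ {y | (fun I => D I y) ∈ B},
      mvfderiv (𝓡 n) (fun y => h (fun J => D J y) I) y = ∑ J, fderiv ℝ (fun z => h z I)
        (fun J => D J y) (Pi.single J 1) • mvfderiv (𝓡 n) (D J) y := fun I y hy =>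
    mvfderiv_comp_defining hD hy.1 ((hcomp I _ hy.2).differentiableAt (by simp))
      (Filter.Eventually.of_forall fun _ => rfl)
  refine ⟨hVo, fun I => ⟨?_, ?_⟩, ?_, ?_⟩
  · intro y hy
    have h1 : ContMDiffAt (𝓡 n) 𝓘(ℝ, Fin k → ℝ) ∞ (fun y J => D J y) y :=
      contMDiffAt_pi_space.2 (hD.contMDiffAt hy.1)
    exact ((hcomp I _ hy.2).contMDiffAt.comp y h1).contMDiffWithinAt
  · intro y hy
    rw [hdF I y hy, map_sum]
    refine Finset.sum_eq_zero fun J _ => ?_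
    rw [map_smul, (hD.casimir J).2 y hy.1, smul_zero]
  · rintro y ⟨hyL, hy⟩
    have hy0 : (fun J => D J y) = 0 := funext fun J => hD.eq_zero hyL hy.1 J
    have h0B : (0 : Fin k → ℝ) ∈ B := hy0 ▸ hy.2
    have hli := hD.indep y ⟨hyL, hy.1⟩
    rw [Fintype.linearIndependent_iff] at hli ⊢
    intro g hg
    have hg' : ∑ J, (∑ I, g I * fderiv ℝ (fun z => h z I) 0 (Pi.single J 1)) •
        mvfderiv (𝓡 n) (D J) y = 0 := by
      rw [← hg]
      simp only [hdF _ y hy, hy0, Finset.smul_sum, Finset.sum_smul, smul_smul]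
      rw [Finset.sum_comm]
    have hz := hli _ hg'
    -- `T` is the relation `g` composed with the differential of `h` at `0`. Independence of the
    -- `dD_J` gives `T = 0`; since `h ∘ h' = id` near `0` that differential is onto, so `g = 0`.
    let T : (Fin k → ℝ) →L[ℝ] ℝ := ∑ I, g I • fderiv ℝ (fun z => h z I) 0
    have hT : T = 0 := by
      refine ContinuousLinearMap.coe_injective (LinearMap.pi_ext' fun J => LinearMap.ext_ring ?_)
      simpa [T] using hz J
    have hd : HasFDerivAt h (ContinuousLinearMap.pi fun I => fderiv ℝ (fun z => h z I) 0) (h' 0) :=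
      h0'.symm ▸ hasFDerivAt_pi.2 fun I =>
        ((hcomp I 0 h0B).differentiableAt (by simp)).hasFDerivAt
    have hid := (hd.comp 0 hh'.hasFDerivAt).unique
      ((hasFDerivAt_id (0 : Fin k → ℝ)).congr_of_eventuallyEq hr)
    intro I
    have h1 : T (fderiv ℝ h' 0 (Pi.single I 1)) = g I := by
      have h2 : ∀ K, fderiv ℝ (fun z => h z K) 0 (fderiv ℝ h' 0 (Pi.single I 1))
          = (Pi.single I 1 : Fin k → ℝ) K := fun K =>
        congrArg (fun S => S (Pi.single I 1) K) hid
      simp [T, h2, Pi.single_apply]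
    rw [← h1, hT]
    rfl
  · ext y
    constructor
    · rintro ⟨hyL, hy⟩
      refine ⟨hy, fun I => ?_⟩
      have hy0 : (fun J => D J y) = 0 := funext fun J => hD.eq_zero hyL hy.1 J
      rw [hy0, h0]
      rfl
    · rintro ⟨hy, hz⟩
      have h1 : h (fun J => D J y) = 0 := funext hz
      have h2 : (fun J => D J y) = 0 := by rw [← hl _ hy.2, h1, h0']
      have h3 : y ∈ L ∩ V := by
        rw [hD.zeroSet]
        exact ⟨hy.1, congrFun h2⟩
      exact ⟨h3.1, hy⟩

/-- A germ of defining functions extends along the part of the leaf in the domain of any other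
system of defining functions. -/
theorem exists_defining_extension [IsManifold (𝓡 n) ∞ M] (hL : IsRegularLeaf P k L)
    (hD : IsDefining P L V D) (hE : IsDefining P L V' E) {x : M} (hxL : x ∈ L) (hxV : x ∈ V)
    (hxV' : x ∈ V') :
    ∃ (V'' : Set M) (F : Fin k → M → ℝ), IsDefining P L V'' F ∧ L ∩ V ⊆ V'' ∧
      (fun y I => F I y) =ᶠ[𝓝 x] fun y I => E I y := by
  obtain ⟨B, h, hB, h0B, hh, hEh⟩ :=
    exists_casimir_eq_comp hL hD hxL hxV hE.isOpen hxV' hE.casimir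
  obtain ⟨B', h', hB', h0B', hh', hDh'⟩ :=
    exists_casimir_eq_comp hL hE hxL hxV' hD.isOpen hxV hD.casimir
  have hD0 : (fun J => D J x) = 0 := funext fun J => hD.eq_zero hxL hxV J
  have hE0 : (fun J => E J x) = 0 := funext fun J => hE.eq_zero hxL hxV' J
  have h0 : h 0 = 0 :=
    (congrArg h hD0.symm).trans ((funext fun I => (hEh.self_of_nhds I).symm).trans hE0)
  have h0' : h' 0 = 0 :=
    (congrArg h' hE0.symm).trans ((funext fun I => (hDh'.self_of_nhds I).symm).trans hD0)
  have hl : ∀ᶠ z in 𝓝 (0 : Fin k → ℝ), h' (h z) = z := by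
    rw [← map_nhds_defining hL hD hxL hxV, Filter.eventually_map]
    filter_upwards [hEh, hDh'] with y hy hy'
    have h1 : h (fun I => D I y) = fun I => E I y := funext fun I => (hy I).symm
    rw [h1]
    exact funext fun I => (hy' I).symm
  have hr : ∀ᶠ z in 𝓝 (0 : Fin k → ℝ), h (h' z) = z := by
    rw [← map_nhds_defining hL hE hxL hxV', Filter.eventually_map]
    filter_upwards [hEh, hDh'] with y hy hy'
    have h1 : h' (fun I => E I y) = fun I => D I y := funext fun I => (hy' I).symm
    rw [h1]
    exact funext fun I => (hy I).symm
  -- The extension is `h ∘ D` on the set where `D` takes values in `B₁`. All of `L ∩ V` lies there,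
  -- since `D = 0` on it.
  obtain ⟨B₁, hB₁s, hB₁, h0B₁⟩ := mem_nhds_iff.1 (Filter.inter_mem hl (hB.mem_nhds h0B))
  refine ⟨_, _, hD.comp hB₁ (hh.mono fun z hz => (hB₁s hz).2)
    ((hh'.contDiffAt (hB'.mem_nhds h0B')).differentiableAt (by simp)) h0 h0'
    (fun z hz => (hB₁s hz).1) hr, ?_, ?_⟩
  · rintro y ⟨hyL, hy⟩
    refine ⟨hy, ?_⟩
    have hy0 : (fun J => D J y) = 0 := funext fun J => hD.eq_zero hyL hy J
    change (fun J => D J y) ∈ B₁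
    rw [hy0]
    exact h0B₁
  · filter_upwards [hEh] with y hy
    exact funext fun I => (hy I).symm

variable (P k L) in
/-- The germs of defining functions at the points of the leaf. -/
def DefiningGerm : Type _ :=
  {q : Σ y : M, Filter.Germ (𝓝 y) (Fin k → ℝ) // q.1 ∈ L ∧ ∃ (V : Set M) (D : Fin k → M → ℝ),
    q.1 ∈ V ∧ IsDefining P L V D ∧ q.2 = ((fun y I => D I y : M → Fin k → ℝ) : Filter.Germ _ _)}

namespace DefiningGerm

/-- The germs of a fixed system of defining functions. -/
def sheet (V : Set M) (D : Fin k → M → ℝ) : Set (DefiningGerm k P L) :=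
  {q | q.1.1 ∈ V ∧ q.1.2 = ((fun y I => D I y : M → Fin k → ℝ) : Filter.Germ _ _)}

/-- The étale topology of a space of germs: a path is a continuation of germs along its projection
to `M`. -/
instance : TopologicalSpace (DefiningGerm k P L) :=
  TopologicalSpace.generateFrom {s | ∃ V D, IsDefining P L V D ∧ s = sheet V D}

/-- The germ of `D` at `x`. -/
def mk {x : M} (hxL : x ∈ L) (hxV : x ∈ V) (hD : IsDefining P L V D) : DefiningGerm k P L :=
  ⟨⟨x, ((fun y I => D I y : M → Fin k → ℝ) : Filter.Germ _ _)⟩, hxL, V, D, hxV, hD, rfl⟩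

theorem exists_eq_mk (q : DefiningGerm k P L) : ∃ (x : M) (V : Set M) (D : Fin k → M → ℝ)
    (hxL : x ∈ L) (hxV : x ∈ V) (hD : IsDefining P L V D), q = mk hxL hxV hD := by
  obtain ⟨⟨x, g⟩, hxL, V, D, hxV, hD, h⟩ := q
  refine ⟨x, V, D, hxL, hxV, hD, ?_⟩
  dsimp only at h
  subst h
  rfl

theorem mk_congr {x y : M} (h : x = y) (hxL : x ∈ L) (hxV : x ∈ V) (hyL : y ∈ L) (hyV : y ∈ V)
    (hD : IsDefining P L V D) : mk hxL hxV hD = mk hyL hyV hD := by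
  subst h
  rfl

theorem mk_eq_mk {x : M} (hxL : x ∈ L) (hxV : x ∈ V) (hD : IsDefining P L V D) (hxV' : x ∈ V')
    (hE : IsDefining P L V' E) (h : (fun y I => D I y) =ᶠ[𝓝 x] fun y I => E I y) :
    mk hxL hxV hD = mk hxL hxV' hE := by
  refine Subtype.ext ?_
  simp only [mk, Sigma.mk.injEq, heq_eq_eq, true_and]
  exact Filter.Germ.coe_eq.2 h

theorem isOpen_sheet (hD : IsDefining P L V D) :
    IsOpen (sheet V D : Set (DefiningGerm k P L)) :=
  TopologicalSpace.isOpen_generateFrom_of_mem ⟨V, D, hD, rfl⟩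

theorem continuous_base : Continuous fun q : DefiningGerm k P L => q.1.1 := by
  refine continuous_def.2 fun O hO => isOpen_iff_forall_mem_open.2 fun q hq => ?_
  obtain ⟨hqL, V, D, hqV, hD, h⟩ := q.2
  have hD' := hD.mono (hD.isOpen.inter hO) Set.inter_subset_left
  exact ⟨sheet (V ∩ O) D, fun q' hq' => hq'.1.2, isOpen_sheet hD', ⟨hqV, hq⟩, h⟩

/-- Moving the base point with the functions fixed is continuous, because equality of the germs of
two functions is an open condition on the point. -/
theorem joined_mk {x y : M} (h : JoinedIn (L ∩ V) x y) (hD : IsDefining P L V D) :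
    Joined (mk h.source_mem.1 h.source_mem.2 hD) (mk h.target_mem.1 h.target_mem.2 hD) := by
  obtain ⟨γ, hγ⟩ := h
  have hc : Continuous fun t : unitInterval => mk (hγ t).1 (hγ t).2 hD := by
    refine continuous_generateFrom_iff.2 ?_
    rintro _ ⟨V', E, hE, rfl⟩
    have ho : IsOpen {y : M | y ∈ V' ∧ (fun y I => D I y) =ᶠ[𝓝 y] fun y I => E I y} :=
      hE.isOpen.inter (isOpen_iff_mem_nhds.2 fun y hy => Filter.Eventually.eventually_nhds hy)
    convert! ho.preimage γ.continuous using 1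
    ext t
    exact and_congr_right fun _ => Filter.Germ.coe_eq
  exact ⟨⟨⟨_, hc⟩, mk_congr γ.source (hγ 0).1 (hγ 0).2 _ _ hD,
    mk_congr γ.target (hγ 1).1 (hγ 1).2 _ _ hD⟩⟩

/-- A path between two germs over `x` projects to a loop in `L`. Representatives of its germs form a
continuation along that loop, to which trivial holonomy applies. -/
theorem eq_of_joined (hol : HasTrivialHolonomy P k L) {x : M} (hxL : x ∈ L) (hxV : x ∈ V)
    (hD : IsDefining P L V D) (hxV' : x ∈ V') (hE : IsDefining P L V' E)
    (h : Joined (mk hxL hxV hD) (mk hxL hxV' hE)) :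
    (fun y I => D I y) =ᶠ[𝓝 x] fun y I => E I y := by
  obtain ⟨γ⟩ := h
  choose hγL W c hcW hc hγ using fun t => (γ t).2
  let γ' : C(unitInterval, M) := ⟨fun t => (γ t).1.1, continuous_base.comp γ.continuous⟩
  have h0 : γ' 0 = x := congrArg (fun q => q.1.1) γ.source
  have h1 : γ' 1 = x := congrArg (fun q => q.1.1) γ.target
  have hol' := hol γ' c hγL (h0.trans h1.symm) (by
    intro t₀
    refine ⟨W t₀, c t₀, hcW t₀, hc t₀, ?_⟩
    have hmem : γ t₀ ∈ sheet (W t₀) (c t₀) := ⟨hcW t₀, hγ t₀⟩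
    filter_upwards [γ.continuous.continuousAt.eventually
      ((isOpen_sheet (hc t₀)).mem_nhds hmem)] with t ht I
    have ht' := Filter.Germ.coe_eq.1 ((hγ t).symm.trans ht.2)
    exact ht'.mono fun y hy => congrFun hy I)
  have e0 : (fun y I => c 0 I y) =ᶠ[𝓝 x] fun y I => D I y := by
    have := hγ 0
    rw [γ.source] at this
    exact Filter.Germ.coe_eq.1 this.symm
  have e1 : (fun y I => c 1 I y) =ᶠ[𝓝 x] fun y I => E I y := by
    have := hγ 1
    rw [γ.target] at this
    exact Filter.Germ.coe_eq.1 this.symm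
  rw [h0] at hol'
  have e2 : (fun y I => c 0 I y) =ᶠ[𝓝 x] fun y I => c 1 I y := by
    filter_upwards [Filter.eventually_all.2 hol'] with y hy using funext hy
  exact e0.symm.trans (e2.trans e1)

variable [IsManifold (𝓡 n) ∞ M]

/-- By `exists_defining_extension` every germ over a point moves to a germ over any other point of
the leaf near enough to it, in both directions; preconnectedness of `L` propagates this to all pairs
of points. -/
theorem exists_joined (hL : IsRegularLeaf P k L) (q : DefiningGerm k P L) {y : M} (hy : y ∈ L) :
    ∃ q' : DefiningGerm k P L, q'.1.1 = y ∧ Joined q q' := by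
  refine hL.leaf.isPreconnected.induction₂'
    (fun x y => ∀ q : DefiningGerm k P L, q.1.1 = x →
      ∃ q' : DefiningGerm k P L, q'.1.1 = y ∧ Joined q q') ?_ ?_ q.2.1 hy q rfl
  · intro x hxL
    obtain ⟨V, D, hxV, hD⟩ := hL.foliated x hxL
    filter_upwards [mem_nhdsWithin_of_mem_nhds (eventually_joinedIn_leaf hL hD hxL hxV),
      self_mem_nhdsWithin] with y hy hyL
    have key : ∀ x y, JoinedIn (L ∩ V) x y → ∀ q : DefiningGerm k P L, q.1.1 = x →
        ∃ q' : DefiningGerm k P L, q'.1.1 = y ∧ Joined q q' := by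
      rintro x y hxy q rfl
      obtain ⟨x, V', E, hxL, hxV', hE, rfl⟩ := q.exists_eq_mk
      obtain ⟨V'', F, hF, hV'', hFE⟩ :=
        exists_defining_extension hL hD hE hxL hxy.source_mem.2 hxV'
      have hxy' : JoinedIn (L ∩ V'') x y := hxy.mono fun z hz => ⟨hz.1, hV'' hz⟩
      rw [mk_eq_mk hxL hxV' hE hxy'.source_mem.2 hF hFE.symm]
      exact ⟨_, rfl, joined_mk hxy' hF⟩
    exact ⟨key x y (hy hyL), key y x (hy hyL).symm⟩
  · intro x y z _ _ _ hxy hyz q hq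
    obtain ⟨q', hq', h⟩ := hxy q hq
    obtain ⟨q'', hq'', h'⟩ := hyz q' hq'
    exact ⟨q'', hq'', h.trans h'⟩

end DefiningGerm

/-- A regular leaf with trivial holonomy has global defining Casimir functions. -/
theorem exists_isDefining [T2Space M] [SecondCountableTopology M] [IsManifold (𝓡 n) ∞ M]
    (hL : IsRegularLeaf P k L) (hol : HasTrivialHolonomy P k L) {U : Set M} (hU : IsOpen U)
    (hLU : L ⊆ U) : ∃ (W : Set M) (C : Fin k → M → ℝ), L ⊆ W ∧ W ⊆ U ∧ IsDefining P L W C := by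
  classical
  obtain ⟨x₀, hx₀⟩ := hL.leaf.nonempty
  obtain ⟨V₀, D₀, hxV₀, hD₀⟩ := hL.foliated x₀ hx₀
  -- The germ of `D₀` at `x₀` is continued to each point of `L`; off the leaf the values are
  -- dummies.
  have hex : ∀ y : M, ∃ (V : Set M) (D : Fin k → M → ℝ), y ∈ L → ∃ (hyL : y ∈ L) (hyV : y ∈ V)
      (hD : IsDefining P L V D),
      Joined (DefiningGerm.mk hx₀ hxV₀ hD₀) (DefiningGerm.mk hyL hyV hD) := by
    intro y
    by_cases hy : y ∈ L
    · obtain ⟨q, hq, hj⟩ := DefiningGerm.exists_joined hL (DefiningGerm.mk hx₀ hxV₀ hD₀) hy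
      obtain ⟨x, V, D, hxL, hxV, hD, rfl⟩ := q.exists_eq_mk
      obtain rfl : x = y := hq
      exact ⟨V, D, fun _ => ⟨hxL, hxV, hD, hj⟩⟩
    · exact ⟨∅, 0, fun h => absurd h hy⟩
  choose V D hVD using hex
  choose _ hV hD hj using hVD
  have : LocallyCompactSpace M :=
    ChartedSpace.locallyCompactSpace (EuclideanSpace ℝ (Fin n)) M
  have hmet : TopologicalSpace.MetrizableSpace M := TopologicalSpace.metrizableSpace_of_t3_secondCountable M
  let O : Set M := ⋃ y : L, V y
  have hO : IsOpen O := isOpen_iUnion fun y => (hD y y.2).isOpen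
  have hLO : L ⊆ O := fun y hy => Set.mem_iUnion.2 ⟨⟨y, hy⟩, hV y hy⟩
  -- `L` need not be closed in `M`, but it is closed in `O`, being a zero set in each `V y`.
  have hdiff : IsOpen (O \ L) := by
    have hOL : O \ L = ⋃ y : L, V y ∩ (fun x I => D y I x) ⁻¹' {0}ᶜ := by
      ext x
      simp only [O, Set.mem_sdiff, Set.mem_iUnion, Set.mem_inter_iff, Set.mem_preimage,
        Set.mem_compl_iff, Set.mem_singleton_iff]
      constructor
      · rintro ⟨⟨y, hxy⟩, hxL⟩
        refine ⟨y, hxy, fun h0 => hxL ?_⟩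
        have : x ∈ L ∩ V y := by
          rw [(hD y y.2).zeroSet]
          exact ⟨hxy, congrFun h0⟩
        exact this.1
      · rintro ⟨y, hxy, h0⟩
        exact ⟨⟨y, hxy⟩, fun hxL => h0 (funext fun I => (hD y y.2).eq_zero hxL hxy I)⟩
    rw [hOL]
    refine isOpen_iUnion fun y => ?_
    have hc : ContinuousOn (fun x I => D y I x) (V y) :=
      continuousOn_pi.2 fun I => ((hD y y.2).casimir I).1.continuousOn
    exact hc.isOpen_inter_preimage (hD y y.2).isOpen isOpen_compl_singleton
  obtain ⟨f, hf⟩ := exists_eventuallyEq_of_isOpen_diff hO hLO hdiff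
    (fun y x I => D y I x) (by
      intro y hy
      filter_upwards [eventually_joinedIn_leaf hL (hD y hy) hy (hV y hy)] with z hz hzL
      -- The germ chosen at `z` and the germ of `D y` at `z` are both joined to the initial germ, so
      -- trivial holonomy identifies them.
      have h1 := DefiningGerm.joined_mk (hz hzL) (hD y hy)
      exact DefiningGerm.eq_of_joined hol hzL (hV z hzL) (hD z hzL) (hz hzL).target_mem.2 (hD y hy)
        ((hj z hzL).symm.trans ((hj y hy).trans h1)))
  have hW : IsOpen (U ∩ {x | ∃ V, x ∈ V ∧ IsDefining P L V fun I x => f x I}) := by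
    refine hU.inter (isOpen_iff_mem_nhds.2 ?_)
    rintro x ⟨V, hxV, hV⟩
    filter_upwards [hV.isOpen.mem_nhds hxV] with z hz using ⟨V, hz, hV⟩
  refine ⟨_, fun I x => f x I, ?_, Set.inter_subset_left, IsDefining.of_local hW fun x hx => hx.2⟩
  intro y hy
  refine ⟨hLU hy, ?_⟩
  obtain ⟨V', hV's, hV', hyV'⟩ := mem_nhds_iff.1
    (Filter.inter_mem (Filter.Eventually.eventually_nhds (hf y hy)) ((hD y hy).isOpen.mem_nhds (hV y hy)))
  refine ⟨V', hyV', ((hD y hy).mono hV' fun z hz => (hV's hz).2).congr fun z hz I => ?_⟩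
  exact (hV's hz).1.mono fun w hw => congrFun hw I

/-- The differentials of Casimir functions are constant combinations of the differentials of
defining functions along the leaf. -/
theorem existsUnique_coefficients [IsManifold (𝓡 n) ∞ M] (hL : IsRegularLeaf P k L) {W : Set M}
    {C : Fin k → M → ℝ} (hLW : L ⊆ W) (hC : IsDefining P L W C) {m : ℕ} {Cas : Fin m → M → ℝ}
    (hCas : ∀ s, IsCasimirOn P Set.univ (Cas s)) :
    ∃! c : Fin m → Fin k → ℝ, ∀ s, ∀ y ∈ L,
      mvfderiv (𝓡 n) (Cas s) y = ∑ I, c s I • mvfderiv (𝓡 n) (C I) y := by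
  have huniq : ∀ y ∈ L, ∀ c c' : Fin k → ℝ, ∑ I, c I • mvfderiv (𝓡 n) (C I) y
      = ∑ I, c' I • mvfderiv (𝓡 n) (C I) y → c = c' := by
    intro y hy c c' h
    have h1 := Fintype.linearIndependent_iff.1 (hC.indep y ⟨hy, hLW hy⟩) (c - c') (by
      simp [sub_smul, h])
    exact funext fun I => sub_eq_zero.1 (h1 I)
  obtain ⟨x₀, hx₀⟩ := hL.leaf.nonempty
  have hloc : ∀ x ∈ L, ∃ c : Fin m → Fin k → ℝ, ∀ᶠ y in 𝓝 x, y ∈ L → ∀ s,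
      mvfderiv (𝓡 n) (Cas s) y = ∑ I, c s I • mvfderiv (𝓡 n) (C I) y := by
    intro x hx
    obtain ⟨B, h, hB, h0B, hh, hev⟩ :=
      exists_casimir_eq_comp hL hC hx (hLW hx) isOpen_univ (Set.mem_univ x) hCas
    -- The coefficients are locally constant because `C = 0` on the leaf, so the derivative of `h`
    -- is always taken at `0`.
    refine ⟨fun s I => fderiv ℝ (fun z => h z s) 0 (Pi.single I 1), ?_⟩
    filter_upwards [hev.eventually_nhds] with y hy hyL s
    have hy0 : (fun I => C I y) = 0 := funext fun I => hC.eq_zero hyL (hLW hyL) I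
    have hd : DifferentiableAt ℝ (fun z => h z s) fun I => C I y := by
      rw [hy0]
      exact (contDiffAt_pi.1 (hh.contDiffAt (hB.mem_nhds h0B)) s).differentiableAt (by simp)
    have h1 := mvfderiv_comp_defining hC (hLW hyL) hd (hy.mono fun z hz => hz s)
    rw [hy0] at h1
    exact h1
  obtain ⟨c₀, hc₀⟩ := hloc x₀ hx₀
  refine ⟨c₀, fun s y hy => ?_, fun c hc => ?_⟩
  -- The induction relates two points sharing one system of coefficients; transitivity holds because
  -- the coefficients at the common point are unique.
  · have key := hL.leaf.isPreconnected.induction₂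
      (fun x y => x ∈ L ∧ y ∈ L ∧ ∃ c : Fin m → Fin k → ℝ, ∀ s,
        mvfderiv (𝓡 n) (Cas s) x = ∑ I, c s I • mvfderiv (𝓡 n) (C I) x ∧
        mvfderiv (𝓡 n) (Cas s) y = ∑ I, c s I • mvfderiv (𝓡 n) (C I) y) ?_ ?_ ?_ hx₀ hy
    · obtain ⟨-, -, c, hc⟩ := key
      have h0 := hc₀.self_of_nhds hx₀ s
      rw [huniq x₀ hx₀ _ _ (h0.symm.trans (hc s).1)]
      exact (hc s).2
    · intro x hx
      obtain ⟨c, hc⟩ := hloc x hx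
      filter_upwards [mem_nhdsWithin_of_mem_nhds hc, self_mem_nhdsWithin] with y hy hyL
      exact ⟨hx, hyL, c, fun s => ⟨hc.self_of_nhds hx s, hy hyL s⟩⟩
    · rintro x y z _ hyL _ ⟨hx, -, c, hc⟩ ⟨-, hz, c', hc'⟩
      refine ⟨hx, hz, c, fun s => ⟨(hc s).1, ?_⟩⟩
      rw [huniq y hyL _ _ ((hc s).2.symm.trans (hc' s).1)]
      exact (hc' s).2
    · rintro x y _ _ ⟨hx, hy, c, hc⟩
      exact ⟨hy, hx, c, fun s => (hc s).symm⟩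
  · funext s
    exact huniq x₀ hx₀ _ _ ((hc s x₀ hx₀).symm.trans (hc₀.self_of_nhds hx₀ s))

end Holonomy

end PSM

end

noncomputable section

namespace PSM

theorem minSmoothness_le_infty : minSmoothness ℝ 2 ≤ ∞ := by
  rw [minSmoothness_of_isRCLikeNormedField]
  exact WithTop.coe_le_coe.2 (le_top : (2 : ℕ∞) ≤ ⊤)

/-! ### Linear algebra, smoothness and curvature along the leaf. -/

section AdaptedData

variable {n k : ℕ} {M : Type*} [TopologicalSpace M] [ChartedSpace (EuclideanSpace ℝ (Fin n)) M]

theorem comp₁_chart {d : ℕ} {N : Type*} [TopologicalSpace N]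
    [ChartedSpace (EuclideanSpace ℝ (Fin d)) N] (α : CovectorField d N)
    {φ : OpenPartialHomeomorph N (EuclideanSpace ℝ (Fin d))} {x : N} (hx : x ∈ φ.source)
    (v : EuclideanSpace ℝ (Fin d)) : comp₁ α φ v (φ x) = α x (coordVec φ x v) := by
  have key : ∀ x', x' = x → α x' (coordVec φ x' v) = α x (coordVec φ x v) := by
    rintro x' rfl
    rfl
  exact key _ (φ.left_inv hx)

theorem comp₂_chart {d : ℕ} {N : Type*} [TopologicalSpace N]
    [ChartedSpace (EuclideanSpace ℝ (Fin d)) N] (τ : BilinField d N)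
    {φ : OpenPartialHomeomorph N (EuclideanSpace ℝ (Fin d))} {x : N} (hx : x ∈ φ.source)
    (v w : EuclideanSpace ℝ (Fin d)) :
    comp₂ τ φ v w (φ x) = τ x (coordVec φ x v) (coordVec φ x w) := by
  have key : ∀ x', x' = x → τ x' (coordVec φ x' v) (coordVec φ x' w)
      = τ x (coordVec φ x v) (coordVec φ x w) := by
    rintro x' rfl
    rfl
  exact key _ (φ.left_inv hx)

/-- A regular leaf `L` with a compatible presymplectic form `Ω` on `U ⊇ L` and defining Casimir
functions `C^I` on `W ⊇ L`. -/
structure AdaptedData (P : PoissonTensor n M) (L U W : Set M) (Ω : BilinField n M)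
    (C : Fin k → M → ℝ) : Prop where
  leaf : IsRegularLeaf P k L
  isOpen : IsOpen U
  subset_left : L ⊆ U
  subset_right : L ⊆ W
  presymplectic : IsCompatiblePresymplectic P U Ω
  defining : IsDefining P L W C

variable {P : PoissonTensor n M} {L U W : Set M} {Ω : BilinField n M} {C : Fin k → M → ℝ}

namespace AdaptedData

theorem linearIndependent (h : AdaptedData P L U W Ω C) {y : M} (hy : y ∈ L) :
    LinearIndependent ℝ fun I => mvfderiv (𝓡 n) (C I) y :=
  h.defining.indep y ⟨hy, h.subset_right hy⟩

theorem exists_dual (h : AdaptedData P L U W Ω C) {y : M} (hy : y ∈ L) :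
    ∃ e : Fin k → TangentSpace (𝓡 n) y,
      ∀ I J, mvfderiv (𝓡 n) (C I) y (e J) = if I = J then 1 else 0 :=
  exists_dual_vectors (E := EuclideanSpace ℝ (Fin n)) (h.linearIndependent hy)

theorem eq_of_sum_eq (h : AdaptedData P L U W Ω C) {y : M} (hy : y ∈ L) {r s : Fin k → ℝ}
    (hrs : ∀ w, ∑ I, r I * mvfderiv (𝓡 n) (C I) y w = ∑ I, s I * mvfderiv (𝓡 n) (C I) y w) :
    r = s := by
  obtain ⟨e, he⟩ := h.exists_dual hy
  funext J
  simpa [he] using hrs (e J)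

/-- Covectors of the form `-Ω(·, ξ) + r_I dC^I` are those mapped to `-ξ`. -/
theorem sharp_eq_neg (h : AdaptedData P L U W Ω C) {y : M} (hy : y ∈ L)
    {a : TangentSpace (𝓡 n) y →L[ℝ] ℝ} {ξ : TangentSpace (𝓡 n) y} {r : Fin k → ℝ}
    (ha : ∀ w, a w = - Ω y w ξ + ∑ I, r I * mvfderiv (𝓡 n) (C I) y w)
    (hξ : ∀ I, mvfderiv (𝓡 n) (C I) y ξ = 0) : P.sharp y a = - ξ := by
  obtain ⟨c, rfl⟩ := exists_sharp_eq h.leaf h.defining hy (h.subset_right hy) hξ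
  -- With `ξ = 𝒫c`, skewness and compatibility give `b(𝒫a) = -a(𝒫b) = Ω(𝒫b, 𝒫c) = c(𝒫b) = -b(𝒫c)`;
  -- the `dC^I` drop out on `𝒫b`.
  have key : ∀ b : TangentSpace (𝓡 n) y →L[ℝ] ℝ, b (P.sharp y a) = b (- P.sharp y c) := by
    intro b
    rw [P.skew, ha, h.presymplectic.compatible y (h.subset_left hy), P.skew y c, map_neg]
    simp [(h.defining.casimir _).mvfderiv_sharp (h.subset_right hy)]
  refine PiLp.ext fun i => ?_
  exact key (EuclideanSpace.proj i : EuclideanSpace ℝ (Fin n) →L[ℝ] ℝ)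

/-- `-Ω(·, ξ)` is a particular solution of the equation for `a`; the difference lies in the kernel
of 𝒫, spanned by the `dC^I`. -/
theorem exists_coefficients (h : AdaptedData P L U W Ω C) {y : M} (hy : y ∈ L)
    {a : TangentSpace (𝓡 n) y →L[ℝ] ℝ} {ξ : TangentSpace (𝓡 n) y} (ha : P.sharp y a = - ξ) :
    ∃ r : Fin k → ℝ, ∀ w, a w = - Ω y w ξ + ∑ I, r I * mvfderiv (𝓡 n) (C I) y w := by
  have hyW := h.subset_right hy
  have hξ : ∀ I, mvfderiv (𝓡 n) (C I) y ξ = 0 := by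
    intro I
    rw [← neg_neg ξ, ← ha, map_neg, (h.defining.casimir I).mvfderiv_sharp hyW, neg_zero]
  let ω' : EuclideanSpace ℝ (Fin n) →L[ℝ] EuclideanSpace ℝ (Fin n) →L[ℝ] ℝ := Ω y
  let b : TangentSpace (𝓡 n) y →L[ℝ] ℝ := - ω'.flip ξ
  have hb : ∀ w, b w = - Ω y w ξ := fun w => rfl
  have h1 : P.sharp y b = - ξ := h.sharp_eq_neg hy (r := 0) (fun w => by simp [hb]) hξ
  have h2 : P.sharp y (a - b) = 0 := by
    rw [map_sub, ha, h1, sub_self]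
  have h3 := ker_sharp_le_span h.leaf h.defining hy hyW h2
  rw [Submodule.mem_span_range_iff_exists_fun] at h3
  obtain ⟨r, hr⟩ := h3
  refine ⟨r, fun w => ?_⟩
  have h4 := congrArg (fun T => T w) hr
  simp only [_root_.sum_apply, _root_.smul_apply, smul_eq_mul, _root_.sub_apply,
    hb] at h4
  linarith

variable {ψ : OpenPartialHomeomorph M (EuclideanSpace ℝ (Fin n))}
  {F : Type*} [NormedAddCommGroup F] [NormedSpace ℝ F]

variable (Ω C ψ) in
/-- The covector `-Ω(·, ξ) + r_I dC^I` at the point with coordinates `y`, in the chart `ψ`. -/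
def localForm (y ξ : EuclideanSpace ℝ (Fin n)) (r : Fin k → ℝ) (e : EuclideanSpace ℝ (Fin n)) :
    ℝ :=
  - coord₂ Ω ψ y e ξ + ∑ I, r I * fderiv ℝ (fun u => C I (ψ.symm u)) y e

theorem localForm_chart (h : AdaptedData P L U W Ω C) (hψ : ψ ∈ charts n M) {y : M} (hy : y ∈ L)
    (hyψ : y ∈ ψ.source) (e ξ : EuclideanSpace ℝ (Fin n)) (r : Fin k → ℝ) :
    localForm Ω C ψ (ψ y) ξ r e = - Ω y (coordVec ψ y e) (coordVec ψ y ξ)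
      + ∑ I, r I * mvfderiv (𝓡 n) (C I) y (coordVec ψ y e) := by
  simp only [localForm, coord₂_apply, comp₂_chart Ω hyψ, mvfderiv_coordVec hψ hyψ
    (h.defining.mdifferentiableAt (h.subset_right hy) _)]

theorem contDiffAt_dC (h : AdaptedData P L U W Ω C) (hψ : ψ ∈ charts n M) {y : M} (hy : y ∈ L)
    (hyψ : y ∈ ψ.source) (I : Fin k) :
    ContDiffAt ℝ ∞ (fderiv ℝ fun u => C I (ψ.symm u)) (ψ y) :=
  (contDiffAt_comp_chart_symm hψ hyψ
    (h.defining.contMDiffAt (h.subset_right hy) I)).fderiv_right (by simp)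

theorem contDiffAt_localForm (h : AdaptedData P L U W Ω C) (hψ : ψ ∈ charts n M) {y : M}
    (hy : y ∈ L) (hyψ : y ∈ ψ.source) {x ξ : F → EuclideanSpace ℝ (Fin n)} {r : Fin k → F → ℝ}
    {u : F} (hx : ContDiffAt ℝ ∞ x u) (hxy : x u = ψ y) (hξ : ContDiffAt ℝ ∞ ξ u)
    (hr : ∀ I, ContDiffAt ℝ ∞ (r I) u) (e : EuclideanSpace ℝ (Fin n)) :
    ContDiffAt ℝ ∞ (fun u => localForm Ω C ψ (x u) (ξ u) (fun I => r I u) e) u := by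
  have hΩ := (contDiffAt_coord₂ h.isOpen h.presymplectic.twoForm hψ hyψ (h.subset_left hy))
  have hΩ' : ContDiffAt ℝ ∞ (fun u => coord₂ Ω ψ (x u)) u :=
    (show ContDiffAt ℝ ∞ (coord₂ Ω ψ) (x u) from hxy ▸ hΩ).comp u hx
  refine ((hΩ'.clm_apply contDiffAt_const).clm_apply hξ).neg.add (ContDiffAt.sum fun I _ => ?_)
  have hC : ContDiffAt ℝ ∞ (fun u => fderiv ℝ (fun u => C I (ψ.symm u)) (x u)) u :=
    ContDiffAt.comp u (hxy ▸ h.contDiffAt_dC hψ hy hyψ I) hx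
  exact (hr I).mul (hC.clm_apply contDiffAt_const)

/-- The parameter space `F` is left free: it is the chart space of Σ for a single solution, and `ℝ`
times it for a family. -/
theorem contDiffAt_coefficients (h : AdaptedData P L U W Ω C) (hψ : ψ ∈ charts n M) {y : M}
    (hy : y ∈ L) (hyψ : y ∈ ψ.source) {x ξ : F → EuclideanSpace ℝ (Fin n)} {r : Fin k → F → ℝ}
    {u : F} (hx : ContDiffAt ℝ ∞ x u) (hxy : x u = ψ y) (hξ : ContDiffAt ℝ ∞ ξ u)
    {g : EuclideanSpace ℝ (Fin n) → F → ℝ} (hg : ∀ e, ContDiffAt ℝ ∞ (g e) u)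
    (heq : ∀ᶠ u in 𝓝 u, ∀ e, g e u = localForm Ω C ψ (x u) (ξ u) (fun I => r I u) e)
    (I : Fin k) : ContDiffAt ℝ ∞ (r I) u := by
  obtain ⟨E, hE⟩ := h.exists_dual hy
  have hΩ := (contDiffAt_coord₂ h.isOpen h.presymplectic.twoForm hψ hyψ (h.subset_left hy))
  have hΩ' : ContDiffAt ℝ ∞ (fun u => coord₂ Ω ψ (x u)) u :=
    (show ContDiffAt ℝ ∞ (coord₂ Ω ψ) (x u) from hxy ▸ hΩ).comp u hx
  refine contDiffAt_coefficient (V := EuclideanSpace ℝ (Fin n))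
    (B := fun I u e => fderiv ℝ (fun u => C I (ψ.symm u)) (x u) e)
    (g := fun e u => g e u + coord₂ Ω ψ (x u) e (ξ u))
    (e := fun J => mfderiv (𝓡 n) (𝓡 n) ψ y (E J)) ?_ ?_ ?_ ?_ I
  · intro I J
    rw [hxy]
    refine (mvfderiv_coordVec hψ hyψ
      (h.defining.mdifferentiableAt (h.subset_right hy) I) _).symm.trans ?_
    rw [coordVec_mfderiv hψ hyψ, hE]
  · intro I e
    have hC : ContDiffAt ℝ ∞ (fun u => fderiv ℝ (fun u => C I (ψ.symm u)) (x u)) u :=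
      ContDiffAt.comp u (hxy ▸ h.contDiffAt_dC hψ hy hyψ I) hx
    exact hC.clm_apply contDiffAt_const
  · exact fun e => (hg e).add ((hΩ'.clm_apply contDiffAt_const).clm_apply hξ)
  · filter_upwards [heq] with u hu e
    rw [hu, localForm]
    ring

/-- The covariant curvature of `-Ω(·, dx) + α_I dC^I` in a chart. -/
theorem curvature_localForm (h : AdaptedData P L U W Ω C) (hψ : ψ ∈ charts n M) {y : M}
    (hy : y ∈ L) (hyψ : y ∈ ψ.source) {x : F → EuclideanSpace ℝ (Fin n)}
    {α : Fin k → F → F →L[ℝ] ℝ} {u : F} (hx : ContDiffAt ℝ ∞ x u) (hxy : x u = ψ y)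
    (hα : ∀ I, DifferentiableAt ℝ (α I) u) {v w : F} {e : EuclideanSpace ℝ (Fin n)}
    {a b : TangentSpace (𝓡 n) y →L[ℝ] ℝ} {fv fw : F → ℝ}
    (ha : ∀ z, a (coordVec ψ y z) = localForm Ω C ψ (x u) (fderiv ℝ x u v) (fun I => α I u v) z)
    (hb : ∀ z, b (coordVec ψ y z) = localForm Ω C ψ (x u) (fderiv ℝ x u w) (fun I => α I u w) z)
    (hfv : ∀ᶠ u in 𝓝 u,
      fv u = localForm Ω C ψ (x u) (fderiv ℝ x u v) (fun I => α I u v) e)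
    (hfw : ∀ᶠ u in 𝓝 u,
      fw u = localForm Ω C ψ (x u) (fderiv ℝ x u w) (fun I => α I u w) e)
    (hpa : P.sharp y a = - coordVec ψ y (fderiv ℝ x u v))
    (hpb : P.sharp y b = - coordVec ψ y (fderiv ℝ x u w)) :
    fderiv ℝ fw u v - fderiv ℝ fv u w + P.dComp ψ y e a b
      = ∑ I, (fderiv ℝ (α I) u v w - fderiv ℝ (α I) u w v)
        * mvfderiv (𝓡 n) (C I) y (coordVec ψ y e) := by
  have hyU := h.subset_left hy
  have hyW := h.subset_right hy
  -- Although `X` stays in `L`, the identities are needed on neighbourhoods in `M`, since they are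
  -- differentiated in the direction `e`.
  have hUev : ∀ᶠ z in 𝓝 (x u), z ∈ ψ.target ∧ ψ.symm z ∈ U := by
    rw [hxy]
    exact eventually_chart hyψ (h.isOpen.mem_nhds hyU)
  have hWev : ∀ᶠ z in 𝓝 (x u), z ∈ ψ.target ∧ ψ.symm z ∈ W := by
    rw [hxy]
    exact eventually_chart hyψ (h.defining.isOpen.mem_nhds hyW)
  have hsharp : ∀ a' : TangentSpace (𝓡 n) y →L[ℝ] ℝ, ∀ ξ, P.sharp y a' = - coordVec ψ y ξ →
      ξ = - P.coord ψ (x u) (a'.comp (coordVec ψ y)) := by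
    intro a' ξ ha'
    rw [P.sharp_eq_coord hψ hyψ, ← hxy] at ha'
    refine coordVec_injective hψ hyψ ?_
    rw [map_neg, ha', neg_neg]
  have key := curvature_identity (p := P.coord ψ) (Ω := coord₂ Ω ψ)
    (dC := fun I => fderiv ℝ fun u => C I (ψ.symm u)) (x := x) (dx := fderiv ℝ x) (α := α)
    (u := u) (a := a.comp (coordVec ψ y)) (b := b.comp (coordVec ψ y)) (v := v) (w := w) (e := e)
    (fv := fv) (fw := fw)
    ((((P.contDiffOn_coord hψ).contDiffAt (ψ.open_target.mem_nhds
      (hxy ▸ ψ.map_source hyψ : x u ∈ ψ.target))).differentiableAt (by simp)).hasFDerivAt)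
    (((hxy ▸ contDiffAt_coord₂ h.isOpen h.presymplectic.twoForm hψ hyψ hyU :
      ContDiffAt ℝ ∞ (coord₂ Ω ψ) (x u)).differentiableAt (by simp)).hasFDerivAt)
    (fun I => ((hxy ▸ h.contDiffAt_dC hψ hy hyψ I :
      ContDiffAt ℝ ∞ _ (x u)).differentiableAt (by simp)).hasFDerivAt)
    (hx.differentiableAt (by simp)).hasFDerivAt
    (((hx.fderiv_right (m := ∞) (by simp)).differentiableAt (by simp)).hasFDerivAt)
    (fun I => (hα I).hasFDerivAt) ?_ ?_ ?_ ?_ ?_ ?_ ?_ ha hb hfv hfw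
    (hsharp a _ hpa) (hsharp b _ hpb)
  · rw [P.dComp_eq hψ hyψ, ← hxy]
    refine key.trans (Finset.sum_congr rfl fun I _ => ?_)
    rw [mvfderiv_coordVec hψ hyψ (h.defining.mdifferentiableAt hyW _), hxy]
  · filter_upwards [hUev] with z hz a b
    rw [P.apply_coord hψ hz.1, P.apply_coord hψ hz.1, PoissonTensor.comp, PoissonTensor.comp,
      P.skew]
  · filter_upwards [hUev] with z hz v w
    have h1 := fun v => h.presymplectic.twoForm.1 _ hz.2 (coordVec ψ (ψ.symm z) v)
    have h2 := h1 (v + w)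
    simp only [map_add, _root_.add_apply, h1] at h2
    change Ω (ψ.symm z) (coordVec ψ (ψ.symm z) v) (coordVec ψ (ψ.symm z) w)
      = - Ω (ψ.symm z) (coordVec ψ (ψ.symm z) w) (coordVec ψ (ψ.symm z) v)
    linarith
  · have hd : ∀ v w, HasFDerivAt (comp₂ Ω ψ v w)
        (((fderiv ℝ (coord₂ Ω ψ) (x u)).flip v).flip w) (x u) := by
      intro v w
      have h1 := (((hxy ▸ contDiffAt_coord₂ h.isOpen h.presymplectic.twoForm hψ hyψ hyU :
        ContDiffAt ℝ ∞ (coord₂ Ω ψ) (x u)).differentiableAt (by simp)).hasFDerivAt)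
      simpa using! (h1.clm_apply (hasFDerivAt_const v (x u))).clm_apply (hasFDerivAt_const w (x u))
    intro v w z
    have h1 := h.presymplectic.closed ψ hψ (x u) (hxy ▸ ψ.map_source hyψ)
      (by rwa [hxy, ψ.left_inv hyψ]) v w z
    rw [(hd w z).fderiv, (hd z v).fderiv, (hd v w).fderiv] at h1
    exact h1
  · filter_upwards [hUev] with z hz a b
    have hc : ∀ a, coordVec ψ (ψ.symm z) (P.coord ψ z a)
        = P.sharp (ψ.symm z) (coordCovec ψ a (ψ.symm z)) := by
      intro a
      rw [P.coord_eq hψ hz.1, coordVec_mfderiv hψ (ψ.map_target hz.1)]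
    rw [coord₂_apply, comp₂, hc, hc, h.presymplectic.compatible _ hz.2, P.apply_coord hψ hz.1,
      PoissonTensor.comp]
  · intro I
    filter_upwards [hWev] with z hz
    rw [(hasFDerivAt_coord h.defining hψ hz.1 hz.2 I).fderiv, P.coord_eq hψ hz.1,
      coordCovec_comp_coordVec hψ (ψ.map_target hz.1), (h.defining.casimir I).2 _ hz.2]
    exact map_zero _
  · intro I v w
    have hC := contDiffAt_comp_chart_symm hψ hyψ (h.defining.contMDiffAt hyW I)
    rw [hxy]
    exact (hC.isSymmSndFDerivAt minSmoothness_le_infty).eq v w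
  · intro v w
    exact (hx.isSymmSndFDerivAt minSmoothness_le_infty).eq v w

end AdaptedData

end AdaptedData

end PSM

end

noncomputable section

namespace PSM

theorem eventually_source {S M E G : Type*} [TopologicalSpace S] [TopologicalSpace M]
    [TopologicalSpace E] [TopologicalSpace G] {φ : OpenPartialHomeomorph S E}
    {ψ : OpenPartialHomeomorph M G} {X : S → M} (hX : Continuous X) {x : S} (hx : x ∈ φ.source) (hXx : X x ∈ ψ.source) :
    ∀ᶠ u in 𝓝 (φ x), u ∈ φ.target ∧ X (φ.symm u) ∈ ψ.source :=
  eventually_chart hx (hX.continuousAt.eventually (ψ.open_source.mem_nhds hXx))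

/-! ### Solutions in terms of the 1-forms `α_I`. -/

section Solutions

variable {n k : ℕ} {M : Type*} [TopologicalSpace M] [ChartedSpace (EuclideanSpace ℝ (Fin n)) M]
  {S : Type*} [TopologicalSpace S] [ChartedSpace (EuclideanSpace ℝ (Fin 2)) S]
  {P : PoissonTensor n M} {L U W : Set M} {Ω : BilinField n M} {C : Fin k → M → ℝ}
  {X : S → M} {A : PullbackForm (n := n) X} {α : Fin k → CovectorField 2 S}
  {φ : OpenPartialHomeomorph S (EuclideanSpace ℝ (Fin 2))}
  {ψ : OpenPartialHomeomorph M (EuclideanSpace ℝ (Fin n))}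

theorem compA_chart (A : PullbackForm (n := n) X) {x : S} (hx : x ∈ φ.source)
    (e : EuclideanSpace ℝ (Fin n)) (v : EuclideanSpace ℝ (Fin 2)) :
    compA A φ ψ e v (φ x) = A x (coordVec φ x v) (coordVec ψ (X x) e) := by
  have key : ∀ x', x' = x → A x' (coordVec φ x' v) (coordVec ψ (X x') e)
      = A x (coordVec φ x v) (coordVec ψ (X x) e) := by
    rintro x' rfl
    rfl
  exact key _ (φ.left_inv hx)

theorem fderiv_comp₁ {N : Type*} {d : ℕ} [TopologicalSpace N]
    [ChartedSpace (EuclideanSpace ℝ (Fin d)) N] {β : CovectorField d N} (hβ : IsSmooth₁ β)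
    {φ : OpenPartialHomeomorph N (EuclideanSpace ℝ (Fin d))} (hφ : φ ∈ charts d N)
    {u : EuclideanSpace ℝ (Fin d)} (hu : u ∈ φ.target) (v w : EuclideanSpace ℝ (Fin d)) :
    fderiv ℝ (comp₁ β φ w) u v = fderiv ℝ (coord₁ β φ) u v w := by
  have h1 := (((contDiffOn_coord₁ hβ hφ).contDiffAt
    (φ.open_target.mem_nhds hu)).differentiableAt (by simp)).hasFDerivAt
  have h2 := h1.clm_apply (hasFDerivAt_const w u)
  refine (congrArg (fun T => T v) h2.fderiv).trans ?_
  simp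

namespace AdaptedData

/-- `C^I ∘ X` vanishes identically. The source manifold is arbitrary, so that this serves both for
maps of the worldsheet and for curves in time. -/
theorem dC_mfderiv (h : AdaptedData P L U W Ω C) {E H N : Type*} [NormedAddCommGroup E]
    [NormedSpace ℝ E] [TopologicalSpace H] {I' : ModelWithCorners ℝ E H} [TopologicalSpace N]
    [ChartedSpace H N] {X : N → M} (hX : ContMDiff I' (𝓡 n) ∞ X)
    (hXL : ∀ x, X x ∈ L) (x : N) (v : TangentSpace I' x) (I : Fin k) :
    mvfderiv (𝓡 n) (C I) (X x) (mfderiv I' (𝓡 n) X x v) = 0 := by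
  have hXW := h.subset_right (hXL x)
  rw [← mvfderiv_comp_apply x (h.defining.mdifferentiableAt hXW I)
    (hX.mdifferentiableAt (by simp))]
  have : C I ∘ X = fun _ => (0 : ℝ) :=
    funext fun z => h.defining.eq_zero (hXL z) (h.subset_right (hXL z)) I
  rw [this, mvfderiv_const]
  rfl

theorem hasForm_unique (h : AdaptedData P L U W Ω C) (hXL : ∀ x, X x ∈ L)
    {β : Fin k → CovectorField 2 S} (hα : HasForm Ω C A α) (hβ : HasForm Ω C A β) : α = β := by
  funext I x
  ext v
  have key := h.eq_of_sum_eq (hXL x) (r := fun I => α I x v) (s := fun I => β I x v) fun w => by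
    have h1 := hα x v w
    have h2 := hβ x v w
    linarith
  exact congrFun key I

theorem exists_hasForm (h : AdaptedData P L U W Ω C) (hXL : ∀ x, X x ∈ L)
    (hA : ∀ x v, mfderiv (𝓡 2) (𝓡 n) X x v + P.sharp (X x) (A x v) = 0) :
    ∃ α : Fin k → CovectorField 2 S, HasForm Ω C A α := by
  choose e he using fun x => h.exists_dual (hXL x)
  -- The coefficients from `exists_coefficients` are chosen separately for each `v`. Contracting `A
  -- + Ω(·, dX)` with vectors dual to the `dC^I` recovers them in a form visibly linear in `v`.
  let α : Fin k → CovectorField 2 S := fun I x =>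
    let a : EuclideanSpace ℝ (Fin 2) →L[ℝ] EuclideanSpace ℝ (Fin n) →L[ℝ] ℝ := A x
    let t : EuclideanSpace ℝ (Fin n) →L[ℝ] EuclideanSpace ℝ (Fin n) →L[ℝ] ℝ := Ω (X x)
    let T : EuclideanSpace ℝ (Fin 2) →L[ℝ] EuclideanSpace ℝ (Fin n) := mfderiv (𝓡 2) (𝓡 n) X x
    a.flip (e x I) + (t (e x I)).comp T
  have hα : ∀ I x v, α I x v = A x v (e x I) + Ω (X x) (e x I) (mfderiv (𝓡 2) (𝓡 n) X x v) :=
    fun I x v => rfl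
  refine ⟨α, fun x v w => ?_⟩
  obtain ⟨r, hr⟩ := h.exists_coefficients (hXL x) (eq_neg_of_add_eq_zero_right (hA x v))
  rw [hr]
  congr 1
  refine Finset.sum_congr rfl fun I _ => ?_
  rw [hα, hr]
  simp [he]

theorem compA_eq_localForm [IsManifold (𝓡 2) ∞ S] [IsManifold (𝓡 n) ∞ M]
    (h : AdaptedData P L U W Ω C) (hX : ContMDiff (𝓡 2) (𝓡 n) ∞ X)
    (hXL : ∀ x, X x ∈ L) (hα : HasForm Ω C A α) (hφ : φ ∈ charts 2 S) (hψ : ψ ∈ charts n M)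
    {u : EuclideanSpace ℝ (Fin 2)} (hu : u ∈ φ.target ∧ X (φ.symm u) ∈ ψ.source)
    (e : EuclideanSpace ℝ (Fin n)) (v : EuclideanSpace ℝ (Fin 2)) :
    compA A φ ψ e v u = localForm Ω C ψ (ψ (X (φ.symm u)))
      (fderiv ℝ (fun u => ψ (X (φ.symm u))) u v) (fun I => coord₁ (α I) φ u v) e := by
  have hs := φ.map_target hu.1
  have h1 := mfderiv_coordVec hφ hψ hs hu.2 (hX.mdifferentiableAt (by simp)) v
  rw [φ.right_inv hu.1] at h1
  rw [h.localForm_chart hψ (hXL _) hu.2, ← h1]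
  exact hα _ _ _

variable {m : ℕ} {Cas : Fin m → M → ℝ} {eps : Fin m → BilinField 2 S} {c : Fin m → Fin k → ℝ}
  {p : Fin k → CovectorField 2 S}

/-- The source term becomes `dp_I dC^I`, of the same shape as the curvature, so that the two can be
compared coefficient by coefficient. -/
theorem sum_dCas_mul_eps (hc : ∀ s, ∀ y ∈ L,
      mvfderiv (𝓡 n) (Cas s) y = ∑ I, c s I • mvfderiv (𝓡 n) (C I) y)
    (hp : ∀ I, HasExtDeriv₁ (p I) (∑ s, c s I • eps s)) {y : M} (hy : y ∈ L)
    (ξ : TangentSpace (𝓡 n) y) (hφ : φ ∈ charts 2 S) {x : S} (hx : x ∈ φ.source)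
    (v w : EuclideanSpace ℝ (Fin 2)) :
    ∑ s, mvfderiv (𝓡 n) (Cas s) y ξ * eps s x (coordVec φ x v) (coordVec φ x w)
      = ∑ I, (fderiv ℝ (comp₁ (p I) φ w) (φ x) v - fderiv ℝ (comp₁ (p I) φ v) (φ x) w)
        * mvfderiv (𝓡 n) (C I) y ξ := by
  have h1 : ∀ I, fderiv ℝ (comp₁ (p I) φ w) (φ x) v - fderiv ℝ (comp₁ (p I) φ v) (φ x) w
      = ∑ s, c s I * eps s x (coordVec φ x v) (coordVec φ x w) := by
    intro I
    rw [hp I φ hφ _ (φ.map_source hx), comp₂_chart _ hx]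
    simp [Finset.sum_apply, _root_.sum_apply]
  simp only [h1, hc _ y hy, _root_.sum_apply, _root_.smul_apply, smul_eq_mul,
    Finset.sum_mul]
  rw [Finset.sum_comm]
  refine Finset.sum_congr rfl fun I _ => Finset.sum_congr rfl fun s _ => ?_
  ring

variable [IsManifold (𝓡 2) ∞ S] [IsManifold (𝓡 n) ∞ M]

theorem contDiffOn_compA (h : AdaptedData P L U W Ω C) (hX : ContMDiff (𝓡 2) (𝓡 n) ∞ X)
    (hXL : ∀ x, X x ∈ L) (hα : HasForm Ω C A α) (hαs : ∀ I, IsSmooth₁ (α I))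
    (hφ : φ ∈ charts 2 S) (hψ : ψ ∈ charts n M) (e : EuclideanSpace ℝ (Fin n))
    (v : EuclideanSpace ℝ (Fin 2)) :
    ContDiffOn ℝ ∞ (compA A φ ψ e v) {u ∈ φ.target | X (φ.symm u) ∈ ψ.source} := by
  rintro u ⟨hu, huψ⟩
  have hs := φ.map_target hu
  have hx : ContDiffAt ℝ ∞ (fun u => ψ (X (φ.symm u))) u := by
    have := contDiffAt_coord_map hφ hψ hs huψ hX.contMDiffAt
    rwa [φ.right_inv hu] at this
  have hev := eventually_source hX.continuous hs huψ
  rw [φ.right_inv hu] at hev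
  refine ContDiffAt.contDiffWithinAt (ContDiffAt.congr_of_eventuallyEq
    (h.contDiffAt_localForm hψ (hXL _) huψ
      (ξ := fun u' => fderiv ℝ (fun u => ψ (X (φ.symm u))) u' v) (r := fun I u => coord₁ (α I) φ u v) hx rfl
      ((hx.fderiv_right (m := ∞) (by simp)).clm_apply contDiffAt_const)
      (fun I => (((contDiffOn_coord₁ (hαs I) hφ).contDiffAt
        (φ.open_target.mem_nhds hu)).clm_apply contDiffAt_const)) e) ?_)
  filter_upwards [hev] with u hu using h.compA_eq_localForm hX hXL hα hφ hψ hu e v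

theorem isSmooth_of_hasForm (h : AdaptedData P L U W Ω C) (hX : ContMDiff (𝓡 2) (𝓡 n) ∞ X)
    (hXL : ∀ x, X x ∈ L) (hα : HasForm Ω C A α)
    (hA : ∀ φ ∈ charts 2 S, ∀ ψ ∈ charts n M, ∀ e v,
      ContDiffOn ℝ ∞ (compA A φ ψ e v) {u ∈ φ.target | X (φ.symm u) ∈ ψ.source}) (I : Fin k) :
    IsSmooth₁ (α I) := by
  intro φ hφ v u hu
  have hs := φ.map_target hu
  have hψ := chartAt_mem_charts (d := n) (X (φ.symm u))
  set ψ := chartAt (EuclideanSpace ℝ (Fin n)) (X (φ.symm u))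
  have huψ : X (φ.symm u) ∈ ψ.source := mem_chart_source _ _
  have hx : ContDiffAt ℝ ∞ (fun u => ψ (X (φ.symm u))) u := by
    have := contDiffAt_coord_map hφ hψ hs huψ hX.contMDiffAt
    rwa [φ.right_inv hu] at this
  have hev := eventually_source hX.continuous hs huψ
  rw [φ.right_inv hu] at hev
  refine (h.contDiffAt_coefficients hψ (hXL _) huψ
    (ξ := fun u' => fderiv ℝ (fun u => ψ (X (φ.symm u))) u' v) (r := fun I u => coord₁ (α I) φ u v) hx rfl
    (g := fun e => compA A φ ψ e v)
    ((hx.fderiv_right (m := ∞) (by simp)).clm_apply contDiffAt_const) (fun e => ?_) ?_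
    I).contDiffWithinAt
  · exact (hA φ hφ ψ hψ e v).contDiffAt hev
  · filter_upwards [hev] with u hu e using h.compA_eq_localForm hX hXL hα hφ hψ hu e v

theorem curvature_compA (h : AdaptedData P L U W Ω C) (hX : ContMDiff (𝓡 2) (𝓡 n) ∞ X)
    (hXL : ∀ x, X x ∈ L) (hα : HasForm Ω C A α) (hαs : ∀ I, IsSmooth₁ (α I))
    (hφ : φ ∈ charts 2 S) (hψ : ψ ∈ charts n M) {x : S} (hx : x ∈ φ.source)
    (hxψ : X x ∈ ψ.source) (e : EuclideanSpace ℝ (Fin n)) (v w : EuclideanSpace ℝ (Fin 2)) :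
    fderiv ℝ (compA A φ ψ e w) (φ x) v - fderiv ℝ (compA A φ ψ e v) (φ x) w
      + P.dComp ψ (X x) e (A x (coordVec φ x v)) (A x (coordVec φ x w))
    = ∑ I, (fderiv ℝ (comp₁ (α I) φ w) (φ x) v - fderiv ℝ (comp₁ (α I) φ v) (φ x) w)
      * mvfderiv (𝓡 n) (C I) (X x) (coordVec ψ (X x) e) := by
  have hxt := φ.map_source hx
  have hev := eventually_source hX.continuous hx hxψ
  have hcurv := h.curvature_localForm hψ (hXL x) hxψ (x := fun u => ψ (X (φ.symm u)))
    (α := fun I => coord₁ (α I) φ) (u := φ x) (v := v) (w := w) (e := e)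
    (a := A x (coordVec φ x v)) (b := A x (coordVec φ x w))
    (fv := compA A φ ψ e v) (fw := compA A φ ψ e w)
    (contDiffAt_coord_map hφ hψ hx hxψ hX.contMDiffAt) (by simp [φ.left_inv hx])
    (fun I => (((contDiffOn_coord₁ (hαs I) hφ).contDiffAt
        (φ.open_target.mem_nhds hxt)).differentiableAt (by simp)))
    (fun z => by
      rw [← compA_chart A hx]
      exact h.compA_eq_localForm hX hXL hα hφ hψ hev.self_of_nhds z v)
    (fun z => by
      rw [← compA_chart A hx]
      exact h.compA_eq_localForm hX hXL hα hφ hψ hev.self_of_nhds z w)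
    (by filter_upwards [hev] with u hu using h.compA_eq_localForm hX hXL hα hφ hψ hu e v)
    (by filter_upwards [hev] with u hu using h.compA_eq_localForm hX hXL hα hφ hψ hu e w)
    (by
      rw [← mfderiv_coordVec hφ hψ hx hxψ (hX.mdifferentiableAt (by simp))]
      exact h.sharp_eq_neg (hXL x) (hα x _) (h.dC_mfderiv hX hXL x _))
    (by
      rw [← mfderiv_coordVec hφ hψ hx hxψ (hX.mdifferentiableAt (by simp))]
      exact h.sharp_eq_neg (hXL x) (hα x _) (h.dC_mfderiv hX hXL x _))
  rw [hcurv]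
  simp only [fderiv_comp₁ (hαs _) hφ hxt]

/-- A pair `(X, A)` with `A = -X^*Ω + α_I X^* dC^I` is a solution iff the forms `α_I` are smooth
and `α_I + p_I` is closed. -/
theorem isSolution_iff_of_hasForm (h : AdaptedData P L U W Ω C)
    (hX : ContMDiff (𝓡 2) (𝓡 n) ∞ X) (hXL : ∀ x, X x ∈ L)
    (hc : ∀ s, ∀ y ∈ L, mvfderiv (𝓡 n) (Cas s) y = ∑ I, c s I • mvfderiv (𝓡 n) (C I) y)
    (hp : ∀ I, IsSmooth₁ (p I) ∧ HasExtDeriv₁ (p I) (∑ s, c s I • eps s))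
    (hα : HasForm Ω C A α) :
    IsSolution P Cas eps ⟨X, A⟩ ↔ ∀ I, IsSmooth₁ (α I) ∧ α I + p I ∈ closedForms 2 S := by
  have hadd : ∀ (φ : OpenPartialHomeomorph S (EuclideanSpace ℝ (Fin 2))) (I : Fin k) v,
      comp₁ (α I + p I) φ v = comp₁ (α I) φ v + comp₁ (p I) φ v := fun φ I v => rfl
  have hd : (∀ I, IsSmooth₁ (α I)) → ∀ φ ∈ charts 2 S, ∀ u ∈ φ.target, ∀ I v w,
      fderiv ℝ (comp₁ (α I + p I) φ w) u v = fderiv ℝ (comp₁ (α I) φ w) u v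
        + fderiv ℝ (comp₁ (p I) φ w) u v := by
    intro hαs φ hφ u hu I v w
    rw [hadd, fderiv_add (comp₁_differentiableAt (hαs I) hφ hu w)
      (comp₁_differentiableAt (hp I).1 hφ hu w)]
    rfl
  constructor
  · intro hsol
    have hαs := h.isSmooth_of_hasForm hX hXL hα hsol.smooth_A
    refine fun I => ⟨hαs I, ⟨fun φ hφ v => ?_, fun φ hφ u hu v w => ?_⟩⟩
    · rw [hadd]
      exact (hαs I φ hφ v).add ((hp I).1 φ hφ v)
    · rw [hd hαs φ hφ u hu, hd hαs φ hφ u hu]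
      have hs := φ.map_target hu
      have hψ := chartAt_mem_charts (d := n) (X (φ.symm u))
      set ψ := chartAt (EuclideanSpace ℝ (Fin n)) (X (φ.symm u))
      have huψ : X (φ.symm u) ∈ ψ.source := mem_chart_source _ _
      -- The second field equation reads `(dα_I + dp_I) dC^I = 0`, contracted with every vector;
      -- independence isolates each coefficient.
      have key := h.eq_of_sum_eq (hXL (φ.symm u)) (s := 0)
        (r := fun I => (fderiv ℝ (comp₁ (α I) φ w) (φ (φ.symm u)) v
            - fderiv ℝ (comp₁ (α I) φ v) (φ (φ.symm u)) w)
          + (fderiv ℝ (comp₁ (p I) φ w) (φ (φ.symm u)) v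
            - fderiv ℝ (comp₁ (p I) φ v) (φ (φ.symm u)) w)) (by
          intro ξ
          obtain ⟨e, rfl⟩ := coordVec_surjective hψ huψ ξ
          have h1 := hsol.eqA φ hφ ψ hψ (φ.symm u) hs huψ e v w
          rw [h.curvature_compA hX hXL hα hαs hφ hψ hs huψ,
            sum_dCas_mul_eps hc (fun I => (hp I).2) (hXL _) _ hφ hs, ← Finset.sum_add_distrib] at h1
          simp only [← add_mul] at h1
          simpa using h1)
      have key' := congrFun key I
      simp only [φ.right_inv hu, Pi.zero_apply] at key'
      simp only [comp₂, Pi.zero_apply, _root_.zero_apply]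
      linarith
  · intro hcl
    have hαs := fun I => (hcl I).1
    refine ⟨hX, fun φ hφ ψ hψ e v => h.contDiffOn_compA hX hXL hα hαs hφ hψ e v, fun x v => ?_,
      fun φ hφ ψ hψ x hx hxψ e v w => ?_⟩
    · rw [h.sharp_eq_neg (hXL x) (hα x v) (h.dC_mfderiv hX hXL x v)]
      exact add_neg_cancel _
    · rw [h.curvature_compA hX hXL hα hαs hφ hψ hx hxψ,
        sum_dCas_mul_eps hc (fun I => (hp I).2) (hXL _) _ hφ hx, ← Finset.sum_add_distrib]
      refine Finset.sum_eq_zero fun I _ => ?_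
      have h1 := (hcl I).2.2 φ hφ (φ x) (φ.map_source hx) v w
      rw [hd hαs φ hφ _ (φ.map_source hx), hd hαs φ hφ _ (φ.map_source hx)] at h1
      simp only [comp₂, Pi.zero_apply, _root_.zero_apply] at h1
      rw [← add_mul]
      exact mul_eq_zero_of_left (by linarith) _

theorem isSolution_iff (h : AdaptedData P L U W Ω C)
    (hX : ContMDiff (𝓡 2) (𝓡 n) ∞ X) (hXL : ∀ x, X x ∈ L)
    (hc : ∀ s, ∀ y ∈ L, mvfderiv (𝓡 n) (Cas s) y = ∑ I, c s I • mvfderiv (𝓡 n) (C I) y)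
    (hp : ∀ I, IsSmooth₁ (p I) ∧ HasExtDeriv₁ (p I) (∑ s, c s I • eps s)) :
    IsSolution P Cas eps ⟨X, A⟩ ↔ ∃! α : Fin k → CovectorField 2 S,
      (∀ I, IsSmooth₁ (α I) ∧ α I + p I ∈ closedForms 2 S) ∧ HasForm Ω C A α := by
  constructor
  · intro hsol
    obtain ⟨α, hα⟩ := h.exists_hasForm hXL hsol.eqX
    exact ⟨α, ⟨(h.isSolution_iff_of_hasForm hX hXL hc hp hα).1 hsol, hα⟩,
      fun β hβ => h.hasForm_unique hXL hβ.2 hα⟩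
  · rintro ⟨α, ⟨hcl, hα⟩, -⟩
    exact (h.isSolution_iff_of_hasForm hX hXL hc hp hα).2 hcl

end AdaptedData

end Solutions

end PSM

end

noncomputable section

namespace PSM

/-! ### Families of maps as maps from `ℝ × Σ`. -/

section Families

variable {n k d : ℕ} {M : Type*} [TopologicalSpace M] [ChartedSpace (EuclideanSpace ℝ (Fin n)) M]
  {S : Type*} [TopologicalSpace S] [ChartedSpace (EuclideanSpace ℝ (Fin d)) S]
  {Y : ℝ → S → M} {φ : OpenPartialHomeomorph S (EuclideanSpace ℝ (Fin d))}
  {ψ : OpenPartialHomeomorph M (EuclideanSpace ℝ (Fin n))}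

theorem contMDiff_slice (hY : ContMDiff (𝓘(ℝ, ℝ).prod (𝓡 d)) (𝓡 n) ∞ fun q : ℝ × S => Y q.1 q.2)
    (t : ℝ) : ContMDiff (𝓡 d) (𝓡 n) ∞ (Y t) :=
  hY.comp (contMDiff_const.prodMk contMDiff_id)

theorem contMDiff_orbit (hY : ContMDiff (𝓘(ℝ, ℝ).prod (𝓡 d)) (𝓡 n) ∞ fun q : ℝ × S => Y q.1 q.2)
    (x : S) : ContMDiff 𝓘(ℝ, ℝ) (𝓡 n) ∞ fun t => Y t x :=
  hY.comp (contMDiff_id.prodMk contMDiff_const)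

theorem contMDiffAt_family_chart
    (hY : ContMDiff (𝓘(ℝ, ℝ).prod (𝓡 d)) (𝓡 n) ∞ fun q : ℝ × S => Y q.1 q.2)
    (hφ : φ ∈ charts d S) {q : ℝ × EuclideanSpace ℝ (Fin d)} (hq : q.2 ∈ φ.target) :
    ContMDiffAt 𝓘(ℝ, ℝ × EuclideanSpace ℝ (Fin d)) (𝓡 n) ∞
      (fun q : ℝ × EuclideanSpace ℝ (Fin d) => Y q.1 (φ.symm q.2)) q := by
  have h1 : ContMDiffAt 𝓘(ℝ, ℝ × EuclideanSpace ℝ (Fin d)) (𝓘(ℝ, ℝ).prod (𝓡 d)) ∞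
      (fun q : ℝ × EuclideanSpace ℝ (Fin d) => (q.1, φ.symm q.2)) q :=
    (contDiffAt_fst.contMDiffAt).prodMk
      ((contMDiffAt_symm_of_mem_maximalAtlas hφ hq).comp q contDiffAt_snd.contMDiffAt)
  exact (hY _).comp q h1

theorem eventually_family_source
    (hY : ContMDiff (𝓘(ℝ, ℝ).prod (𝓡 d)) (𝓡 n) ∞ fun q : ℝ × S => Y q.1 q.2)
    (hφ : φ ∈ charts d S) {q : ℝ × EuclideanSpace ℝ (Fin d)} (hq : q.2 ∈ φ.target)
    (hqψ : Y q.1 (φ.symm q.2) ∈ ψ.source) :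
    ∀ᶠ q in 𝓝 q, q.2 ∈ φ.target ∧ Y q.1 (φ.symm q.2) ∈ ψ.source :=
  (continuousAt_snd.eventually (φ.open_target.mem_nhds hq)).and
    ((contMDiffAt_family_chart hY hφ hq).continuousAt.eventually (ψ.open_source.mem_nhds hqψ))

theorem contDiffAt_family
    (hY : ContMDiff (𝓘(ℝ, ℝ).prod (𝓡 d)) (𝓡 n) ∞ fun q : ℝ × S => Y q.1 q.2)
    (hφ : φ ∈ charts d S) (hψ : ψ ∈ charts n M) {q : ℝ × EuclideanSpace ℝ (Fin d)}
    (hq : q.2 ∈ φ.target) (hqψ : Y q.1 (φ.symm q.2) ∈ ψ.source) :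
    ContDiffAt ℝ ∞ (fun q : ℝ × EuclideanSpace ℝ (Fin d) => ψ (Y q.1 (φ.symm q.2))) q := by
  rw [← contMDiffAt_iff_contDiffAt]
  exact (contMDiffAt_of_mem_maximalAtlas hψ hqψ).comp q (contMDiffAt_family_chart hY hφ hq)

theorem fderiv_slice_right {E H V : Type*} [NormedAddCommGroup E] [NormedSpace ℝ E]
    [NormedAddCommGroup H] [NormedSpace ℝ H] [NormedAddCommGroup V] [NormedSpace ℝ V]
    {g : E × H → V} {q : E × H} (hg : DifferentiableAt ℝ g q) (v : H) :
    fderiv ℝ (fun u => g (q.1, u)) q.2 v = fderiv ℝ g q (0, v) := by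
  have h := HasFDerivAt.comp (g := g) (f := fun u => (q.1, u)) q.2 hg.hasFDerivAt
    (hasFDerivAt_prodMk_right q.1 q.2)
  refine (congrArg (fun T => T v) h.fderiv).trans ?_
  simp

theorem hasDerivAt_slice_left {H V : Type*}
    [NormedAddCommGroup H] [NormedSpace ℝ H] [NormedAddCommGroup V] [NormedSpace ℝ V]
    {g : ℝ × H → V} {q : ℝ × H} (hg : DifferentiableAt ℝ g q) :
    HasDerivAt (fun t => g (t, q.2)) (fderiv ℝ g q (1, 0)) q.1 := by
  have h := (HasFDerivAt.comp (g := g) (f := fun t => (t, q.2)) q.1 hg.hasFDerivAt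
    (hasFDerivAt_prodMk_left q.1 q.2)).hasDerivAt
  simpa using! h

theorem mfderiv_orbit (hY : ContMDiff (𝓘(ℝ, ℝ).prod (𝓡 d)) (𝓡 n) ∞ fun q : ℝ × S => Y q.1 q.2)
    (hφ : φ ∈ charts d S) (hψ : ψ ∈ charts n M) {q : ℝ × EuclideanSpace ℝ (Fin d)}
    (hq : q.2 ∈ φ.target) (hqψ : Y q.1 (φ.symm q.2) ∈ ψ.source) :
    mfderiv 𝓘(ℝ, ℝ) (𝓡 n) (fun t => Y t (φ.symm q.2)) q.1 (1 : ℝ)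
      = coordVec ψ (Y q.1 (φ.symm q.2)) (fderiv ℝ
        (fun q : ℝ × EuclideanSpace ℝ (Fin d) => ψ (Y q.1 (φ.symm q.2))) q (1, 0)) := by
  have h1 := hasDerivAt_slice_left ((contDiffAt_family hY hφ hψ hq hqψ).differentiableAt (by simp))
  have hYx := (contMDiff_orbit hY (φ.symm q.2)).mdifferentiableAt (x := q.1) (by simp)
  have h2 := mfderiv_comp_apply (I := 𝓘(ℝ, ℝ)) (I' := 𝓡 n) (I'' := 𝓡 n)
    (f := fun t => Y t (φ.symm q.2)) q.1
    ((mdifferentiable_of_mem_charts hψ).mdifferentiableAt hqψ) hYx (1 : ℝ)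
  rw [← coordVec_mfderiv hψ hqψ (mfderiv 𝓘(ℝ, ℝ) (𝓡 n) (fun t => Y t (φ.symm q.2)) q.1 (1 : ℝ))]
  congr 1
  refine h2.symm.trans ?_
  have h3 : mfderiv 𝓘(ℝ, ℝ) (𝓡 n) (ψ ∘ fun t => Y t (φ.symm q.2)) q.1
      = fderiv ℝ (fun t => ψ (Y t (φ.symm q.2))) q.1 := mfderiv_eq_fderiv
  refine (congrArg (fun T => T (1 : ℝ)) h3).trans ?_
  exact (fderiv_apply_one_eq_deriv (f := fun t => ψ (Y t (φ.symm q.2)))).trans h1.deriv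

end Families

/-! ### The gauge law as mixed component of the curvature on `ℝ × Σ`. -/

section Gauge

variable {n k : ℕ} {M : Type*} [TopologicalSpace M] [ChartedSpace (EuclideanSpace ℝ (Fin n)) M]
  {S : Type*} [TopologicalSpace S] [ChartedSpace (EuclideanSpace ℝ (Fin 2)) S]
  {P : PoissonTensor n M} {L U W : Set M} {Ω : BilinField n M} {C : Fin k → M → ℝ}
  {φ : OpenPartialHomeomorph S (EuclideanSpace ℝ (Fin 2))}
  {ψ : OpenPartialHomeomorph M (EuclideanSpace ℝ (Fin n))}
  {F : ℝ → Fields n M S} {ε : ∀ t x, TangentSpace (𝓡 n) ((F t).X x) →L[ℝ] ℝ}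
  {α : ℝ → Fin k → CovectorField 2 S} {f : ℝ → Fin k → S → ℝ}

namespace AdaptedData

/-- The parameter ε in direction `(1, 0)` has the same local shape as `A` in direction `(0, v)`: it
is the time component of one form on `ℝ × Σ`. -/
theorem param_eq_localForm_family (h : AdaptedData P L U W Ω C)
    (hF : ContMDiff (𝓘(ℝ, ℝ).prod (𝓡 2)) (𝓡 n) ∞ fun q : ℝ × S => (F q.1).X q.2)
    (hFL : ∀ t x, (F t).X x ∈ L)
    (hε : ∀ t x w, ε t x w
      = - Ω ((F t).X x) w (mfderiv 𝓘(ℝ, ℝ) (𝓡 n) (fun s => (F s).X x) t (1 : ℝ))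
        + ∑ I, f t I x * mvfderiv (𝓡 n) (C I) ((F t).X x) w)
    (hφ : φ ∈ charts 2 S) (hψ : ψ ∈ charts n M) {q : ℝ × EuclideanSpace ℝ (Fin 2)}
    (hq : q.2 ∈ φ.target ∧ (F q.1).X (φ.symm q.2) ∈ ψ.source) (e : EuclideanSpace ℝ (Fin n)) :
    ε q.1 (φ.symm q.2) (coordVec ψ ((F q.1).X (φ.symm q.2)) e)
      = localForm Ω C ψ (ψ ((F q.1).X (φ.symm q.2)))
      (fderiv ℝ (fun q : ℝ × EuclideanSpace ℝ (Fin 2) => ψ ((F q.1).X (φ.symm q.2))) q (1, 0))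
      (fun I => f q.1 I (φ.symm q.2)) e := by
  rw [h.localForm_chart hψ (hFL _ _) hq.2, hε,
    mfderiv_orbit (Y := fun t => (F t).X) hF hφ hψ hq.1 hq.2]

variable [IsManifold (𝓡 2) ∞ S] [IsManifold (𝓡 n) ∞ M]

theorem compA_eq_localForm_family (h : AdaptedData P L U W Ω C)
    (hF : ContMDiff (𝓘(ℝ, ℝ).prod (𝓡 2)) (𝓡 n) ∞ fun q : ℝ × S => (F q.1).X q.2)
    (hFL : ∀ t x, (F t).X x ∈ L) (hα : ∀ t, HasForm Ω C (F t).A (α t))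
    (hφ : φ ∈ charts 2 S) (hψ : ψ ∈ charts n M) {q : ℝ × EuclideanSpace ℝ (Fin 2)}
    (hq : q.2 ∈ φ.target ∧ (F q.1).X (φ.symm q.2) ∈ ψ.source)
    (e : EuclideanSpace ℝ (Fin n)) (v : EuclideanSpace ℝ (Fin 2)) :
    compA (F q.1).A φ ψ e v q.2 = localForm Ω C ψ (ψ ((F q.1).X (φ.symm q.2)))
      (fderiv ℝ (fun q : ℝ × EuclideanSpace ℝ (Fin 2) => ψ ((F q.1).X (φ.symm q.2))) q (0, v))
      (fun I => coord₁ (α q.1 I) φ q.2 v) e := by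
  rw [← fderiv_slice_right ((contDiffAt_family (Y := fun t => (F t).X) hF hφ hψ hq.1 hq.2).differentiableAt (by simp))]
  exact h.compA_eq_localForm (u := q.2) (contMDiff_slice (Y := fun t => (F t).X) hF q.1) (hFL q.1) (hα q.1) hφ hψ hq e v

/-- The variation of a family of fields of the form `-X^*Ω + α_I dC^I` in the direction of a
parameter `ε = -Ω(·, ∂_t X) + f_I dC^I`. -/
theorem gauge_defect (h : AdaptedData P L U W Ω C)
    (hF : ContMDiff (𝓘(ℝ, ℝ).prod (𝓡 2)) (𝓡 n) ∞ fun q : ℝ × S => (F q.1).X q.2)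
    (hFL : ∀ t x, (F t).X x ∈ L) (hα : ∀ t, HasForm Ω C (F t).A (α t))
    (hε : ∀ t x w, ε t x w
      = - Ω ((F t).X x) w (mfderiv 𝓘(ℝ, ℝ) (𝓡 n) (fun s => (F s).X x) t (1 : ℝ))
        + ∑ I, f t I x * mvfderiv (𝓡 n) (C I) ((F t).X x) w)
    (hφ : φ ∈ charts 2 S) (hψ : ψ ∈ charts n M) {t : ℝ} {x : S} (hx : x ∈ φ.source)
    (hxψ : (F t).X x ∈ ψ.source)
    (hαs : ∀ I, ContDiffAt ℝ ∞
      (fun q : ℝ × EuclideanSpace ℝ (Fin 2) => coord₁ (α q.1 I) φ q.2) (t, φ x))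
    (hfs : ∀ I, ContDiffAt ℝ ∞
      (fun q : ℝ × EuclideanSpace ℝ (Fin 2) => f q.1 I (φ.symm q.2)) (t, φ x))
    (e : EuclideanSpace ℝ (Fin n)) (v : EuclideanSpace ℝ (Fin 2)) :
    fderiv ℝ (fun u => ε t (φ.symm u) (coordVec ψ ((F t).X (φ.symm u)) e)) (φ x) v
      + P.dComp ψ ((F t).X x) e ((F t).A x (coordVec φ x v)) (ε t x)
      - deriv (fun s => compA (F s).A φ ψ e v (φ x)) t
    = ∑ I, (fderiv ℝ (fun u => f t I (φ.symm u)) (φ x) v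
        - deriv (fun s => coord₁ (α s I) φ (φ x) v) t)
      * mvfderiv (𝓡 n) (C I) ((F t).X x) (coordVec ψ ((F t).X x) e) := by
  set q₀ : ℝ × EuclideanSpace ℝ (Fin 2) := (t, φ x) with hq₀
  have hq : q₀.2 ∈ φ.target ∧ (F q₀.1).X (φ.symm q₀.2) ∈ ψ.source :=
    ⟨φ.map_source hx, by simpa [hq₀, φ.left_inv hx] using hxψ⟩
  have hev := eventually_family_source (Y := fun t => (F t).X) hF hφ hq.1 hq.2
  let xh : ℝ × EuclideanSpace ℝ (Fin 2) → EuclideanSpace ℝ (Fin n) :=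
    fun q => ψ ((F q.1).X (φ.symm q.2))
  have hxh : ContDiffAt ℝ ∞ xh q₀ := contDiffAt_family (Y := fun t => (F t).X) hF hφ hψ hq.1 hq.2
  have hxh₀ : xh q₀ = ψ ((F t).X x) := by simp [xh, hq₀, φ.left_inv hx]
  -- This is the 1-form `α_I + f_I dt` on `ℝ × Σ`, whose mixed derivative is `d f_I - ∂_t α_I`.
  let ah : Fin k → ℝ × EuclideanSpace ℝ (Fin 2) → ℝ × EuclideanSpace ℝ (Fin 2) →L[ℝ] ℝ :=
    fun I q => (coord₁ (α q.1 I) φ q.2).comp (ContinuousLinearMap.snd ℝ _ _)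
      + f q.1 I (φ.symm q.2) • ContinuousLinearMap.fst ℝ _ _
  have hah : ∀ I q w, ah I q w = coord₁ (α q.1 I) φ q.2 w.2 + f q.1 I (φ.symm q.2) * w.1 :=
    fun I q w => rfl
  have hahd : ∀ I, DifferentiableAt ℝ (ah I) q₀ := fun I =>
    (((hαs I).clm_comp contDiffAt_const).add
      ((hfs I).smul contDiffAt_const)).differentiableAt (by simp)
  have hahf : ∀ I (w z : ℝ × EuclideanSpace ℝ (Fin 2)), fderiv ℝ (ah I) q₀ w z
      = fderiv ℝ (fun q => coord₁ (α q.1 I) φ q.2 z.2 + f q.1 I (φ.symm q.2) * z.1) q₀ w := by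
    intro I w z
    have h1 := (hahd I).hasFDerivAt.clm_apply (hasFDerivAt_const z q₀)
    refine (Eq.trans ?_ (congrArg (fun T => T w) h1.fderiv).symm)
    simp
  have hfv : ∀ᶠ q in 𝓝 q₀, compA (F q.1).A φ ψ e v q.2
      = localForm Ω C ψ (xh q) (fderiv ℝ xh q (0, v)) (fun I => ah I q (0, v)) e := by
    filter_upwards [hev] with q hq
    simpa [hah] using h.compA_eq_localForm_family hF hFL hα hφ hψ hq e v
  have hfw : ∀ᶠ q in 𝓝 q₀, ε q.1 (φ.symm q.2) (coordVec ψ ((F q.1).X (φ.symm q.2)) e)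
      = localForm Ω C ψ (xh q) (fderiv ℝ xh q (1, 0)) (fun I => ah I q (1, 0)) e := by
    filter_upwards [hev] with q hq
    simpa [hah] using h.param_eq_localForm_family hF hFL hε hφ hψ hq e
  have hloc : ∀ w, DifferentiableAt ℝ
      (fun q => localForm Ω C ψ (xh q) (fderiv ℝ xh q w) (fun I => ah I q w) e) q₀ := fun w =>
    (h.contDiffAt_localForm hψ (hFL t x) hxψ (ξ := fun q => fderiv ℝ xh q w)
      (r := fun I q => ah I q w) hxh hxh₀
      ((hxh.fderiv_right (m := ∞) (by simp)).clm_apply contDiffAt_const)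
      (fun I => ((hαs I).clm_apply contDiffAt_const).add ((hfs I).mul contDiffAt_const))
      e).differentiableAt (by simp)
  have hdv := (hloc (0, v)).congr_of_eventuallyEq hfv
  have hdw := (hloc (1, 0)).congr_of_eventuallyEq hfw
  have hxy : ∀ x', x' = x → ∀ z, ε t x' (coordVec ψ ((F t).X x') z)
      = ε t x (coordVec ψ ((F t).X x) z) := by
    rintro x' rfl z
    rfl
  have hdir : ∀ w, mfderiv (𝓡 2) (𝓡 n) (F t).X x (coordVec φ x w)
      = coordVec ψ ((F t).X x) (fderiv ℝ xh q₀ (0, w)) := by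
    intro w
    rw [mfderiv_coordVec hφ hψ hx hxψ ((contMDiff_slice (Y := fun t => (F t).X) hF
      t).mdifferentiableAt (by simp)),
      ← fderiv_slice_right (hxh.differentiableAt (by simp))]
  have hdirt : mfderiv 𝓘(ℝ, ℝ) (𝓡 n) (fun s => (F s).X x) t (1 : ℝ)
      = coordVec ψ ((F t).X x) (fderiv ℝ xh q₀ (1, 0)) := by
    have := mfderiv_orbit (Y := fun t => (F t).X) hF hφ hψ hq.1 hq.2
    have key : ∀ x', x' = x → mfderiv 𝓘(ℝ, ℝ) (𝓡 n) (fun t => (F t).X x') t (1 : ℝ)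
        = coordVec ψ ((F t).X x') (fderiv ℝ xh q₀ (1, 0)) →
        mfderiv 𝓘(ℝ, ℝ) (𝓡 n) (fun t => (F t).X x) t (1 : ℝ)
        = coordVec ψ ((F t).X x) (fderiv ℝ xh q₀ (1, 0)) := by
      rintro x' rfl h
      exact h
    exact key _ (φ.left_inv hx) this
  -- Directions `(0, v)` and `(1, 0)` make `a` the value of `A` and `b` the parameter ε, so the
  -- curvature becomes the gauge variation minus `∂_t A`.
  have hcurv := h.curvature_localForm hψ (hFL t x) hxψ (x := xh) (α := ah) (u := q₀)
    (v := (0, v)) (w := (1, 0)) (e := e) (a := (F t).A x (coordVec φ x v)) (b := ε t x)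
    hxh hxh₀ hahd
    (fun z => by
      rw [← compA_chart (F t).A hx]
      simpa [hah] using h.compA_eq_localForm_family hF hFL hα hφ hψ hq z v)
    (fun z => by
      rw [← hxy _ (φ.left_inv hx)]
      simpa [hah] using h.param_eq_localForm_family hF hFL hε hφ hψ hq z)
    hfv hfw
    (by
      rw [← hdir]
      exact h.sharp_eq_neg (hFL t x) (hα t x _)
        (h.dC_mfderiv (contMDiff_slice (Y := fun t => (F t).X) hF t) (hFL t) x _))
    (by
      rw [← hdirt]
      exact h.sharp_eq_neg (hFL t x) (hε t x)
        (h.dC_mfderiv (contMDiff_orbit (Y := fun t => (F t).X) hF x) (fun t => hFL t x) t _))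
  have h1 := fderiv_slice_right hdw v
  have h2 := (hasDerivAt_slice_left hdv).deriv
  rw [← h1, ← h2] at hcurv
  have h3 : ∀ I, fderiv ℝ (ah I) q₀ (0, v) (1, 0)
      = fderiv ℝ (fun u => f t I (φ.symm u)) (φ x) v := by
    intro I
    rw [hahf, fderiv_slice_right (g := fun q : ℝ × EuclideanSpace ℝ (Fin 2) =>
      f q.1 I (φ.symm q.2)) (q := q₀) ((hfs I).differentiableAt (by simp))]
    simp
  have h4 : ∀ I, fderiv ℝ (ah I) q₀ (1, 0) (0, v)
      = deriv (fun s => coord₁ (α s I) φ (φ x) v) t := by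
    intro I
    rw [hahf, ((hasDerivAt_slice_left (g := fun q : ℝ × EuclideanSpace ℝ (Fin 2) =>
      coord₁ (α q.1 I) φ q.2 v) (q := q₀)
      (((hαs I).clm_apply contDiffAt_const).differentiableAt (by simp))).deriv)]
    simp
  simp only [h3, h4] at hcurv
  rw [← hcurv]
  ring

end AdaptedData

end Gauge

end PSM

end

noncomputable section

namespace PSM

/-! ### Exact changes of `α_I` are gauge transformations. -/

theorem mem_closedForms_of_mem_exactForms {d : ℕ} {N : Type*} [TopologicalSpace N]
    [ChartedSpace (EuclideanSpace ℝ (Fin d)) N] {β : CovectorField d N}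
    (hβ : β ∈ exactForms d N) : β ∈ closedForms d N := by
  obtain ⟨f, hf, rfl⟩ := hβ
  have hsm : ∀ φ ∈ charts d N, ∀ u ∈ φ.target, ContDiffAt ℝ ∞ (fun u => f (φ.symm u)) u := by
    intro φ hφ u hu
    have := contDiffAt_comp_chart_symm hφ (φ.map_target hu) hf.contMDiffAt
    rwa [φ.right_inv hu] at this
  have hcomp : ∀ φ ∈ charts d N, ∀ v, ∀ u ∈ φ.target,
      comp₁ (fun x => mvfderiv (𝓡 d) f x) φ v u = fderiv ℝ (fun u => f (φ.symm u)) u v := by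
    intro φ hφ v u hu
    have := mvfderiv_coordVec hφ (φ.map_target hu) (hf.mdifferentiableAt (by simp)) v
    rwa [φ.right_inv hu] at this
  refine ⟨fun φ hφ v => ?_, fun φ hφ u hu v w => ?_⟩
  · refine ContDiffOn.congr (fun u hu => ContDiffAt.contDiffWithinAt ?_) (hcomp φ hφ v)
    exact ((hsm φ hφ u hu).fderiv_right (m := ∞) (by simp)).clm_apply contDiffAt_const
  · have hd := ((hsm φ hφ u hu).fderiv_right (m := ∞) (by simp)).differentiableAt (by simp)
    have h1 : ∀ v w, fderiv ℝ (comp₁ (fun x => mvfderiv (𝓡 d) f x) φ w) u v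
        = fderiv ℝ (fderiv ℝ fun u => f (φ.symm u)) u v w := by
      intro v w
      have he : comp₁ (fun x => mvfderiv (𝓡 d) f x) φ w =ᶠ[𝓝 u]
          fun u => fderiv ℝ (fun u => f (φ.symm u)) u w := by
        filter_upwards [φ.open_target.mem_nhds hu] with u hu using hcomp φ hφ w u hu
      rw [he.fderiv_eq]
      have h2 := hd.hasFDerivAt.clm_apply (hasFDerivAt_const w u)
      refine (congrArg (fun T => T v) h2.fderiv).trans ?_
      simp
    rw [h1, h1, ((hsm φ hφ u hu).isSymmSndFDerivAt minSmoothness_le_infty).eq v w, sub_self]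
    simp [comp₂]

section Gauge

variable {n k : ℕ} {M : Type*} [TopologicalSpace M] [ChartedSpace (EuclideanSpace ℝ (Fin n)) M]
  {S : Type*} [TopologicalSpace S] [ChartedSpace (EuclideanSpace ℝ (Fin 2)) S]
  {P : PoissonTensor n M} {L U W : Set M} {Ω : BilinField n M} {C : Fin k → M → ℝ}
  {m : ℕ} {Cas : Fin m → M → ℝ} {eps : Fin m → BilinField 2 S}

theorem HasForm.lineMap {X : S → M} {A A' : PullbackForm (n := n) X}
    {α β : Fin k → CovectorField 2 S} (h : HasForm Ω C A α) (h' : HasForm Ω C A' (α + β)) (t : ℝ) :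
    HasForm Ω C (fun x => A x + t • (A' x - A x)) (fun I => α I + t • β I) := by
  intro x v w
  change A x v w + t * (A' x v w - A x v w) = _
  rw [h, h']
  simp only [Pi.add_apply, Pi.smul_apply, _root_.add_apply, _root_.smul_apply, smul_eq_mul,
    add_mul, Finset.sum_add_distrib, mul_assoc, ← Finset.mul_sum]
  ring

theorem exists_form (X : S → M) (Ω : BilinField n M) (C : Fin k → M → ℝ)
    (α : Fin k → CovectorField 2 S) : ∃ A : PullbackForm (n := n) X, HasForm Ω C A α := by
  refine ⟨fun x =>
    let t : EuclideanSpace ℝ (Fin n) →L[ℝ] EuclideanSpace ℝ (Fin n) →L[ℝ] ℝ := Ω (X x)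
    let T : EuclideanSpace ℝ (Fin 2) →L[ℝ] EuclideanSpace ℝ (Fin n) := mfderiv (𝓡 2) (𝓡 n) X x
    let a : Fin k → EuclideanSpace ℝ (Fin 2) →L[ℝ] ℝ := fun I => α I x
    let dC : Fin k → EuclideanSpace ℝ (Fin n) →L[ℝ] ℝ := fun I => mvfderiv (𝓡 n) (C I) (X x)
    (∑ I, (a I).smulRight (dC I)) - t.flip.comp T, fun x v w => ?_⟩
  let t : EuclideanSpace ℝ (Fin n) →L[ℝ] EuclideanSpace ℝ (Fin n) →L[ℝ] ℝ := Ω (X x)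
  let T : EuclideanSpace ℝ (Fin 2) →L[ℝ] EuclideanSpace ℝ (Fin n) := mfderiv (𝓡 2) (𝓡 n) X x
  let a : Fin k → EuclideanSpace ℝ (Fin 2) →L[ℝ] ℝ := fun I => α I x
  let dC : Fin k → EuclideanSpace ℝ (Fin n) →L[ℝ] ℝ := fun I => mvfderiv (𝓡 n) (C I) (X x)
  have key : ∀ (v : EuclideanSpace ℝ (Fin 2)) (w : EuclideanSpace ℝ (Fin n)),
      ((∑ I, (a I).smulRight (dC I)) - t.flip.comp T) v w = - t w (T v) + ∑ I, a I v * dC I w := by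
    intro v w
    simp [_root_.sum_apply, _root_.sub_apply]
    ring
  exact key v w

namespace AdaptedData

variable [IsManifold (𝓡 2) ∞ S] [IsManifold (𝓡 n) ∞ M]

/-- With `β_I = d f_I`, the map is kept fixed and `A` runs along the segment to `A'` with parameter
`f_I dC^I`. The parameter lies in the kernel of 𝒫, so it does not move `X`, and all points of the
segment are solutions because exact forms are closed. -/
theorem gaugeTransform_of_exact (h : AdaptedData P L U W Ω C) {X : S → M}
    (hX : ContMDiff (𝓡 2) (𝓡 n) ∞ X) (hXL : ∀ x, X x ∈ L) {c : Fin m → Fin k → ℝ}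
    (hc : ∀ s, ∀ y ∈ L, mvfderiv (𝓡 n) (Cas s) y = ∑ I, c s I • mvfderiv (𝓡 n) (C I) y)
    {p : Fin k → CovectorField 2 S}
    (hp : ∀ I, IsSmooth₁ (p I) ∧ HasExtDeriv₁ (p I) (∑ s, c s I • eps s))
    {A A' : PullbackForm (n := n) X} {α β : Fin k → CovectorField 2 S}
    (hsol : IsSolution P Cas eps ⟨X, A⟩) (hα : HasForm Ω C A α) (hβ : ∀ I, β I ∈ exactForms 2 S)
    (hα' : HasForm Ω C A' (α + β)) : GaugeTransform P Cas eps ⟨X, A⟩ ⟨X, A'⟩ := by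
  have hαc := (h.isSolution_iff_of_hasForm hX hXL hc hp hα).1 hsol
  have hβc := fun I => mem_closedForms_of_mem_exactForms (hβ I)
  have hline := hα.lineMap hα'
  have hsolt : ∀ t : ℝ, IsSolution P Cas eps ⟨X, fun x => A x + t • (A' x - A x)⟩ := by
    intro t
    refine (h.isSolution_iff_of_hasForm hX hXL hc hp (hline t)).2 fun I => ⟨?_, ?_⟩
    · intro φ hφ v
      exact ((hαc I).1 φ hφ v).add (((hβc I).1 φ hφ v).const_smul t)
    · rw [add_right_comm]
      exact Submodule.add_mem _ (hαc I).2 (Submodule.smul_mem _ t (hβc I))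
  have hA's : ∀ φ ∈ charts 2 S, ∀ ψ ∈ charts n M, ∀ e v,
      ContDiffOn ℝ ∞ (compA A' φ ψ e v) {u ∈ φ.target | X (φ.symm u) ∈ ψ.source} := by
    intro φ hφ ψ hψ e v
    exact h.contDiffOn_compA hX hXL hα' (fun I φ hφ v =>
      ((hαc I).1 φ hφ v).add ((hβc I).1 φ hφ v)) hφ hψ e v
  choose f hf hfβ using hβ
  let F : ℝ → Fields n M S := fun t => ⟨X, fun x => A x + t • (A' x - A x)⟩
  let ε : ∀ t x, TangentSpace (𝓡 n) ((F t).X x) →L[ℝ] ℝ :=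
    fun t x => ∑ I, f I x • mvfderiv (𝓡 n) (C I) (X x)
  have hvel : ∀ t x, mfderiv 𝓘(ℝ, ℝ) (𝓡 n) (fun s => (F s).X x) t (1 : ℝ) = 0 := by
    intro t x
    have h0 : mfderiv 𝓘(ℝ, ℝ) (𝓡 n) (fun s => (F s).X x) t = 0 := mfderiv_const
    rw [h0]
    rfl
  have hε : ∀ t x w, ε t x w
      = - Ω ((F t).X x) w (mfderiv 𝓘(ℝ, ℝ) (𝓡 n) (fun s => (F s).X x) t (1 : ℝ))
        + ∑ I, f I x * mvfderiv (𝓡 n) (C I) ((F t).X x) w := by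
    intro t x w
    rw [hvel, map_zero]
    simp [ε, F, _root_.sum_apply, _root_.smul_apply]
  have hF : ContMDiff (𝓘(ℝ, ℝ).prod (𝓡 2)) (𝓡 n) ∞ (fun q : ℝ × S => (F q.1).X q.2) :=
    hX.comp contMDiff_snd
  have hfs : ∀ φ ∈ charts 2 S, ∀ q : ℝ × EuclideanSpace ℝ (Fin 2), q.2 ∈ φ.target → ∀ I,
      ContDiffAt ℝ ∞ (fun q : ℝ × EuclideanSpace ℝ (Fin 2) => f I (φ.symm q.2)) q := by
    intro φ hφ q hq I
    have := contDiffAt_comp_chart_symm hφ (φ.map_target hq) (hf I).contMDiffAt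
    rw [φ.right_inv hq] at this
    exact ContDiffAt.comp (g := fun u => f I (φ.symm u)) q this contDiffAt_snd
  refine ⟨F, ε, hsolt, hF, ?_, ?_, ?_, ?_, ?_, ?_⟩
  · intro φ hφ ψ hψ e v
    have h1 := (hsol.smooth_A φ hφ ψ hψ e v).comp (t := {u ∈ φ.target | X (φ.symm u) ∈ ψ.source})
      (s := {q : ℝ × EuclideanSpace ℝ (Fin 2) | q.2 ∈ φ.target ∧ X (φ.symm q.2) ∈ ψ.source})
      contDiff_snd.contDiffOn fun q hq => hq
    have h2 := (hA's φ hφ ψ hψ e v).comp (t := {u ∈ φ.target | X (φ.symm u) ∈ ψ.source})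
      (s := {q : ℝ × EuclideanSpace ℝ (Fin 2) | q.2 ∈ φ.target ∧ X (φ.symm q.2) ∈ ψ.source})
      contDiff_snd.contDiffOn fun q hq => hq
    exact h1.add (contDiff_fst.contDiffOn.mul (h2.sub h1))
  · rintro φ hφ ψ hψ e q ⟨hq, hqψ⟩
    have hx := contDiffAt_family (Y := fun _ => X) hF hφ hψ hq hqψ
    have hev := eventually_family_source (Y := fun _ => X) hF hφ hq hqψ
    refine ContDiffAt.contDiffWithinAt (ContDiffAt.congr_of_eventuallyEq
      (h.contDiffAt_localForm hψ (hXL _) hqψ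
        (ξ := fun q' => fderiv ℝ (fun q : ℝ × EuclideanSpace ℝ (Fin 2) =>
          ψ (X (φ.symm q.2))) q' (1, 0)) (r := fun I q => f I (φ.symm q.2)) hx rfl
        ((hx.fderiv_right (m := ∞) (by simp)).clm_apply contDiffAt_const)
        (fun I => hfs φ hφ q hq I) e) ?_)
    filter_upwards [hev] with q hq
    exact h.param_eq_localForm_family hF (fun _ => hXL) hε hφ hψ hq e
  · intro t x
    have h1 : P.sharp ((F t).X x) (ε t x) = 0 := by
      simp only [ε, F, map_sum, map_smul]
      refine Finset.sum_eq_zero fun I _ => ?_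
      rw [(h.defining.casimir I).2 _ (h.subset_right (hXL x)), smul_zero]
    rw [hvel, h1, neg_zero]
  · intro φ hφ ψ hψ t x hx hxψ e v
    have hxt := φ.map_source hx
    have hcs : ∀ β : CovectorField 2 S, IsSmooth₁ β → ContDiffAt ℝ ∞
        (fun q : ℝ × EuclideanSpace ℝ (Fin 2) => coord₁ β φ q.2) (t, φ x) := fun β hβ =>
      ((contDiffOn_coord₁ hβ hφ).contDiffAt (φ.open_target.mem_nhds hxt)).comp (t, φ x)
        contDiffAt_snd
    -- The gauge law for `A` reduces to `d f_I = ∂_t (α_I + t β_I) = β_I`.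
    have key := h.gauge_defect (F := F) (ε := ε) (α := fun t I => α I + t • β I)
      (f := fun _ I => f I) hF (fun _ => hXL) hline hε hφ hψ hx hxψ
      (fun I => (hcs _ (hαc I).1).add (contDiffAt_fst.smul (hcs _ (hβc I).1)))
      (fun I => hfs φ hφ _ hxt I) e v
    rw [Finset.sum_eq_zero, sub_eq_zero] at key
    · exact key.symm
    · intro I _
      refine mul_eq_zero_of_left (sub_eq_zero.2 ?_) _
      have h1 : HasDerivAt (fun s : ℝ => comp₁ (α I) φ v (φ x) + s * comp₁ (β I) φ v (φ x))
          (1 * comp₁ (β I) φ v (φ x)) t := ((hasDerivAt_id t).mul_const _).const_add _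
      refine Eq.trans ?_ h1.deriv.symm
      rw [one_mul, comp₁_chart _ hx, hfβ]
      exact (mvfderiv_coordVec hφ hx ((hf I).mdifferentiableAt (by simp)) v).symm
  · change (⟨X, fun x => A x + (0 : ℝ) • (A' x - A x)⟩ : Fields n M S) = _
    congr 1
    funext x
    ext v w
    change A x v w + 0 * (A' x v w - A x v w) = _
    ring
  · change (⟨X, fun x => A x + (1 : ℝ) • (A' x - A x)⟩ : Fields n M S) = _
    congr 1
    funext x
    ext v w
    change A x v w + 1 * (A' x v w - A x v w) = _
    ring

end AdaptedData

end Gauge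

end PSM

end

noncomputable section

namespace PSM

/-! ### Gauge equivalence preserves the leaf and changes `α_I` by exact forms. -/

section Invariants

variable {n k : ℕ} {M : Type*} [TopologicalSpace M] [ChartedSpace (EuclideanSpace ℝ (Fin n)) M]
  {S : Type*} [TopologicalSpace S] [ChartedSpace (EuclideanSpace ℝ (Fin 2)) S]
  {P : PoissonTensor n M} {L U W : Set M} {Ω : BilinField n M} {C : Fin k → M → ℝ}
  {m : ℕ} {Cas : Fin m → M → ℝ} {eps : Fin m → BilinField 2 S}

/-- Joint smoothness in time and position is what permits differentiating `∫ f_I dt` under the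
integral. -/
theorem AdaptedData.contDiffOn_param_family [IsManifold (𝓡 n) ∞ M]
    (h : AdaptedData P L U W Ω C) {F : ℝ → Fields n M S}
    {ε : ∀ t x, TangentSpace (𝓡 n) ((F t).X x) →L[ℝ] ℝ} {f : ℝ → Fin k → S → ℝ}
    (hF : ContMDiff (𝓘(ℝ, ℝ).prod (𝓡 2)) (𝓡 n) ∞ fun q : ℝ × S => (F q.1).X q.2)
    (hFL : ∀ t x, (F t).X x ∈ L)
    (hf : ∀ t x w, ε t x w
      = - Ω ((F t).X x) w (mfderiv 𝓘(ℝ, ℝ) (𝓡 n) (fun s => (F s).X x) t (1 : ℝ))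
        + ∑ I, f t I x * mvfderiv (𝓡 n) (C I) ((F t).X x) w)
    (hε : ∀ φ ∈ charts 2 S, ∀ ψ ∈ charts n M, ∀ e,
      ContDiffOn ℝ ∞ (fun q : ℝ × EuclideanSpace ℝ (Fin 2) =>
          ε q.1 (φ.symm q.2) (coordVec ψ ((F q.1).X (φ.symm q.2)) e))
        {q | q.2 ∈ φ.target ∧ (F q.1).X (φ.symm q.2) ∈ ψ.source})
    {φ : OpenPartialHomeomorph S (EuclideanSpace ℝ (Fin 2))} (hφ : φ ∈ charts 2 S) (I : Fin k) :
    ContDiffOn ℝ ∞ (fun q : ℝ × EuclideanSpace ℝ (Fin 2) => f q.1 I (φ.symm q.2))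
      {q | q.2 ∈ φ.target} := by
  intro q hq
  refine ContDiffAt.contDiffWithinAt ?_
  have hψ := chartAt_mem_charts (d := n) ((F q.1).X (φ.symm q.2))
  set ψ := chartAt (EuclideanSpace ℝ (Fin n)) ((F q.1).X (φ.symm q.2))
  have hqψ : (F q.1).X (φ.symm q.2) ∈ ψ.source := mem_chart_source _ _
  have hx := contDiffAt_family (Y := fun t => (F t).X) hF hφ hψ hq hqψ
  have hev := eventually_family_source (Y := fun t => (F t).X) hF hφ hq hqψ
  refine h.contDiffAt_coefficients hψ (hFL _ _) hqψ
    (ξ := fun q' => fderiv ℝ (fun q : ℝ × EuclideanSpace ℝ (Fin 2) =>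
      ψ ((F q.1).X (φ.symm q.2))) q' (1, 0))
    (r := fun I q => f q.1 I (φ.symm q.2)) hx rfl
    ((hx.fderiv_right (m := ∞) (by simp)).clm_apply contDiffAt_const)
    (g := fun e q => ε q.1 (φ.symm q.2) (coordVec ψ ((F q.1).X (φ.symm q.2)) e))
    (fun e => (hε φ hφ ψ hψ e).contDiffAt hev) ?_ I
  filter_upwards [hev] with q hq e
  exact h.param_eq_localForm_family hF hFL hf hφ hψ hq e

variable [IsManifold (𝓡 2) ∞ S]

/-- Each orbit `t ↦ X_t(x)` is a cotangent curve with covector `-ε_t(x)`, hence stays in one leaf.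
-/
theorem mem_leaf_iff_of_family (hL : IsSymplecticLeaf P L) {F : ℝ → Fields n M S}
    {ε : ∀ t x, TangentSpace (𝓡 n) ((F t).X x) →L[ℝ] ℝ}
    (hF : ContMDiff (𝓘(ℝ, ℝ).prod (𝓡 2)) (𝓡 n) ∞ fun q : ℝ × S => (F q.1).X q.2)
    (hε : ∀ φ ∈ charts 2 S, ∀ ψ ∈ charts n M, ∀ e,
      ContDiffOn ℝ ∞ (fun q : ℝ × EuclideanSpace ℝ (Fin 2) =>
          ε q.1 (φ.symm q.2) (coordVec ψ ((F q.1).X (φ.symm q.2)) e))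
        {q | q.2 ∈ φ.target ∧ (F q.1).X (φ.symm q.2) ∈ ψ.source})
    (hv : ∀ t x, mfderiv 𝓘(ℝ, ℝ) (𝓡 n) (fun s => (F s).X x) t (1 : ℝ)
      = - P.sharp ((F t).X x) (ε t x)) (t : ℝ) (x : S) :
    (F 0).X x ∈ L ↔ (F t).X x ∈ L := by
  refine hL.mem_of_step (CotangentStep.of_curve (γ := fun t => (F t).X x)
    (η := fun t => - ε t x) (contMDiff_orbit (Y := fun t => (F t).X) hF x) ?_ ?_ t)
  · intro ψ hψ e
    have hφ := chartAt_mem_charts (d := 2) x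
    set φ := chartAt (EuclideanSpace ℝ (Fin 2)) x
    have hx : x ∈ φ.source := mem_chart_source _ _
    have key : ∀ t x', x' = x → ε t x' (coordVec ψ ((F t).X x') e)
        = ε t x (coordVec ψ ((F t).X x) e) := by
      rintro t x' rfl
      rfl
    have h1 := (hε φ hφ ψ hψ e).comp (f := fun t : ℝ => (t, φ x))
      (s := (fun t => (F t).X x) ⁻¹' ψ.source) (by fun_prop)
      fun t ht => ⟨φ.map_source hx, by simpa [φ.left_inv hx] using ht⟩
    exact (h1.congr fun t _ => (key t _ (φ.left_inv hx)).symm).neg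
  · intro t
    rw [map_neg, hv]

namespace AdaptedData

variable [IsManifold (𝓡 n) ∞ M]

theorem contDiffOn_form_family (h : AdaptedData P L U W Ω C) {F : ℝ → Fields n M S}
    (hF : ContMDiff (𝓘(ℝ, ℝ).prod (𝓡 2)) (𝓡 n) ∞ fun q : ℝ × S => (F q.1).X q.2)
    (hFL : ∀ t x, (F t).X x ∈ L) {α : ℝ → Fin k → CovectorField 2 S}
    (hα : ∀ t, HasForm Ω C (F t).A (α t))
    (hA : ∀ φ ∈ charts 2 S, ∀ ψ ∈ charts n M, ∀ e v,
      ContDiffOn ℝ ∞ (fun q : ℝ × EuclideanSpace ℝ (Fin 2) => compA (F q.1).A φ ψ e v q.2)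
        {q | q.2 ∈ φ.target ∧ (F q.1).X (φ.symm q.2) ∈ ψ.source})
    {φ : OpenPartialHomeomorph S (EuclideanSpace ℝ (Fin 2))} (hφ : φ ∈ charts 2 S) (I : Fin k) :
    ContDiffOn ℝ ∞ (fun q : ℝ × EuclideanSpace ℝ (Fin 2) => coord₁ (α q.1 I) φ q.2)
      {q | q.2 ∈ φ.target} := by
  refine contDiffOn_clm_apply.2 fun v q hq => ContDiffAt.contDiffWithinAt ?_
  have hψ := chartAt_mem_charts (d := n) ((F q.1).X (φ.symm q.2))
  set ψ := chartAt (EuclideanSpace ℝ (Fin n)) ((F q.1).X (φ.symm q.2))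
  have hqψ : (F q.1).X (φ.symm q.2) ∈ ψ.source := mem_chart_source _ _
  have hx := contDiffAt_family (Y := fun t => (F t).X) hF hφ hψ hq hqψ
  have hev := eventually_family_source (Y := fun t => (F t).X) hF hφ hq hqψ
  refine h.contDiffAt_coefficients hψ (hFL _ _) hqψ
    (ξ := fun q' => fderiv ℝ (fun q : ℝ × EuclideanSpace ℝ (Fin 2) =>
      ψ ((F q.1).X (φ.symm q.2))) q' (0, v))
    (r := fun I q => coord₁ (α q.1 I) φ q.2 v) hx rfl
    ((hx.fderiv_right (m := ∞) (by simp)).clm_apply contDiffAt_const)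
    (g := fun e q => compA (F q.1).A φ ψ e v q.2) (fun e => ?_) ?_ I
  · exact (hA φ hφ ψ hψ e v).contDiffAt hev
  · filter_upwards [hev] with q hq e
    exact h.compA_eq_localForm_family hF hFL hα hφ hψ hq e v

/-- A gauge transformation starting in the leaf stays in the leaf and changes the forms `α_I` by
exact forms. -/
theorem exists_exact_of_gaugeTransform (h : AdaptedData P L U W Ω C) {Φ Φ' : Fields n M S}
    (hG : GaugeTransform P Cas eps Φ Φ') (hΦ : ∀ x, Φ.X x ∈ L) :
    ∃ δ : Fin k → CovectorField 2 S, (∀ I, δ I ∈ exactForms 2 S) ∧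
      ∀ α, HasForm Ω C Φ.A α ↔ HasForm Ω C Φ'.A (α + δ) := by
  obtain ⟨F, ε, hsol, hF, hA, hε, hv, hδ, rfl, rfl⟩ := hG
  have hFL : ∀ t x, (F t).X x ∈ L := fun t x =>
    (mem_leaf_iff_of_family h.leaf.leaf hF hε hv t x).1 (hΦ x)
  choose α hα using fun t => h.exists_hasForm (hFL t) (hsol t).eqX
  -- The law for `X` says `𝒫ε = -∂_t X`, the same linear equation as for `A` with `∂_t X` in place
  -- of `dX`.
  choose f' hf' using fun t x => h.exists_coefficients (hFL t x) (a := ε t x)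
    (neg_eq_iff_eq_neg.1 (hv t x).symm)
  let f : ℝ → Fin k → S → ℝ := fun t I x => f' t x I
  have hf : ∀ t x w, ε t x w
      = - Ω ((F t).X x) w (mfderiv 𝓘(ℝ, ℝ) (𝓡 n) (fun s => (F s).X x) t (1 : ℝ))
        + ∑ I, f t I x * mvfderiv (𝓡 n) (C I) ((F t).X x) w := hf'
  have hαs := fun φ (hφ : φ ∈ charts 2 S) I => h.contDiffOn_form_family hF hFL hα hA hφ I
  have hfs := fun φ (hφ : φ ∈ charts 2 S) I => h.contDiffOn_param_family hF hFL hf hε hφ I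
  have hopen : ∀ φ : OpenPartialHomeomorph S (EuclideanSpace ℝ (Fin 2)),
      IsOpen {q : ℝ × EuclideanSpace ℝ (Fin 2) | q.2 ∈ φ.target} := fun φ =>
    φ.open_target.preimage continuous_snd
  -- The gauge law makes the left side of `gauge_defect` vanish; independence of the `dC^I` then
  -- gives `∂_t α_I = d f_I`.
  have hder : ∀ φ ∈ charts 2 S, ∀ I, ∀ u ∈ φ.target, ∀ t v,
      HasDerivAt (fun t => coord₁ (α t I) φ u v) (fderiv ℝ (fun u => f t I (φ.symm u)) u v) t := by
    intro φ hφ I u hu t v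
    have hx := φ.map_target hu
    obtain ⟨x, hxs, rfl⟩ : ∃ x ∈ φ.source, φ x = u := ⟨_, hx, φ.right_inv hu⟩
    have hψ := chartAt_mem_charts (d := n) ((F t).X x)
    set ψ := chartAt (EuclideanSpace ℝ (Fin n)) ((F t).X x)
    have hxψ : (F t).X x ∈ ψ.source := mem_chart_source _ _
    have hαa := fun I => (hαs φ hφ I).contDiffAt ((hopen φ).mem_nhds (x := (t, φ x)) hu)
    have hfa := fun I => (hfs φ hφ I).contDiffAt ((hopen φ).mem_nhds (x := (t, φ x)) hu)
    have key := h.eq_of_sum_eq (hFL t x) (s := 0)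
      (r := fun I => fderiv ℝ (fun u => f t I (φ.symm u)) (φ x) v
        - deriv (fun s => coord₁ (α s I) φ (φ x) v) t) (by
        intro w
        obtain ⟨e, rfl⟩ := coordVec_surjective hψ hxψ w
        rw [← h.gauge_defect hF hFL hα hf hφ hψ hxs hxψ hαa hfa e v,
          hδ φ hφ ψ hψ t x hxs hxψ e v]
        simp)
    have h1 : fderiv ℝ (fun u => f t I (φ.symm u)) (φ x) v
        = deriv (fun s => coord₁ (α s I) φ (φ x) v) t := sub_eq_zero.1 (congrFun key I)
    rw [h1]
    exact (hasDerivAt_slice_left (g := fun q : ℝ × EuclideanSpace ℝ (Fin 2) =>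
      coord₁ (α q.1 I) φ q.2 v) (q := (t, φ x))
      (((hαa I).clm_apply contDiffAt_const).differentiableAt (by simp))).differentiableAt.hasDerivAt
  -- The time average of `f_I` is the primitive of `α_I` at time 1 minus `α_I` at time 0.
  let G : Fin k → S → ℝ := fun I x => ∫ t in (0 : ℝ)..1, f t I x
  have hG : ∀ φ ∈ charts 2 S, ∀ I, ∀ u ∈ φ.target, HasFDerivAt (fun u => G I (φ.symm u))
      (coord₁ (α 1 I) φ u - coord₁ (α 0 I) φ u) u := fun φ hφ I u hu =>
    hasFDerivAt_integral_of_hasDerivAt φ.open_target (hfs φ hφ I) hu (hder φ hφ I u hu)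
  have hsm : ∀ t I, IsSmooth₁ (α t I) := fun t I =>
    h.isSmooth_of_hasForm (hsol t).smooth_X (hFL t) (hα t) (hsol t).smooth_A I
  have hGs : ∀ I, ContMDiff (𝓡 2) 𝓘(ℝ, ℝ) ∞ (G I) := by
    intro I x
    have hφ := chartAt_mem_charts (d := 2) x
    set φ := chartAt (EuclideanSpace ℝ (Fin 2)) x
    have hx : x ∈ φ.source := mem_chart_source _ _
    refine contMDiffAt_of_comp_chart_symm hφ hx (ContDiffOn.contDiffAt ?_
      (φ.open_target.mem_nhds (φ.map_source hx)))
    -- Smoothness of the integral is read off from its derivative, a difference of smooth 1-forms,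
    -- without further differentiation under the integral.
    refine (contDiffOn_infty_iff_fderiv_of_isOpen φ.open_target).2
      ⟨fun u hu => (hG φ hφ I u hu).differentiableAt.differentiableWithinAt, ?_⟩
    exact ((contDiffOn_coord₁ (hsm 1 I) hφ).sub (contDiffOn_coord₁ (hsm 0 I) hφ)).congr
      fun u hu => (hG φ hφ I u hu).fderiv
  have hdiff : α 1 = α 0 + fun I x => mvfderiv (𝓡 2) (G I) x := by
    funext I x
    have hφ := chartAt_mem_charts (d := 2) x
    set φ := chartAt (EuclideanSpace ℝ (Fin 2)) x
    have hx : x ∈ φ.source := mem_chart_source _ _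
    refine covector_ext hφ hx fun v => ?_
    have h1 := mvfderiv_coordVec hφ hx ((hGs I).mdifferentiableAt (by simp)) v
    rw [(hG φ hφ I _ (φ.map_source hx)).fderiv] at h1
    change α 1 I x (coordVec φ x v)
      = α 0 I x (coordVec φ x v) + mvfderiv (𝓡 2) (G I) x (coordVec φ x v)
    rw [h1, _root_.sub_apply, coord₁_apply, coord₁_apply, comp₁_chart _ hx, comp₁_chart _ hx]
    ring
  refine ⟨fun I x => mvfderiv (𝓡 2) (G I) x, fun I => ⟨G I, hGs I, rfl⟩, fun β => ⟨fun hβ => ?_,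
    fun hβ => ?_⟩⟩
  · rw [h.hasForm_unique (hFL 0) hβ (hα 0), ← hdiff]
    exact hα 1
  · have h1 := h.hasForm_unique (hFL 1) hβ (hα 1)
    rw [hdiff] at h1
    rw [add_right_cancel h1]
    exact hα 0

/-- The intermediate maps of a chain may differ from `X`, so the induction carries along that being
in the leaf is preserved; the equivalence is needed for reversed steps. -/
theorem exists_exact_of_gaugeEquiv (h : AdaptedData P L U W Ω C) {Φ Φ' : Fields n M S}
    (hG : GaugeEquiv P Cas eps Φ Φ') :
    ((∀ x, Φ.X x ∈ L) ↔ ∀ x, Φ'.X x ∈ L) ∧ ((∀ x, Φ.X x ∈ L) →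
      ∃ δ : Fin k → CovectorField 2 S, (∀ I, δ I ∈ exactForms 2 S) ∧
        ∀ α, HasForm Ω C Φ.A α ↔ HasForm Ω C Φ'.A (α + δ)) := by
  induction hG with
  | rel Φ Φ' hG =>
    refine ⟨?_, h.exists_exact_of_gaugeTransform hG⟩
    obtain ⟨F, ε, -, hF, -, hε, hv, -, rfl, rfl⟩ := hG
    exact forall_congr' fun x => mem_leaf_iff_of_family h.leaf.leaf hF hε hv 1 x
  | refl Φ => exact ⟨Iff.rfl, fun _ => ⟨0, fun I => Submodule.zero_mem _, fun α => by rw [add_zero]⟩⟩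
  | symm Φ Φ' _ ih =>
    refine ⟨ih.1.symm, fun hΦ' => ?_⟩
    obtain ⟨δ, hδ, hδα⟩ := ih.2 (ih.1.2 hΦ')
    exact ⟨-δ, fun I => Submodule.neg_mem _ (hδ I), fun α => by rw [hδα, neg_add_cancel_right]⟩
  | trans Φ Φ' Φ'' _ _ ih ih' =>
    refine ⟨ih.1.trans ih'.1, fun hΦ => ?_⟩
    obtain ⟨δ, hδ, hδα⟩ := ih.2 hΦ
    obtain ⟨δ', hδ', hδα'⟩ := ih'.2 (ih.1.1 hΦ)
    exact ⟨δ + δ', fun I => Submodule.add_mem _ (hδ I) (hδ' I),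
      fun α => by rw [hδα, hδα', add_assoc]⟩

end AdaptedData

end Invariants

end PSM

end

noncomputable section

namespace PSM

/-! ### The bijection with cohomology classes. -/

section Classification

variable {n k : ℕ} {M : Type*} [TopologicalSpace M] [ChartedSpace (EuclideanSpace ℝ (Fin n)) M]
  [IsManifold (𝓡 n) ∞ M]
  {S : Type*} [TopologicalSpace S] [ChartedSpace (EuclideanSpace ℝ (Fin 2)) S]
  [IsManifold (𝓡 2) ∞ S]
  {P : PoissonTensor n M} {L U W : Set M} {Ω : BilinField n M} {C : Fin k → M → ℝ}
  {m : ℕ} {Cas : Fin m → M → ℝ} {eps : Fin m → BilinField 2 S}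

theorem H1.mk_eq_iff {d : ℕ} {N : Type*} [TopologicalSpace N]
    [ChartedSpace (EuclideanSpace ℝ (Fin d)) N] {α β : CovectorField d N}
    (hα : α ∈ closedForms d N) (hβ : β ∈ closedForms d N) :
    H1.mk α hα = H1.mk β hβ ↔ α - β ∈ exactForms d N :=
  Submodule.Quotient.eq _

theorem H1.exists_mk {d : ℕ} {N : Type*} [TopologicalSpace N]
    [ChartedSpace (EuclideanSpace ℝ (Fin d)) N] (κ : H1 d N) :
    ∃ (α : CovectorField d N) (hα : α ∈ closedForms d N), H1.mk α hα = κ := by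
  obtain ⟨⟨α, hα⟩, rfl⟩ := Submodule.Quotient.mk_surjective _ κ
  exact ⟨α, hα, rfl⟩

/-- The tuple of classes is well defined on gauge classes by `exists_exact_of_gaugeEquiv`, separates
them by `gaugeTransform_of_exact`, and takes every value because `exists_form` imposes no condition
on the `α_I`. -/
theorem AdaptedData.exists_equiv (h : AdaptedData P L U W Ω C) {X : S → M}
    (hX : ContMDiff (𝓡 2) (𝓡 n) ∞ X) (hXL : ∀ x, X x ∈ L) {c : Fin m → Fin k → ℝ}
    (hc : ∀ s, ∀ y ∈ L, mvfderiv (𝓡 n) (Cas s) y = ∑ I, c s I • mvfderiv (𝓡 n) (C I) y)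
    {p : Fin k → CovectorField 2 S}
    (hp : ∀ I, IsSmooth₁ (p I) ∧ HasExtDeriv₁ (p I) (∑ s, c s I • eps s)) :
    ∃ e : Quotient (gaugeSetoid P Cas eps X) ≃ (Fin k → H1 2 S),
      ∀ (A : SolutionsOver P Cas eps X) (α : Fin k → CovectorField 2 S)
        (hα : ∀ I, α I + p I ∈ closedForms 2 S), HasForm Ω C A.1 α →
        e (Quotient.mk _ A) = fun I => H1.mk (α I + p I) (hα I) := by
  choose α hα using fun A : SolutionsOver P Cas eps X => h.exists_hasForm hXL A.2.eqX
  have hcl : ∀ A I, α A I + p I ∈ closedForms 2 S := fun A I =>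
    ((h.isSolution_iff_of_hasForm hX hXL hc hp (hα A)).1 A.2 I).2
  let Λ : SolutionsOver P Cas eps X → Fin k → H1 2 S := fun A I => H1.mk (α A I + p I) (hcl A I)
  have hΛ : ∀ A A', (gaugeSetoid P Cas eps X).r A A' ↔ Λ A = Λ A' := by
    intro A A'
    constructor
    · intro hAA'
      obtain ⟨δ, hδ, hδα⟩ := (h.exists_exact_of_gaugeEquiv hAA').2 hXL
      have h1 := h.hasForm_unique hXL ((hδα _).1 (hα A)) (hα A')
      funext I
      refine (H1.mk_eq_iff _ _).2 ?_
      rw [← h1, Pi.add_apply, add_sub_add_right_eq_sub, sub_add_cancel_left]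
      exact Submodule.neg_mem _ (hδ I)
    · intro hAA'
      -- The exact form `α A - α A'` leads from `A'` to `A`, whence the reversal.
      refine Relation.EqvGen.symm _ _ (Relation.EqvGen.rel _ _
        (h.gaugeTransform_of_exact (β := α A - α A') hX hXL hc hp A'.2 (hα A') (fun I => ?_) ?_))
      · have h1 := (H1.mk_eq_iff _ _).1 (congrFun hAA' I)
        rwa [add_sub_add_right_eq_sub] at h1
      · rw [add_sub_cancel]
        exact hα A
  have hsurj : Function.Surjective Λ := by
    intro κ
    choose β hβ hβκ using fun I => H1.exists_mk (κ I)
    -- Closed representatives `β_I` of the prescribed classes force `α_I = β_I - p_I`.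
    obtain ⟨A, hA⟩ := exists_form X Ω C fun I => β I - p I
    have hsm : ∀ I, IsSmooth₁ (β I - p I) := fun I φ hφ v =>
      ((hβ I).1 φ hφ v).sub ((hp I).1 φ hφ v)
    have hsol : IsSolution P Cas eps ⟨X, A⟩ :=
      (h.isSolution_iff_of_hasForm hX hXL hc hp hA).2 fun I => ⟨hsm I, by
        rw [sub_add_cancel]
        exact hβ I⟩
    refine ⟨⟨A, hsol⟩, ?_⟩
    have h1 := h.hasForm_unique hXL (hα ⟨A, hsol⟩) hA
    funext I
    rw [← hβκ]
    refine (H1.mk_eq_iff _ _).2 ?_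
    rw [h1, sub_add_cancel, sub_self]
    exact Submodule.zero_mem _
  let E : Quotient (gaugeSetoid P Cas eps X) → Fin k → H1 2 S :=
    Quotient.lift Λ fun A A' hAA' => (hΛ A A').1 hAA'
  have hE : Function.Bijective E := by
    refine ⟨?_, fun κ => ?_⟩
    · rintro ⟨A⟩ ⟨A'⟩ hAA'
      exact Quotient.sound ((hΛ A A').2 hAA')
    · obtain ⟨A, rfl⟩ := hsurj κ
      exact ⟨Quotient.mk _ A, rfl⟩
  refine ⟨Equiv.ofBijective E hE, fun A β hβ hAβ => ?_⟩
  obtain rfl := h.hasForm_unique hXL (hα A) hAβ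
  rfl

end Classification

end PSM

end

open PSM in
theorem corollary3
    {n : ℕ} {M : Type*} [TopologicalSpace M] [T2Space M] [SecondCountableTopology M]
    [ChartedSpace (EuclideanSpace ℝ (Fin n)) M] [IsManifold (𝓡 n) ∞ M]
    {S : Type*} [TopologicalSpace S] [T2Space S] [SecondCountableTopology S]
    [ChartedSpace (EuclideanSpace ℝ (Fin 2)) S] [IsManifold (𝓡 2) ∞ S]
    (P : PoissonTensor n M)
    {m : ℕ} (Cas : Fin m → M → ℝ) (hCas : ∀ s, IsCasimirOn P Set.univ (Cas s))
    (eps : Fin m → BilinField 2 S) (heps : ∀ s, IsTwoFormOn Set.univ (eps s))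
    {k : ℕ} (L : Set M) (hL : IsRegularLeaf P k L) (hol : HasTrivialHolonomy P k L)
    (U : Set M) (hU : IsOpen U) (hLU : L ⊆ U)
    (Ω : BilinField n M) (hΩ : IsCompatiblePresymplectic P U Ω)
    (X : S → M) (hX : ContMDiff (𝓡 2) (𝓡 n) ∞ X) (hXL : ∀ x, X x ∈ L) :
    (∃ (W : Set M) (C : Fin k → M → ℝ), L ⊆ W ∧ W ⊆ U ∧ IsDefining P L W C) ∧
    ∀ (W : Set M) (C : Fin k → M → ℝ), L ⊆ W → IsDefining P L W C →
      -- the constants `C^σ_{,I}` on `L`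
      (∃! c : Fin m → Fin k → ℝ, ∀ s, ∀ y ∈ L,
        mvfderiv (𝓡 n) (Cas s) y = ∑ I, c s I • mvfderiv (𝓡 n) (C I) y) ∧
      ∀ c : Fin m → Fin k → ℝ,
        (∀ s, ∀ y ∈ L, mvfderiv (𝓡 n) (Cas s) y = ∑ I, c s I • mvfderiv (𝓡 n) (C I) y) →
        -- `ε_I = ε_σ C^σ_{,I} = dp_I`
        ∀ p : Fin k → CovectorField 2 S,
          (∀ I, IsSmooth₁ (p I) ∧ HasExtDeriv₁ (p I) (∑ s, c s I • eps s)) →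
          -- the form of the solutions
          (∀ A : PullbackForm (n := n) X, IsSolution P Cas eps ⟨X, A⟩ ↔
            ∃! α : Fin k → CovectorField 2 S,
              (∀ I, IsSmooth₁ (α I) ∧ α I + p I ∈ closedForms 2 S) ∧ HasForm Ω C A α) ∧
          -- adding exact forms to `α_I` is a gauge transformation
          (∀ (A A' : PullbackForm (n := n) X) (α β : Fin k → CovectorField 2 S),
            IsSolution P Cas eps ⟨X, A⟩ → HasForm Ω C A α → (∀ I, β I ∈ exactForms 2 S) →
            HasForm Ω C A' (α + β) → GaugeTransform P Cas eps ⟨X, A⟩ ⟨X, A'⟩) ∧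
          -- gauge classes of solutions for fixed `X` are `k`-tuples of cohomology classes
          (∃ e : Quotient (gaugeSetoid P Cas eps X) ≃ (Fin k → H1 2 S),
            ∀ (A : SolutionsOver P Cas eps X) (α : Fin k → CovectorField 2 S)
              (hα : ∀ I, α I + p I ∈ closedForms 2 S), HasForm Ω C A.1 α →
              e (Quotient.mk _ A) = fun I => H1.mk (α I + p I) (hα I)) := by
  refine ⟨exists_isDefining hL hol hU hLU, fun W C hLW hC =>
    ⟨existsUnique_coefficients hL hLW hC hCas, fun c hc p hp => ?_⟩⟩
  have h : AdaptedData P L U W Ω C := ⟨hL, hU, hLU, hLW, hΩ, hC⟩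
  exact ⟨fun A => h.isSolution_iff hX hXL hc hp,
    fun A A' α β hsol hα hβ hα' => h.gaugeTransform_of_exact hX hXL hc hp hsol hα hβ hα',
    h.exists_equiv hX hXL hc hp⟩
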